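/- **Model.** Let $(x_t,\epsilon_t)_{t\in\mathbb Z}$ be a strictly stationary process with values in $\mathbb R^{d_x}\times\mathbb R$, where $x_t$ takes values in a bounded convex set. Let $R$ be a known $d_x\times d_z$ matrix of full column rank and $z_t=R'x_t$. For $t=1,\dots,T$ let $$y_t=x_t'\beta_0+\mathbf 1\{t>\lfloor\tau_0T\rfloor\}\,z_t'\delta_0+\epsilon_t ,$$ where the space of break locations $\mathcal H\subset(0,1)$ is measurable and $\tau_0$ is an interior point of $\mathcal H$. **Assumption 1.** (i) $\delta_0\neq0$. (ii) The $\epsilon_t$ are i.i.d. with $E(\epsilon_t|x_t)=0$ and $E(\epsilon_t^2|x_t)=\sigma_0^2>0$. (iii) $\Sigma_X=E[x_tx_t']=\operatorname{plim}\frac1T\sum_{t=1}^Tx_tx_t'$ exists and is positive definite. (iv) For all $0<\tau_1<\tau_2<1$, $\frac1T\sum_{t=\lfloor\tau_1T\rfloor+1}^{\lfloor\tau_2T\rfloor}x_t\epsilon_t=O_p(T^{-1/2})$ and $\frac1T\sum_{t=\lfloor\tau_1T\rfloor+1}^{\lfloor\tau_2T\rfloor}x_tx_t'=(\tau_2-\tau_1)\Sigma_X+O_p(T^{-1/2})$.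 **Likelihood and prior.** For $\gamma=(\beta',\delta')'$ and $\chi_{\tau,t}=(x_t',\mathbf 1\{t>\lfloor\tau T\rfloor\}z_t')'$ let $$p(Y_T|X_T,\gamma,\sigma^2,\tau)=\prod_{t=1}^T(2\pi\sigma^2)^{-1/2}\exp\Big(-\frac{(y_t-\chi_{\tau,t}'\gamma)^2}{2\sigma^2}\Big).$$ The prior is $\pi(\gamma,\sigma^2)\pi(\tau)$. Here $\pi(\gamma,\sigma^2)$ is the natural conjugate prior, $\gamma|\sigma^2\sim N(\underline\mu,\sigma^2\underline H^{-1})$ and $\sigma^2\sim InvGamma(\underline a,\underline b)$ with $\underline H$ positive definite and $\underline a,\underline b>0$; or it is its limit, the improper prior $\pi(\gamma,\sigma^2)\propto\sigma^{-2}$, in which case $\mathcal H$ is assumed to be bounded away from $0$ and $1$. The factor $\pi(\tau)$ is a finite probability density on $\mathcal H$ that is positive and continuous at $\tau_0$. Let $L_T(\tau)=\int p(Y_T|X_T,\gamma,\sigma^2,\tau)\,\pi(\gamma,\sigma^2)\,\pi(\tau)\,d(\gamma,\sigma^2)$, let $\pi_T=L_T/\int_{\mathcal H}L_T$ be the marginal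 posterior density of $\tau$, and let $\hat\tau_{Bayes}\in\operatorname{argmax}_{\tau\in\mathcal H}\pi_T(\tau)$ be the posterior mode (any measurable choice). Let $\hat\tau_{LS}\in\operatorname{argmin}_{\tau\in\mathcal H}S_T(\tau)$ be the least-squares estimator (any measurable choice), where $S_T(\tau)=\min_\gamma\sum_{t=1}^T(y_t-\chi_{\tau,t}'\gamma)^2$. **Limit.** Let $W^*(0)=0$ and $$W^*(m)=-\sum_{i=m+1}^0(\delta_0'z_i)^2+2\sum_{i=m+1}^0\delta_0'z_i\epsilon_i\quad(m<0),\qquad W^*(m)=-\sum_{i=1}^m(\delta_0'z_i)^2-2\sum_{i=1}^m\delta_0'z_i\epsilon_i\quad(m>0).$$ Assume that, almost surely, $W^*$ has at most one maximizer (as is the case under a continuous distribution of the increments of $W^*$), so that $\operatorname{argmax}_mW^*(m)$ is well defined. **Claim.** Almost surely $W^*$ attains its maximum, and as $T\to\infty$ $$\lfloor T\hat\tau_{Bayes}\rfloor-\lfloor T\tau_0\rfloor\ \xrightarrow{d}\ \operatorname{argmax}_{m\in\mathbb Z}W^*(m).$$ The least-squares estimator has the same limit law: $\lfloor T\hat\tau_{LS}\rfloor-\lfloor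 T\tau_0\rfloor\xrightarrow{d}\operatorname{argmax}_{m}W^*(m)$. -/

import Mathlib

open MeasureTheory ProbabilityTheory Filter Topology Matrix

namespace StructuralBreak

noncomputable section

/-! ### The regression model with one structural break -/

/-- The break date `⌊τ T⌋` that belongs to the break location `τ` in a sample of size `T`. -/
def breakDate (T : ℕ) (τ : ℝ) : ℤ := ⌊τ * (T : ℝ)⌋

/-- The row `χ_{τ,t}' = (x_t', 1{t > ⌊τ T⌋} z_t')` of the design matrix, where `z_t = R' x_t`. -/
def designRow {dx dz : ℕ} (R : Matrix (Fin dx) (Fin dz) ℝ) (T : ℕ) (τ : ℝ) (t : ℤ)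
    (v : Fin dx → ℝ) : Fin dx ⊕ Fin dz → ℝ :=
  Sum.elim v (if breakDate T τ < t then Rᵀ *ᵥ v else 0)

/-- The response `y_t` of the sample of size `T` when the slope coefficients are
`γ₀ = (β₀', δ₀')'` and the break location is `τ₀`. -/
def response {Ω : Type*} {dx dz : ℕ} (R : Matrix (Fin dx) (Fin dz) ℝ)
    (x : ℤ → Ω → Fin dx → ℝ) (ε : ℤ → Ω → ℝ) (β₀ : Fin dx → ℝ) (δ₀ : Fin dz → ℝ) (τ₀ : ℝ)
    (T : ℕ) (ω : Ω) (t : ℤ) : ℝ :=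
  designRow R T τ₀ t (x t ω) ⬝ᵥ Sum.elim β₀ δ₀ + ε t ω

/-! ### Stochastic order and the assumptions on the data generating process -/

/-- `Y_T = O_p(r_T)` as `T → ∞`. -/
def IsBigOp {Ω : Type*} [MeasurableSpace Ω] (P : Measure Ω) (Y : ℕ → Ω → ℝ) (r : ℕ → ℝ) : Prop :=
  ∀ η : ℝ, 0 < η → ∃ M : ℝ, ∀ᶠ T in atTop, P {ω | M * r T < |Y T ω|} ≤ ENNReal.ofReal η

/-- The assumptions on the data generating process: a nonzero shift, i.i.d. errors with
conditional mean zero and conditional variance `σ₀²`, second moment matrix `SigX` of the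
regressors, and `√T`-behaviour of the partial sums. -/
structure DGPAssumption {Ω : Type*} [MeasurableSpace Ω] (P : Measure Ω) {dx dz : ℕ}
    (x : ℤ → Ω → Fin dx → ℝ) (ε : ℤ → Ω → ℝ) (δ₀ : Fin dz → ℝ) (σsq₀ : ℝ)
    (SigX : Matrix (Fin dx) (Fin dx) ℝ) : Prop where
  delta_ne_zero : δ₀ ≠ 0
  eps_memLp : ∀ t, MemLp (ε t) 2 P
  eps_indep : iIndepFun ε P
  eps_identDistrib : ∀ s t, IdentDistrib (ε s) (ε t) P P
  eps_condMean : ∀ t, P[ε t | MeasurableSpace.comap (x t) inferInstance] =ᵐ[P] fun _ => 0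
  eps_condVar : ∀ t,
    P[fun ω => ε t ω ^ 2 | MeasurableSpace.comap (x t) inferInstance] =ᵐ[P] fun _ => σsq₀
  secondMoment : ∀ t i j, ∫ ω, x t ω i * x t ω j ∂P = SigX i j
  secondMoment_plim : ∀ i j, TendstoInMeasure P
    (fun (T : ℕ) ω => (1 / (T : ℝ)) * ∑ t ∈ Finset.Icc (1 : ℤ) T, x t ω i * x t ω j) atTop
    (fun _ => SigX i j)
  secondMoment_posDef : SigX.PosDef
  partialSum_xε : ∀ τ₁ τ₂ : ℝ, 0 < τ₁ → τ₁ < τ₂ → τ₂ < 1 → ∀ i, IsBigOp P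
    (fun T ω => (1 / (T : ℝ)) *
      ∑ t ∈ Finset.Icc (breakDate T τ₁ + 1) (breakDate T τ₂), x t ω i * ε t ω)
    (fun T => (T : ℝ) ^ (-(1 / 2) : ℝ))
  partialSum_xx : ∀ τ₁ τ₂ : ℝ, 0 < τ₁ → τ₁ < τ₂ → τ₂ < 1 → ∀ i j, IsBigOp P
    (fun T ω => (1 / (T : ℝ)) *
      ∑ t ∈ Finset.Icc (breakDate T τ₁ + 1) (breakDate T τ₂), x t ω i * x t ω j
        - (τ₂ - τ₁) * SigX i j)
    (fun T => (T : ℝ) ^ (-(1 / 2) : ℝ))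

/-- Strict stationarity of the joint process `(x_t, ε_t)`, `t ∈ ℤ`. -/
def IsStrictlyStationary {Ω : Type*} [MeasurableSpace Ω] (P : Measure Ω) {dx : ℕ}
    (x : ℤ → Ω → Fin dx → ℝ) (ε : ℤ → Ω → ℝ) : Prop :=
  ∀ h : ℤ, P.map (fun ω (t : ℤ) => (x (t + h) ω, ε (t + h) ω))
    = P.map (fun ω (t : ℤ) => (x t ω, ε t ω))

/-! ### Likelihood, prior, posterior, estimators

Below `X t` and `Y t` are the observed regressors and responses, only `t = 1, …, T` being used;
`γ = (β', δ')'` is the vector of slopes and `s` stands for the error variance `σ²`. -/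

/-- The normal likelihood `p(Y_T | X_T, γ, σ², τ)`. -/
def normalLikelihood {dx dz : ℕ} (R : Matrix (Fin dx) (Fin dz) ℝ) (T : ℕ)
    (X : ℤ → Fin dx → ℝ) (Y : ℤ → ℝ) (τ : ℝ) (γ : Fin dx ⊕ Fin dz → ℝ) (s : ℝ) : ℝ :=
  ∏ t ∈ Finset.Icc (1 : ℤ) T,
    1 / √(2 * Real.pi * s) * Real.exp (-(Y t - designRow R T τ t (X t) ⬝ᵥ γ) ^ 2 / (2 * s))

/-- The density of the normal distribution `N(μ, s H⁻¹)`. -/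
def normalDensity {ι : Type*} [Fintype ι] [DecidableEq ι] (μ : ι → ℝ) (H : Matrix ι ι ℝ)
    (s : ℝ) (γ : ι → ℝ) : ℝ :=
  (2 * Real.pi * s) ^ (-(Fintype.card ι : ℝ) / 2) * √H.det *
    Real.exp (-((γ - μ) ⬝ᵥ (H *ᵥ (γ - μ))) / (2 * s))

/-- The density of the inverse gamma distribution with shape `a` and scale `b`. -/
def invGammaDensity (a b s : ℝ) : ℝ :=
  b ^ a / Real.Gamma a * s ^ (-a - 1) * Real.exp (-b / s)

/-- The natural conjugate prior: `γ | σ² ∼ N(μ, σ² H⁻¹)` and `σ² ∼ InvGamma(a, b)`. -/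
def conjugatePrior {ι : Type*} [Fintype ι] [DecidableEq ι] (μ : ι → ℝ) (H : Matrix ι ι ℝ)
    (a b : ℝ) (γ : ι → ℝ) (s : ℝ) : ℝ :=
  normalDensity μ H s γ * invGammaDensity a b s

/-- The uninformative improper prior, proportional to `σ⁻²`. -/
def improperPrior {ι : Type*} (_γ : ι → ℝ) (s : ℝ) : ℝ := 1 / s

/-- `L_T(τ) = ∫ p(Y_T | X_T, θ, τ) π(θ, τ) dθ` for the prior `π(θ, τ) = prior(γ, σ²) priorτ(τ)`. -/
def marginalLikelihood {dx dz : ℕ} (R : Matrix (Fin dx) (Fin dz) ℝ)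
    (prior : (Fin dx ⊕ Fin dz → ℝ) → ℝ → ℝ) (priorτ : ℝ → ℝ) (T : ℕ)
    (X : ℤ → Fin dx → ℝ) (Y : ℤ → ℝ) (τ : ℝ) : ENNReal :=
  ∫⁻ s in Set.Ioi (0 : ℝ), ∫⁻ γ : Fin dx ⊕ Fin dz → ℝ,
    ENNReal.ofReal (normalLikelihood R T X Y τ γ s * (prior γ s * priorτ τ))

/-- The marginal posterior density `π_T(τ) = L_T(τ) / ∫ L_T` of the break location. -/
def posteriorDensity {dx dz : ℕ} (R : Matrix (Fin dx) (Fin dz) ℝ)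
    (prior : (Fin dx ⊕ Fin dz → ℝ) → ℝ → ℝ) (priorτ : ℝ → ℝ) (𝓗 : Set ℝ) (T : ℕ)
    (X : ℤ → Fin dx → ℝ) (Y : ℤ → ℝ) (τ : ℝ) : ENNReal :=
  marginalLikelihood R prior priorτ T X Y τ /
    ∫⁻ u in 𝓗, marginalLikelihood R prior priorτ T X Y u

/-- `τ` is a posterior mode: it maximizes `π_T` over `𝓗`. -/
def IsPosteriorMode {dx dz : ℕ} (R : Matrix (Fin dx) (Fin dz) ℝ)
    (prior : (Fin dx ⊕ Fin dz → ℝ) → ℝ → ℝ) (priorτ : ℝ → ℝ) (𝓗 : Set ℝ) (T : ℕ)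
    (X : ℤ → Fin dx → ℝ) (Y : ℤ → ℝ) (τ : ℝ) : Prop :=
  τ ∈ 𝓗 ∧ IsMaxOn (posteriorDensity R prior priorτ 𝓗 T X Y) 𝓗 τ

/-- The sum of squared residuals `S_T(τ)` of the regression given `τ`. -/
def ssr {dx dz : ℕ} (R : Matrix (Fin dx) (Fin dz) ℝ) (T : ℕ)
    (X : ℤ → Fin dx → ℝ) (Y : ℤ → ℝ) (τ : ℝ) : ℝ :=
  ⨅ γ : Fin dx ⊕ Fin dz → ℝ,
    ∑ t ∈ Finset.Icc (1 : ℤ) T, (Y t - designRow R T τ t (X t) ⬝ᵥ γ) ^ 2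

/-- `τ` is a least-squares estimate: it minimizes `S_T` over `𝓗`. -/
def IsLeastSquares {dx dz : ℕ} (R : Matrix (Fin dx) (Fin dz) ℝ) (𝓗 : Set ℝ) (T : ℕ)
    (X : ℤ → Fin dx → ℝ) (Y : ℤ → ℝ) (τ : ℝ) : Prop :=
  τ ∈ 𝓗 ∧ IsMinOn (ssr R T X Y) 𝓗 τ

/-! ### The limit -/

/-- The two-sided random walk `W*(m)`, `m ∈ ℤ`; both sums are empty at `m = 0`. -/
def Wstar {Ω : Type*} {dx dz : ℕ} (R : Matrix (Fin dx) (Fin dz) ℝ)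
    (x : ℤ → Ω → Fin dx → ℝ) (ε : ℤ → Ω → ℝ) (δ₀ : Fin dz → ℝ) (ω : Ω) (m : ℤ) : ℝ :=
  if m < 0 then
    -(∑ i ∈ Finset.Icc (m + 1) 0, (δ₀ ⬝ᵥ (Rᵀ *ᵥ x i ω)) ^ 2)
      + 2 * ∑ i ∈ Finset.Icc (m + 1) 0, (δ₀ ⬝ᵥ (Rᵀ *ᵥ x i ω)) * ε i ω
  else
    -(∑ i ∈ Finset.Icc 1 m, (δ₀ ⬝ᵥ (Rᵀ *ᵥ x i ω)) ^ 2)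
      - 2 * ∑ i ∈ Finset.Icc 1 m, (δ₀ ⬝ᵥ (Rᵀ *ᵥ x i ω)) * ε i ω

/-- `m` is a maximizer of the two-sided sequence `w`. -/
def IsArgmax (w : ℤ → ℝ) (m : ℤ) : Prop := ∀ k, w k ≤ w m

open Classical in
/-- `argmax_m w(m)`, with the value `0` where the maximum is not attained. -/
def argmax (w : ℤ → ℝ) : ℤ := if h : ∃ m, IsArgmax w m then h.choose else 0

end

end StructuralBreak

open StructuralBreak

open StructuralBreak

/-! ### Almost sure bounds for ergodic sums -/

section Ergodic

variable {S : Type*}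

/-! With `u = β - β₀`, `w = R δ` and `w₀ = R δ₀`, both estimators compare the function `k ↦ profile
… k`, the (penalized) sum of squares minimized over the slopes, at different break dates `k`. The
claim rests on one deterministic fact: in a sample with well-behaved blocks, the profile at `k₀`
minus the profile at `k` is nearly the random walk started at the true date `k₀` when `k` is near
`k₀`, and the profile grows at least linearly in `|k - k₀|` further out. If the maximizer of that
walk beats all other values by a definite gap, then the estimated date minus `k₀` equals the
maximizer exactly.

The limit law then needs no functional limit theorem. The walk started at `k₀` is a fixed function
of the path shifted by `k₀`, so by stationarity its argmax has the law of `argmax W*` for every `T`.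
An integer sequence that agrees with it with probability tending to one converges in distribution
(`tendstoInDistribution_argmax`).

A block is well behaved if the empirical second moments of regressors and errors are within `κ` per
observation of their means. All long blocks at one anchor must be controlled at once, so convergence
in probability is upgraded to almost sure convergence by a maximal ergodic theorem
(`ae_tendsto_birkhoffSum`). By stationarity, one length threshold then serves, up to small
probability, for the three moving anchors `0`, `k₀`, `T`. On good blocks the sum of squares is
coercive (`SampleGood.le_residualSq`). This localizes the slopes (`exists_localization`) and yields
`exists_profile_growth` and `exists_profile_near`. The same control gives `W*` negative drift, hence
a maximizer; with the assumed uniqueness there is also a gap (`exists_gap`).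

For the posterior mode, integrating out `γ` and `σ²` gives `p(τ) · gaussMass(designForm τ) ·
q(τ)^(-ν)` up to a constant, where `q` is the profile plus a rate and `ν` is of order `T/2`. Since
`q` is of order `T`, an increment `Δ` of `q` multiplies the power by at least `1 + Δ/(4A)`, and by
an exponentially large factor if `Δ` is of order `T`. The Gaussian masses differ by at most a power
of `T` in general, by a bounded factor for dates away from the ends, and by a factor near one for
dates close to `k₀`. The prior ratio is bounded, because a mode exists, and is near one close to
`τ₀`. These three regimes confine the mode successively to `|k - k₀| < cT`, to a bounded window, and
to the argmax (`posteriorMode_eq_argmax`). -/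

/-- The running maximum `max_{0 ≤ k ≤ n} ∑_{i < k} g (θ^i x)`, defined recursively. -/
noncomputable def ergodicMax (θ : S → S) (g : S → ℝ) : ℕ → S → ℝ
  | 0, _ => 0
  | n + 1, x => max 0 (g x + ergodicMax θ g n (θ x))

theorem ergodicMax_nonneg (θ : S → S) (g : S → ℝ) (n : ℕ) (x : S) : 0 ≤ ergodicMax θ g n x := by
  cases n with
  | zero => exact le_rfl
  | succ n => exact le_max_left _ _

theorem ergodicMax_le_succ (θ : S → S) (g : S → ℝ) (n : ℕ) (x : S) :
    ergodicMax θ g n x ≤ ergodicMax θ g (n + 1) x := by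
  induction n generalizing x with
  | zero => exact le_max_left _ _
  | succ n ih =>
    simp only [ergodicMax] at ih ⊢
    exact max_le_max le_rfl (by linarith [ih (θ x)])

theorem birkhoffSum_le_ergodicMax (θ : S → S) (g : S → ℝ) {k n : ℕ} (hk : k ≤ n) (x : S) :
    birkhoffSum θ g k x ≤ ergodicMax θ g n x := by
  induction n generalizing x k with
  | zero =>
    obtain rfl : k = 0 := by omega
    simp [ergodicMax]
  | succ n ih =>
    cases k with
    | zero => simpa using ergodicMax_nonneg θ g (n + 1) x
    | succ k =>
      rw [birkhoffSum_succ']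
      exact le_max_of_le_right (by linarith [ih (k := k) (by omega) (θ x)])

/-- The set on which the ergodic sums of `g` are unbounded above. -/
def ergodicUnbounded (θ : S → S) (g : S → ℝ) : Set S :=
  {x | ∀ C : ℕ, ∃ n, (C : ℝ) < birkhoffSum θ g n x}

/-- Dropping the first term changes every sum by the single number `g x`, which does not affect
unboundedness. Invariance is what makes the integrals over this set insensitive to `θ`. -/
theorem preimage_ergodicUnbounded (θ : S → S) (g : S → ℝ) :
    θ ⁻¹' ergodicUnbounded θ g = ergodicUnbounded θ g := by
  ext x
  constructor
  · intro h C
    obtain ⟨C', hC'⟩ := exists_nat_ge ((C : ℝ) + |g x|)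
    obtain ⟨n, hn⟩ := h C'
    refine ⟨n + 1, ?_⟩
    rw [birkhoffSum_succ']
    linarith [neg_abs_le (g x)]
  · intro h C
    obtain ⟨C', hC'⟩ := exists_nat_ge ((C : ℝ) + |g x|)
    obtain ⟨n, hn⟩ := h C'
    cases n with
    | zero =>
      rw [birkhoffSum_zero] at hn
      exact absurd hn (not_lt.mpr (Nat.cast_nonneg _))
    | succ n =>
      rw [birkhoffSum_succ'] at hn
      exact ⟨n, by linarith [le_abs_self (g x)]⟩

variable [MeasurableSpace S] {μ : Measure S} {θ : S → S}

theorem setIntegral_comp_of_preimage_eq (hθ : MeasurePreserving θ μ μ) {B : Set S}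
    (hB : MeasurableSet B) (hinv : θ ⁻¹' B = B) {f : S → ℝ} (hf : Measurable f) :
    ∫ x in B, f (θ x) ∂μ = ∫ x in B, f x ∂μ := by
  have h := setIntegral_map (μ := μ) (g := θ) (f := f) hB
    (by rw [hθ.map_eq]; exact hf.aestronglyMeasurable) hθ.measurable.aemeasurable
  rw [hθ.map_eq, hinv] at h
  exact h.symm

theorem measurable_ergodicMax (hθ : Measurable θ) {g : S → ℝ} (hg : Measurable g) (n : ℕ) :
    Measurable (ergodicMax θ g n) := by
  induction n with
  | zero => exact measurable_const
  | succ n ih => exact measurable_const.max (hg.add (ih.comp hθ))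

theorem integrable_ergodicMax [IsFiniteMeasure μ] (hθ : MeasurePreserving θ μ μ) {g : S → ℝ}
    (hg : Integrable g μ) (n : ℕ) : Integrable (ergodicMax θ g n) μ := by
  induction n with
  | zero => exact integrable_const _
  | succ n ih =>
    exact (integrable_const (0 : ℝ)).sup (hg.add (hθ.integrable_comp_of_integrable ih))

theorem measurable_birkhoffSum (hθ : Measurable θ) {g : S → ℝ} (hg : Measurable g) (n : ℕ) :
    Measurable (birkhoffSum θ g n) := by
  unfold birkhoffSum
  exact Finset.measurable_sum _ fun i _ => hg.comp (hθ.iterate i)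

theorem measurableSet_ergodicUnbounded (hθ : Measurable θ) {g : S → ℝ} (hg : Measurable g) :
    MeasurableSet (ergodicUnbounded θ g) := by
  have : ergodicUnbounded θ g = ⋂ C : ℕ, ⋃ n, {x | (C : ℝ) < birkhoffSum θ g n x} := by
    ext; simp [ergodicUnbounded]
  rw [this]
  exact MeasurableSet.iInter fun C => MeasurableSet.iUnion fun n =>
    measurableSet_lt measurable_const (measurable_birkhoffSum hθ hg n)

/-- **Maximal ergodic theorem**, on the set where the ergodic sums are unbounded. -/
theorem setIntegral_ergodicUnbounded_nonneg [IsFiniteMeasure μ] (hθ : MeasurePreserving θ μ μ)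
    {g : S → ℝ} (hg : Measurable g) (hgi : Integrable g μ) :
    0 ≤ ∫ x in ergodicUnbounded θ g, g x ∂μ := by
  set B := ergodicUnbounded θ g with hBdef
  have hB : MeasurableSet B := measurableSet_ergodicUnbounded hθ.measurable hg
  have hinv : θ ⁻¹' B = B := preimage_ergodicUnbounded θ g
  have hM := fun n => integrable_ergodicMax hθ hgi n
  have hMθ := fun n => hθ.integrable_comp_of_integrable (hM n)
  have hbound : ∀ n x, ‖ergodicMax θ g (n + 1) x - ergodicMax θ g n (θ x)‖ ≤ |g x| := by
    intro n x
    have h0 := ergodicMax_nonneg θ g n (θ x)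
    simp only [ergodicMax, Real.norm_eq_abs]
    rcases max_cases 0 (g x + ergodicMax θ g n (θ x)) with ⟨h, h'⟩ | ⟨h, h'⟩ <;> rw [h, abs_le] <;>
      constructor <;> linarith [neg_abs_le (g x), le_abs_self (g x)]
  have hlim : Tendsto (fun n => ∫ x in B, (ergodicMax θ g (n + 1) x - ergodicMax θ g n (θ x)) ∂μ)
      atTop (𝓝 (∫ x in B, g x ∂μ)) := by
    refine tendsto_integral_of_dominated_convergence (fun x => |g x|) ?_ hgi.abs.integrableOn ?_ ?_
    · exact fun n => ((hM (n + 1)).sub (hMθ n)).aestronglyMeasurable.restrict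
    · exact fun n => ae_of_all _ (hbound n)
    · refine (ae_restrict_iff' hB).2 (ae_of_all _ fun x hx => ?_)
      have hx' : θ x ∈ B := by rwa [← hinv] at hx
      -- Since `θ x` has unbounded sums too, its running maximum eventually exceeds `|g x|`. From
      -- then on the truncation at `0` is inactive and the difference is exactly `g x`.
      obtain ⟨C, hC⟩ := exists_nat_ge |g x|
      obtain ⟨k, hk⟩ := hx' C
      refine tendsto_const_nhds.congr' ?_
      filter_upwards [eventually_ge_atTop k] with n hn
      have h1 := birkhoffSum_le_ergodicMax θ g hn (θ x)
      simp only [ergodicMax]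
      rw [max_eq_right (by linarith [neg_abs_le (g x)])]
      ring
  -- Invariance replaces the running maximum at `θ x` by the one at `x`, and running maxima increase
  -- with `n`, so each approximating integral is nonnegative.
  refine ge_of_tendsto' hlim fun n => ?_
  rw [integral_sub (g := fun x => ergodicMax θ g n (θ x)) (hM (n + 1)).integrableOn
    (hMθ n).integrableOn]
  have h1 : ∫ x in B, ergodicMax θ g n (θ x) ∂μ = ∫ x in B, ergodicMax θ g n x ∂μ :=
    setIntegral_comp_of_preimage_eq hθ hB hinv (measurable_ergodicMax hθ.measurable hg n)
  have h2 : ∫ x in B, ergodicMax θ g n x ∂μ ≤ ∫ x in B, ergodicMax θ g (n + 1) x ∂μ :=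
    setIntegral_mono (hM n).integrableOn (hM (n + 1)).integrableOn (ergodicMax_le_succ θ g n)
  linarith

/-- If the ergodic averages of `f` converge to `c` in mean, then almost surely the ergodic sums
are eventually below the line of slope `c + δ`, up to a constant. -/
theorem ae_birkhoffSum_le [IsProbabilityMeasure μ] (hθ : MeasurePreserving θ μ μ)
    {f : S → ℝ} (hf : Measurable f) (hfi : Integrable f μ) (c : ℝ)
    (hL : Tendsto (fun n : ℕ => ∫ x, |(n : ℝ)⁻¹ * birkhoffSum θ f n x - c| ∂μ) atTop (𝓝 0))
    {δ : ℝ} (hδ : 0 < δ) :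
    ∀ᵐ x ∂μ, ∃ K : ℝ, ∀ n : ℕ, birkhoffSum θ f n x ≤ n * (c + δ) + K := by
  set g : S → ℝ := fun x => f x - (c + δ) with hgdef
  have hg : Measurable g := hf.sub_const _
  have hgi : Integrable g μ := hfi.sub (integrable_const _)
  have hS : ∀ n x, birkhoffSum θ g n x = birkhoffSum θ f n x - n * (c + δ) := by
    intro n x
    simp [birkhoffSum, hgdef, Finset.sum_sub_distrib, mul_add]
  set B := ergodicUnbounded θ g with hBdef
  have hB : MeasurableSet B := measurableSet_ergodicUnbounded hθ.measurable hg
  have hinv : θ ⁻¹' B = B := preimage_ergodicUnbounded θ g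
  have hinvi : ∀ i : ℕ, θ^[i] ⁻¹' B = B := by
    intro i
    induction i with
    | zero => rfl
    | succ i ih => rw [Function.iterate_succ, Set.preimage_comp, ih, hinv]
  have hfi' : ∀ i : ℕ, Integrable (fun x => f (θ^[i] x)) μ := fun i =>
    (hθ.iterate i).integrable_comp_of_integrable hfi
  have hSint : ∀ n, Integrable (birkhoffSum θ f n) μ := fun n => by
    unfold birkhoffSum
    exact integrable_finsetSum _ fun i _ => hfi' i
  have hSB : ∀ n : ℕ, ∫ x in B, birkhoffSum θ f n x ∂μ = n * ∫ x in B, f x ∂μ := by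
    intro n
    unfold birkhoffSum
    rw [integral_finsetSum _ fun i _ => (hfi' i).integrableOn]
    rw [Finset.sum_congr rfl fun i _ =>
      setIntegral_comp_of_preimage_eq (hθ.iterate i) hB (hinvi i) hf]
    simp
  -- On the invariant set every ergodic average has the same integral as `f`. Mean convergence
  -- therefore forces this integral to be `c * μ B`, and the maximal inequality for `f - (c + δ)`
  -- becomes `0 ≤ -δ * μ B`.
  have hmean : |∫ x in B, f x ∂μ - c * μ.real B| ≤ 0 := by
    refine ge_of_tendsto hL ?_
    filter_upwards [eventually_gt_atTop 0] with n hn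
    have hn' : (n : ℝ) ≠ 0 := by positivity
    have hi : Integrable (fun x => (n : ℝ)⁻¹ * birkhoffSum θ f n x - c) μ :=
      ((hSint n).const_mul _).sub (integrable_const _)
    have h1 : ∫ x in B, ((n : ℝ)⁻¹ * birkhoffSum θ f n x - c) ∂μ
        = ∫ x in B, f x ∂μ - c * μ.real B := by
      rw [integral_sub ((hSint n).const_mul _).integrableOn (integrable_const _).integrableOn,
        integral_const_mul, hSB]
      simp [hn', mul_comm]
    rw [← h1]
    refine (abs_integral_le_integral_abs).trans ?_
    exact setIntegral_le_integral hi.abs (ae_of_all _ fun x => abs_nonneg _)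
  have hmean' : ∫ x in B, f x ∂μ = c * μ.real B := by
    have := abs_nonpos_iff.mp hmean
    linarith
  have hpos := setIntegral_ergodicUnbounded_nonneg hθ hg hgi
  have hgB : ∫ x in B, g x ∂μ = -(δ * μ.real B) := by
    simp only [hgdef]
    rw [integral_sub hfi.integrableOn (integrable_const _).integrableOn, hmean']
    simp
    ring
  rw [← hBdef, hgB] at hpos
  have hB0 : μ B = 0 := by
    have h0 : 0 ≤ μ.real B := measureReal_nonneg
    have : μ.real B = 0 := by nlinarith
    exact (measureReal_eq_zero_iff).1 this
  filter_upwards [measure_eq_zero_iff_ae_notMem.1 hB0] with x hx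
  simp only [hBdef, ergodicUnbounded, Set.mem_ofPred_eq, not_forall, not_exists, not_lt] at hx
  obtain ⟨C, hC⟩ := hx
  exact ⟨C, fun n => by linarith [hC n, hS n x]⟩

/-- **Pointwise ergodic theorem** in the case of a constant limit in probability. -/
theorem ae_tendsto_birkhoffSum [IsProbabilityMeasure μ] (hθ : MeasurePreserving θ μ μ)
    {f : S → ℝ} (hf : Measurable f) (hfi : Integrable f μ) (c : ℝ)
    (hL : TendstoInMeasure μ (fun (n : ℕ) x => (n : ℝ)⁻¹ * birkhoffSum θ f n x) atTop
      (fun _ => c)) {κ : ℝ} (hκ : 0 < κ) :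
    ∀ᵐ x ∂μ, ∃ N : ℕ, ∀ n : ℕ, N ≤ n → |birkhoffSum θ f n x - n * c| ≤ κ * n := by
  have hmono : ∀ h : S → ℝ, Measurable h → Integrable h μ → ∀ c' : ℝ,
      Tendsto (fun n : ℕ => ∫ x, |(n : ℝ)⁻¹ * birkhoffSum θ h n x - c'| ∂μ) atTop (𝓝 0) →
      ∀ᵐ x ∂μ, ∃ N : ℕ, ∀ n : ℕ, N ≤ n → birkhoffSum θ h n x - n * c' ≤ κ * n := by
    intro h hh hhi c' hL'
    filter_upwards [ae_birkhoffSum_le hθ hh hhi c' hL' (half_pos hκ)] with x hx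
    obtain ⟨K, hK⟩ := hx
    -- The slope was exceeded by `κ / 2` only; the other half absorbs the constant `K`.
    obtain ⟨N, hN⟩ := exists_nat_ge (K / (κ / 2))
    refine ⟨N, fun n hn => ?_⟩
    have h1 : (N : ℝ) ≤ n := by exact_mod_cast hn
    have h2 : K ≤ n * (κ / 2) := (div_le_iff₀ (half_pos hκ)).1 (hN.trans h1)
    linarith [hK n]
  have hident : ∀ i : ℕ, IdentDistrib (fun x => f (θ^[i] x)) (fun x => f (θ^[0] x)) μ μ := by
    intro i
    refine ⟨(hf.comp (hθ.iterate i).measurable).aemeasurable, hf.aemeasurable, ?_⟩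
    have := Measure.map_map (μ := μ) hf (hθ.iterate i).measurable
    rw [(hθ.iterate i).map_eq] at this
    exact this.symm
  -- The summands are identically distributed, hence they and their averages are uniformly
  -- integrable. This upgrades convergence in probability to convergence in mean.
  have hUI : UniformIntegrable (fun (i : ℕ) x => f (θ^[i] x)) 1 μ :=
    MemLp.uniformIntegrable_of_identDistrib (j := 0) le_rfl ENNReal.one_ne_top
      (memLp_one_iff_integrable.2 hfi) hident
  have hUI' := uniformIntegrable_average (le_refl 1) hUI
  have heq : (fun n : ℕ => (n : ℝ)⁻¹ • ∑ i ∈ Finset.range n, fun x => f (θ^[i] x))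
      = fun (n : ℕ) x => (n : ℝ)⁻¹ * birkhoffSum θ f n x := by
    ext n x
    simp [birkhoffSum]
  rw [heq] at hUI'
  have hLp := tendsto_Lp_finite_of_tendstoInMeasure (le_refl 1) ENNReal.one_ne_top hUI'.1
    (memLp_const c) hUI'.2.1 hL
  have hL1 : Tendsto (fun n : ℕ => ∫ x, |(n : ℝ)⁻¹ * birkhoffSum θ f n x - c| ∂μ) atTop
      (𝓝 0) := by
    have h := (ENNReal.tendsto_toReal ENNReal.zero_ne_top).comp hLp
    simp only [ENNReal.toReal_zero] at h
    refine h.congr fun n => ?_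
    have hm : AEStronglyMeasurable (fun x => (n : ℝ)⁻¹ * birkhoffSum θ f n x - c) μ :=
      (hUI'.1 n).sub aestronglyMeasurable_const
    simp only [Function.comp]
    rw [eLpNorm_one_eq_lintegral_enorm]
    exact (integral_norm_eq_lintegral_enorm hm).symm
  have hL2 : Tendsto (fun n : ℕ => ∫ x, |(n : ℝ)⁻¹ * birkhoffSum θ (fun y => -f y) n x - (-c)| ∂μ)
      atTop (𝓝 0) := by
    refine hL1.congr fun n => integral_congr_ae (ae_of_all _ fun x => ?_)
    simp only [birkhoffSum, Finset.sum_neg_distrib]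
    rw [← abs_neg]
    ring_nf
  filter_upwards [hmono f hf hfi c hL1, hmono _ hf.neg hfi.neg (-c) hL2] with x h1 h2
  obtain ⟨N1, h1⟩ := h1
  obtain ⟨N2, h2⟩ := h2
  refine ⟨max N1 N2, fun n hn => abs_le.2 ⟨?_, h1 n (le_of_max_le_left hn)⟩⟩
  have := h2 n (le_of_max_le_right hn)
  simp only [birkhoffSum, Pi.neg_apply, Finset.sum_neg_distrib] at this
  simp only [birkhoffSum]
  linarith

end Ergodic

/-! ### Deterministic bounds on blocks of observations -/

section Blocks

variable {d : ℕ}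

theorem sq_dotProduct_le {ι : Type*} [Fintype ι] (a v : ι → ℝ) :
    (a ⬝ᵥ v) ^ 2 ≤ (a ⬝ᵥ a) * (v ⬝ᵥ v) := by
  have := Finset.sum_mul_sq_le_sq_mul_sq Finset.univ a v
  simpa [dotProduct, pow_two] using this

theorem dotProduct_self_nonneg' {ι : Type*} [Fintype ι] (v : ι → ℝ) : 0 ≤ v ⬝ᵥ v :=
  Finset.sum_nonneg fun i _ => mul_self_nonneg (v i)

theorem dotProduct_self_add_le {ι : Type*} [Fintype ι] (v w : ι → ℝ) :
    (v + w) ⬝ᵥ (v + w) ≤ 2 * (v ⬝ᵥ v) + 2 * (w ⬝ᵥ w) := by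
  simp only [dotProduct, Finset.mul_sum, ← Finset.sum_add_distrib, Pi.add_apply]
  exact Finset.sum_le_sum fun i _ => by nlinarith [sq_nonneg (v i - w i)]

theorem dotProduct_self_sub_le {ι : Type*} [Fintype ι] (v w : ι → ℝ) :
    (v - w) ⬝ᵥ (v - w) ≤ 2 * (v ⬝ᵥ v) + 2 * (w ⬝ᵥ w) := by
  simp only [dotProduct, Finset.mul_sum, ← Finset.sum_add_distrib, Pi.sub_apply]
  exact Finset.sum_le_sum fun i _ => by nlinarith [sq_nonneg (v i + w i)]

/-- The form has a positive minimum on the compact unit sphere; homogeneity does the rest. -/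
theorem exists_dotProduct_mulVec_ge {ι : Type*} [Fintype ι] [DecidableEq ι]
    {A : Matrix ι ι ℝ} (hA : A.PosDef) :
    ∃ l > 0, ∀ v : ι → ℝ, l * (v ⬝ᵥ v) ≤ v ⬝ᵥ (A *ᵥ v) := by
  rcases isEmpty_or_nonempty ι with hι | hι
  · exact ⟨1, one_pos, fun v => by simp [dotProduct]⟩
  have hcont : Continuous fun v : ι → ℝ => v ⬝ᵥ (A *ᵥ v) := by
    simp only [dotProduct, mulVec]
    fun_prop
  have hcont' : Continuous fun v : ι → ℝ => v ⬝ᵥ v := by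
    simp only [dotProduct]
    fun_prop
  have hK : IsCompact {v : ι → ℝ | v ⬝ᵥ v = 1} := by
    refine Metric.isCompact_of_isClosed_isBounded (isClosed_eq hcont' continuous_const) ?_
    refine (Metric.isBounded_iff_subset_closedBall 0).2 ⟨1, fun v hv => ?_⟩
    rw [mem_closedBall_zero_iff, pi_norm_le_iff_of_nonneg zero_le_one]
    intro i
    have h1 : v i * v i ≤ v ⬝ᵥ v :=
      Finset.single_le_sum (f := fun i => v i * v i) (fun j _ => mul_self_nonneg _)
        (Finset.mem_univ i)
    have h2 : v ⬝ᵥ v = 1 := hv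
    rw [Real.norm_eq_abs, abs_le]
    constructor <;> nlinarith
  have hne : {v : ι → ℝ | v ⬝ᵥ v = 1}.Nonempty := by
    classical
    exact ⟨Pi.single (Classical.arbitrary ι) 1, by simp⟩
  obtain ⟨v0, hv0, hmin⟩ := hK.exists_isMinOn hne hcont.continuousOn
  have hv0' : v0 ⬝ᵥ v0 = 1 := hv0
  have hv0ne : v0 ≠ 0 := by
    rintro rfl
    simp at hv0'
  have hpos : 0 < v0 ⬝ᵥ (A *ᵥ v0) := by
    simpa using hA.dotProduct_mulVec_pos hv0ne
  refine ⟨v0 ⬝ᵥ (A *ᵥ v0), hpos, fun v => ?_⟩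
  rcases eq_or_lt_of_le (dotProduct_self_nonneg' v) with h | h
  · have hv : v = 0 := dotProduct_self_eq_zero.1 h.symm
    simp [hv]
  · set c := √(v ⬝ᵥ v) with hc
    have hcpos : 0 < c := Real.sqrt_pos.2 h
    have hcsq : c * c = v ⬝ᵥ v := Real.mul_self_sqrt h.le
    have hmem : c⁻¹ • v ∈ {v : ι → ℝ | v ⬝ᵥ v = 1} := by
      change (c⁻¹ • v) ⬝ᵥ (c⁻¹ • v) = 1
      rw [smul_dotProduct, dotProduct_smul, ← hcsq, smul_eq_mul, smul_eq_mul]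
      field_simp
    have h1 : v0 ⬝ᵥ (A *ᵥ v0) ≤ (c⁻¹ • v) ⬝ᵥ (A *ᵥ (c⁻¹ • v)) := hmin hmem
    rw [mulVec_smul, smul_dotProduct, dotProduct_smul, smul_eq_mul, smul_eq_mul] at h1
    have h2 := mul_le_mul_of_nonneg_right h1 (mul_pos hcpos hcpos).le
    rw [← hcsq]
    refine h2.trans_eq ?_
    field_simp

/-- On the block `B` the empirical second moments of regressors `a` and errors `e` are within
`κ` of their expectations `Sig`, `0` and `v`. -/
structure BlockGood (κ : ℝ) (Sig : Matrix (Fin d) (Fin d) ℝ) (v : ℝ) (a : ℤ → Fin d → ℝ)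
    (e : ℤ → ℝ) (B : Finset ℤ) : Prop where
  xx : ∀ i j, |∑ t ∈ B, a t i * a t j - B.card * Sig i j| ≤ κ * B.card
  xe : ∀ i, |∑ t ∈ B, a t i * e t| ≤ κ * B.card
  ee : |∑ t ∈ B, e t ^ 2 - B.card * v| ≤ κ * B.card

/-- All blocks of length at least `N` that start or end at `p` are good. -/
def AnchorGood (κ : ℝ) (N : ℕ) (Sig : Matrix (Fin d) (Fin d) ℝ) (v : ℝ) (a : ℤ → Fin d → ℝ)
    (e : ℤ → ℝ) (p : ℤ) : Prop :=
  ∀ q : ℤ, (N : ℤ) ≤ |q - p| →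
    BlockGood κ Sig v a e (Finset.Ioc p q) ∧ BlockGood κ Sig v a e (Finset.Ioc q p)

variable {κ κ' s l : ℝ} {N : ℕ} {Sig : Matrix (Fin d) (Fin d) ℝ} {a : ℤ → Fin d → ℝ}
  {e : ℤ → ℝ} {B : Finset ℤ} {p q : ℤ}

theorem BlockGood.mono (h : BlockGood κ Sig s a e B) (hκ : κ ≤ κ') :
    BlockGood κ' Sig s a e B := by
  have : κ * B.card ≤ κ' * B.card := by gcongr
  exact ⟨fun i j => (h.xx i j).trans this, fun i => (h.xe i).trans this, h.ee.trans this⟩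

theorem AnchorGood.mono (h : AnchorGood κ N Sig s a e p) (hκ : κ ≤ κ') :
    AnchorGood κ' N Sig s a e p :=
  fun q hq => ⟨(h q hq).1.mono hκ, (h q hq).2.mono hκ⟩

theorem sum_sq_dotProduct (B : Finset ℤ) (a : ℤ → Fin d → ℝ) (v : Fin d → ℝ) :
    ∑ t ∈ B, (a t ⬝ᵥ v) ^ 2 = ∑ i, ∑ j, v i * v j * ∑ t ∈ B, a t i * a t j := by
  have h : ∀ t, (a t ⬝ᵥ v) ^ 2 = ∑ i, ∑ j, v i * v j * (a t i * a t j) := by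
    intro t
    rw [pow_two, dotProduct, Finset.sum_mul_sum]
    exact Finset.sum_congr rfl fun i _ => Finset.sum_congr rfl fun j _ => by ring
  simp_rw [h]
  rw [Finset.sum_comm]
  refine Finset.sum_congr rfl fun i _ => ?_
  rw [Finset.sum_comm]
  exact Finset.sum_congr rfl fun j _ => by rw [Finset.mul_sum]

/-- Entrywise errors of size `κ` change the quadratic form by at most `κ d |v|²` per observation, by
`|v i v j| ≤ (v i² + v j²)/2`. This uses up at most half of the lower bound `2 l` for `Sig`. -/
theorem BlockGood.le_sum_sq (h : BlockGood κ Sig s a e B) (hκl : κ * d ≤ l)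
    (hSig : ∀ v, 2 * l * (v ⬝ᵥ v) ≤ v ⬝ᵥ (Sig *ᵥ v)) (v : Fin d → ℝ) :
    l * B.card * (v ⬝ᵥ v) ≤ ∑ t ∈ B, (a t ⬝ᵥ v) ^ 2 := by
  have h1 : v ⬝ᵥ (Sig *ᵥ v) = ∑ i, ∑ j, v i * v j * Sig i j := by
    simp only [dotProduct, mulVec, Finset.mul_sum]
    exact Finset.sum_congr rfl fun i _ => Finset.sum_congr rfl fun j _ => by ring
  have h2 : ∀ i j, v i * v j * (B.card * Sig i j)
      - κ * B.card * ((v i ^ 2 + v j ^ 2) / 2) ≤ v i * v j * ∑ t ∈ B, a t i * a t j := by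
    intro i j
    have h3 := h.xx i j
    have h4 : |v i * v j * (∑ t ∈ B, a t i * a t j - B.card * Sig i j)|
        ≤ (v i ^ 2 + v j ^ 2) / 2 * (κ * B.card) := by
      rw [abs_mul]
      refine mul_le_mul ?_ h3 (abs_nonneg _) (by positivity)
      rw [abs_le]
      constructor <;> nlinarith [sq_nonneg (v i + v j), sq_nonneg (v i - v j)]
    have := neg_abs_le (v i * v j * (∑ t ∈ B, a t i * a t j - B.card * Sig i j))
    nlinarith
  have h5 : ∑ i, ∑ j, (v i * v j * (B.card * Sig i j) - κ * B.card * ((v i ^ 2 + v j ^ 2) / 2))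
      = B.card * (v ⬝ᵥ (Sig *ᵥ v)) - κ * B.card * (d * (v ⬝ᵥ v)) := by
    rw [h1]
    simp only [Finset.sum_sub_distrib, ← Finset.mul_sum, ← Finset.sum_div,
      Finset.sum_add_distrib, Finset.sum_const, Finset.card_univ, Fintype.card_fin, nsmul_eq_mul]
    have h6 : ∑ i, ∑ j, v i * v j * (B.card * Sig i j)
        = B.card * ∑ i, ∑ j, v i * v j * Sig i j := by
      simp only [Finset.mul_sum]
      exact Finset.sum_congr rfl fun i _ => Finset.sum_congr rfl fun j _ => by ring
    have h7 : v ⬝ᵥ v = ∑ i, v i ^ 2 := by simp [dotProduct, pow_two]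
    rw [h7, h6]
    ring
  rw [sum_sq_dotProduct]
  refine le_trans ?_ (Finset.sum_le_sum fun i _ => Finset.sum_le_sum fun j _ => h2 i j)
  rw [h5]
  have h8 := mul_le_mul_of_nonneg_left (hSig v) (Nat.cast_nonneg (α := ℝ) B.card)
  have h9 : κ * d * (B.card * (v ⬝ᵥ v)) ≤ l * (B.card * (v ⬝ᵥ v)) :=
    mul_le_mul_of_nonneg_right hκl
      (mul_nonneg (Nat.cast_nonneg _) (dotProduct_self_nonneg' v))
  nlinarith

theorem BlockGood.abs_sum_mul_le (h : BlockGood κ Sig s a e B) (v : Fin d → ℝ) :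
    |∑ t ∈ B, (a t ⬝ᵥ v) * e t| ≤ κ * B.card * ∑ i, |v i| := by
  have h1 : ∑ t ∈ B, (a t ⬝ᵥ v) * e t = ∑ i, v i * ∑ t ∈ B, a t i * e t := by
    simp only [dotProduct, Finset.sum_mul, Finset.mul_sum]
    rw [Finset.sum_comm]
    exact Finset.sum_congr rfl fun i _ => Finset.sum_congr rfl fun j _ => by ring
  rw [h1, Finset.mul_sum]
  refine (Finset.abs_sum_le_sum_abs _ _).trans (Finset.sum_le_sum fun i _ => ?_)
  rw [abs_mul, mul_comm]
  exact mul_le_mul_of_nonneg_right (h.xe i) (abs_nonneg _)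

/-- The sum of squared residuals over a good block grows quadratically in the coefficient. -/
theorem BlockGood.le_sum_sq_sub (h : BlockGood κ Sig s a e B) (hκl : κ * d ≤ l)
    (hl : 0 < l) (hSig : ∀ v, 2 * l * (v ⬝ᵥ v) ≤ v ⬝ᵥ (Sig *ᵥ v)) (v : Fin d → ℝ) :
    ∑ t ∈ B, e t ^ 2 + l / 2 * B.card * (v ⬝ᵥ v) - 2 * d * κ ^ 2 / l * B.card
      ≤ ∑ t ∈ B, (e t - a t ⬝ᵥ v) ^ 2 := by
  have h1 : ∑ t ∈ B, (e t - a t ⬝ᵥ v) ^ 2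
      = ∑ t ∈ B, e t ^ 2 - 2 * ∑ t ∈ B, (a t ⬝ᵥ v) * e t + ∑ t ∈ B, (a t ⬝ᵥ v) ^ 2 := by
    rw [Finset.mul_sum, ← Finset.sum_sub_distrib, ← Finset.sum_add_distrib]
    exact Finset.sum_congr rfl fun i _ => by ring
  have h2 := h.le_sum_sq hκl hSig v
  have h3 := (le_abs_self _).trans (h.abs_sum_mul_le v)
  have h4 : 2 * κ * ∑ i, |v i| ≤ l / 2 * (v ⬝ᵥ v) + 2 * d * κ ^ 2 / l := by
    -- Completing the square: the noise term, linear in `v`, costs half of the quadratic gain plus a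
    -- constant of order `κ²`.
    have h5 : ∀ i, 2 * κ * |v i| ≤ l / 2 * (v i * v i) + 2 * κ ^ 2 / l := by
      intro i
      have h6 : 0 ≤ l / 2 * (|v i| - 2 * κ / l) ^ 2 := by positivity
      have h7 : l / 2 * (|v i| - 2 * κ / l) ^ 2
          = l / 2 * (|v i| * |v i|) + 2 * κ ^ 2 / l - 2 * κ * |v i| := by
        field_simp
        ring
      rw [abs_mul_abs_self] at h7
      linarith
    have h8 := Finset.sum_le_sum fun i (_ : i ∈ Finset.univ) => h5 i
    rw [← Finset.mul_sum, Finset.sum_add_distrib, ← Finset.mul_sum, Finset.sum_const,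
      Finset.card_univ, Fintype.card_fin, nsmul_eq_mul] at h8
    refine h8.trans_eq ?_
    simp only [dotProduct]
    ring
  have h9 := mul_le_mul_of_nonneg_left h4 (Nat.cast_nonneg (α := ℝ) B.card)
  rw [h1]
  nlinarith

theorem BlockGood.sum_sq_le (h : BlockGood κ Sig s a e B) :
    ∑ t ∈ B, e t ^ 2 ≤ (s + κ) * B.card := by
  have := (le_abs_self _).trans h.ee
  linarith

theorem Ioc_subset_of_card_le {p q : ℤ} {n : ℕ} (h : (Finset.Ioc p q).card ≤ n) :
    Finset.Ioc p q ⊆ Finset.Ioc p (p + n) := by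
  intro t ht
  rw [Finset.mem_Ioc] at ht ⊢
  rw [Int.card_Ioc] at h
  omega

theorem Ioc_subset_of_card_le' {p q : ℤ} {n : ℕ} (h : (Finset.Ioc q p).card ≤ n) :
    Finset.Ioc q p ⊆ Finset.Ioc (p - n) p := by
  intro t ht
  rw [Finset.mem_Ioc] at ht ⊢
  rw [Int.card_Ioc] at h
  omega

/-- `B` is a block that starts or ends at `p`. -/
def IsBlockAt (p : ℤ) (B : Finset ℤ) : Prop := ∃ q, B = Finset.Ioc p q ∨ B = Finset.Ioc q p

theorem AnchorGood.blockGood (h : AnchorGood κ N Sig s a e p) (hB : IsBlockAt p B)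
    (hN : N ≤ B.card) : BlockGood κ Sig s a e B := by
  obtain ⟨q, rfl | rfl⟩ := hB
  · by_cases hq : (N : ℤ) ≤ |q - p|
    · exact (h q hq).1
    · rw [Int.card_Ioc] at hN
      rw [le_abs] at hq
      omega
  · by_cases hq : (N : ℤ) ≤ |q - p|
    · exact (h q hq).2
    · rw [Int.card_Ioc] at hN
      rw [le_abs] at hq
      omega

/-- A block shorter than `N` is not controlled itself, but it lies in the block of length `n` at the
same anchor, and squares are nonnegative. -/
theorem AnchorGood.sum_sq_le (h : AnchorGood κ N Sig s a e p) (hB : IsBlockAt p B) {n : ℕ}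
    (hN : N ≤ n) (hn : B.card ≤ n) : ∑ t ∈ B, e t ^ 2 ≤ (s + κ) * n := by
  have key : ∀ B', B ⊆ B' → IsBlockAt p B' → B'.card = n → ∑ t ∈ B, e t ^ 2 ≤ (s + κ) * n := by
    intro B' hs hB' hc
    refine (Finset.sum_le_sum_of_subset_of_nonneg hs fun i _ _ => sq_nonneg _).trans ?_
    have := (h.blockGood hB' (by omega)).sum_sq_le
    rwa [hc] at this
  obtain ⟨q, rfl | rfl⟩ := hB
  · exact key _ (Ioc_subset_of_card_le hn) ⟨_, Or.inl rfl⟩ (by simp)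
  · exact key _ (Ioc_subset_of_card_le' hn) ⟨_, Or.inr rfl⟩ (by simp)

/-- For a block shorter than `N` the quadratic gain is dropped by the truncated length, and the
error sum is paid for by `(s + κ) * N`. The bound therefore holds for blocks of every length. -/
theorem AnchorGood.le_sum_sq_sub (h : AnchorGood κ N Sig s a e p) (hB : IsBlockAt p B)
    (hκ : 0 ≤ κ) (hκl : κ * d ≤ l) (hl : 0 < l)
    (hSig : ∀ v, 2 * l * (v ⬝ᵥ v) ≤ v ⬝ᵥ (Sig *ᵥ v)) (hs : 0 ≤ s) (v : Fin d → ℝ) :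
    ∑ t ∈ B, e t ^ 2 + l / 2 * max ((B.card : ℝ) - N) 0 * (v ⬝ᵥ v)
        - 2 * d * κ ^ 2 / l * B.card - (s + κ) * N
      ≤ ∑ t ∈ B, (e t - a t ⬝ᵥ v) ^ 2 := by
  have hv := dotProduct_self_nonneg' v
  have hsN : 0 ≤ (s + κ) * N := by positivity
  rcases le_total N B.card with hN | hN
  · have h1 := (h.blockGood hB hN).le_sum_sq_sub hκl hl hSig v
    have h2 : max ((B.card : ℝ) - N) 0 ≤ B.card :=
      max_le (by linarith [Nat.cast_nonneg (α := ℝ) N]) (Nat.cast_nonneg _)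
    have h3 : l / 2 * max ((B.card : ℝ) - N) 0 * (v ⬝ᵥ v) ≤ l / 2 * B.card * (v ⬝ᵥ v) := by
      gcongr
    linarith
  · have h1 := h.sum_sq_le hB le_rfl hN
    have h2 : max ((B.card : ℝ) - N) 0 = 0 :=
      max_eq_right (by have : (B.card : ℝ) ≤ N := by exact_mod_cast hN
                       linarith)
    have h3 : 0 ≤ 2 * d * κ ^ 2 / l * B.card := by positivity
    have h4 : 0 ≤ ∑ t ∈ B, (e t - a t ⬝ᵥ v) ^ 2 := Finset.sum_nonneg fun i _ => sq_nonneg _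
    rw [h2]
    linarith

theorem sum_Ioc_add_sum_Ioc {p q r : ℤ} (h₁ : p ≤ q) (h₂ : q ≤ r) (f : ℤ → ℝ) :
    ∑ t ∈ Finset.Ioc p q, f t + ∑ t ∈ Finset.Ioc q r, f t = ∑ t ∈ Finset.Ioc p r, f t := by
  rw [← Finset.Ioc_union_Ioc_eq_Ioc h₁ h₂, Finset.sum_union]
  rw [Finset.disjoint_left]
  intro t ht ht'
  rw [Finset.mem_Ioc] at ht ht'
  omega

theorem card_Ioc_cast {p q : ℤ} (h : p ≤ q) : ((Finset.Ioc p q).card : ℝ) = q - p := by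
  rw [Int.card_Ioc]
  have : (((q - p).toNat : ℤ) : ℝ) = ((q - p : ℤ) : ℝ) := by
    rw [Int.toNat_of_nonneg (by omega)]
  push_cast at this
  simpa using this

end Blocks

/-! ### The sum of squared residuals and the two-sided random walk -/

section Residuals

variable {d : ℕ}

/-- The sum of squared residuals for the break date `k` when the true break date is `k₀`; `u` is
the estimation error of the initial slope, `w` the estimate of the shift `w₀`. -/
noncomputable def residualSq (T : ℕ) (a : ℤ → Fin d → ℝ) (e : ℤ → ℝ) (w₀ : Fin d → ℝ) (k₀ k : ℤ)
    (u w : Fin d → ℝ) : ℝ :=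
  ∑ t ∈ Finset.Ioc (0 : ℤ) T,
    (e t - a t ⬝ᵥ (u + (if k < t then w else 0) - if k₀ < t then w₀ else 0)) ^ 2

/-- The two-sided random walk `W*` started at `p`, evaluated at `k`. -/
noncomputable def walk (a : ℤ → Fin d → ℝ) (e : ℤ → ℝ) (w₀ : Fin d → ℝ) (p k : ℤ) : ℝ :=
  if k < p then
    -(∑ t ∈ Finset.Ioc k p, (a t ⬝ᵥ w₀) ^ 2) + 2 * ∑ t ∈ Finset.Ioc k p, (a t ⬝ᵥ w₀) * e t
  else
    -(∑ t ∈ Finset.Ioc p k, (a t ⬝ᵥ w₀) ^ 2) - 2 * ∑ t ∈ Finset.Ioc p k, (a t ⬝ᵥ w₀) * e t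

/-- The observations between two dates. -/
noncomputable def between (p k : ℤ) : Finset ℤ := Finset.Ioc (min p k) (max p k)

theorem isBlockAt_between (p k : ℤ) : IsBlockAt p (between p k) := by
  rcases le_total p k with h | h
  · exact ⟨k, Or.inl (by simp [between, h])⟩
  · exact ⟨k, Or.inr (by simp [between, h])⟩

theorem card_between (p k : ℤ) : ((between p k).card : ℝ) = |(k : ℝ) - p| := by
  rw [between, card_Ioc_cast (min_le_max)]
  push_cast
  rcases le_total (p : ℝ) k with h | h
  · rw [min_eq_left h, max_eq_right h, abs_of_nonneg (by linarith)]
  · rw [min_eq_right h, max_eq_left h, abs_of_nonpos (by linarith)]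
    ring

variable {T : ℕ} {κ s l : ℝ} {N : ℕ} {Sig : Matrix (Fin d) (Fin d) ℝ} {a : ℤ → Fin d → ℝ}
  {e : ℤ → ℝ} {w₀ : Fin d → ℝ} {k₀ k : ℤ}

theorem walk_self (p : ℤ) : walk a e w₀ p p = 0 := by simp [walk]

theorem walk_le (p k : ℤ) : walk a e w₀ p k ≤ -(∑ t ∈ between p k, (a t ⬝ᵥ w₀) ^ 2)
    + 2 * |∑ t ∈ between p k, (a t ⬝ᵥ w₀) * e t| := by
  rcases lt_or_ge k p with h | h
  · simp only [walk, between, h, if_true, min_eq_right h.le, max_eq_left h.le]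
    linarith [le_abs_self (∑ t ∈ Finset.Ioc k p, (a t ⬝ᵥ w₀) * e t)]
  · simp only [walk, between, not_lt.2 h, if_false, min_eq_left h, max_eq_right h]
    linarith [neg_abs_le (∑ t ∈ Finset.Ioc p k, (a t ⬝ᵥ w₀) * e t)]

theorem abs_walk_le (p k : ℤ) : |walk a e w₀ p k| ≤ ∑ t ∈ between p k, (a t ⬝ᵥ w₀) ^ 2
    + 2 * |∑ t ∈ between p k, (a t ⬝ᵥ w₀) * e t| := by
  have h0 : 0 ≤ ∑ t ∈ between p k, (a t ⬝ᵥ w₀) ^ 2 := Finset.sum_nonneg fun i _ => sq_nonneg _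
  rw [abs_le]
  refine ⟨?_, (walk_le p k).trans (by linarith)⟩
  rcases lt_or_ge k p with h | h
  · simp only [walk, between, h, if_true, min_eq_right h.le, max_eq_left h.le] at h0 ⊢
    linarith [neg_abs_le (∑ t ∈ Finset.Ioc k p, (a t ⬝ᵥ w₀) * e t)]
  · simp only [walk, between, not_lt.2 h, if_false, min_eq_left h, max_eq_right h] at h0 ⊢
    linarith [le_abs_self (∑ t ∈ Finset.Ioc p k, (a t ⬝ᵥ w₀) * e t)]

/-- With bounded regressors the walk grows at most as the sum of `1 + ε_t²`. -/
theorem abs_walk_le_sum {c : ℝ} (hc : 0 ≤ c) (ha : ∀ t, |a t ⬝ᵥ w₀| ≤ c) (p k : ℤ) :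
    |walk a e w₀ p k| ≤ (c ^ 2 + 2 * c) * ∑ t ∈ between p k, (1 + e t ^ 2) := by
  refine (abs_walk_le p k).trans ?_
  have h1 := Finset.abs_sum_le_sum_abs (fun t => (a t ⬝ᵥ w₀) * e t) (between p k)
  refine (add_le_add_right (mul_le_mul_of_nonneg_left h1 two_pos.le) _).trans ?_
  rw [Finset.mul_sum, Finset.mul_sum, ← Finset.sum_add_distrib]
  refine Finset.sum_le_sum fun t _ => ?_
  have h2 : (a t ⬝ᵥ w₀) ^ 2 ≤ c ^ 2 := sq_le_sq' (by linarith [abs_le.1 (ha t)]) (abs_le.1 (ha t)).2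
  have h3 : |(a t ⬝ᵥ w₀) * e t| ≤ c * (1 + e t ^ 2) := by
    rw [abs_mul]
    refine mul_le_mul (ha t) ?_ (abs_nonneg _) hc
    nlinarith [sq_abs (e t), sq_nonneg (|e t| - 1)]
  nlinarith [sq_nonneg (e t), sq_nonneg c, mul_nonneg (sq_nonneg c) (sq_nonneg (e t))]

/-- Negative drift: each observation contributes at least `l |w₀|²` through the squares, against at
most `2 κ ∑ |w₀ i|` from the noise. -/
theorem AnchorGood.walk_le (h : AnchorGood κ N Sig s a e k₀) (hκl : κ * d ≤ l)
    (hSig : ∀ v, 2 * l * (v ⬝ᵥ v) ≤ v ⬝ᵥ (Sig *ᵥ v)) (hN : (N : ℝ) ≤ |(k : ℝ) - k₀|) :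
    walk a e w₀ k₀ k ≤ -((l * (w₀ ⬝ᵥ w₀) - 2 * κ * ∑ i, |w₀ i|) * |(k : ℝ) - k₀|) := by
  rw [← card_between] at hN ⊢
  have hB := h.blockGood (isBlockAt_between k₀ k) (by exact_mod_cast hN)
  have h1 := hB.le_sum_sq hκl hSig w₀
  have h2 := hB.abs_sum_mul_le w₀
  have h3 := _root_.walk_le (a := a) (e := e) (w₀ := w₀) k₀ k
  linarith

theorem AnchorGood.sum_between_le (h : AnchorGood κ N Sig s a e k₀) :
    ∑ t ∈ between k₀ k, (1 + e t ^ 2) ≤ (s + κ + 1) * (|(k : ℝ) - k₀| + N) := by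
  have h1 := h.sum_sq_le (isBlockAt_between k₀ k) (n := (between k₀ k).card + N)
    (by omega) (by omega)
  rw [Finset.sum_add_distrib, Finset.sum_const, nsmul_eq_mul, mul_one]
  push_cast [card_between] at h1 ⊢
  linarith [Nat.cast_nonneg (α := ℝ) N]

theorem AnchorGood.sum_between_le_of_le_one (h : AnchorGood κ N Sig s a e k₀) (hκ : κ ≤ 1) :
    ∑ t ∈ between k₀ k, (1 + e t ^ 2) ≤ (s + 2) * (|(k : ℝ) - k₀| + N) := by
  refine h.sum_between_le.trans (mul_le_mul_of_nonneg_right (by linarith) ?_)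
  positivity

theorem residualSq_of_le (hk : 0 ≤ k) (hkk : k ≤ k₀) (hT : k₀ ≤ T) (u w : Fin d → ℝ) :
    residualSq T a e w₀ k₀ k u w = ∑ t ∈ Finset.Ioc 0 k, (e t - a t ⬝ᵥ u) ^ 2
      + ∑ t ∈ Finset.Ioc k k₀, (e t - a t ⬝ᵥ (u + w)) ^ 2
      + ∑ t ∈ Finset.Ioc k₀ (T : ℤ), (e t - a t ⬝ᵥ (u + w - w₀)) ^ 2 := by
  rw [residualSq, ← sum_Ioc_add_sum_Ioc (hk.trans hkk) hT, ← sum_Ioc_add_sum_Ioc hk hkk]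
  congr 1
  · congr 1 <;> refine Finset.sum_congr rfl fun t ht => ?_ <;> rw [Finset.mem_Ioc] at ht
    · rw [if_neg (by omega), if_neg (by omega), add_zero, sub_zero]
    · rw [if_pos (by omega), if_neg (by omega), sub_zero]
  · refine Finset.sum_congr rfl fun t ht => ?_
    rw [Finset.mem_Ioc] at ht
    rw [if_pos (by omega), if_pos (by omega)]

theorem residualSq_of_ge (hk : 0 ≤ k₀) (hkk : k₀ ≤ k) (hT : k ≤ T) (u w : Fin d → ℝ) :
    residualSq T a e w₀ k₀ k u w = ∑ t ∈ Finset.Ioc 0 k₀, (e t - a t ⬝ᵥ u) ^ 2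
      + ∑ t ∈ Finset.Ioc k₀ k, (e t - a t ⬝ᵥ (u - w₀)) ^ 2
      + ∑ t ∈ Finset.Ioc k (T : ℤ), (e t - a t ⬝ᵥ (u + w - w₀)) ^ 2 := by
  rw [residualSq, ← sum_Ioc_add_sum_Ioc (hk.trans hkk) hT, ← sum_Ioc_add_sum_Ioc hk hkk]
  congr 1
  · congr 1 <;> refine Finset.sum_congr rfl fun t ht => ?_ <;> rw [Finset.mem_Ioc] at ht
    · rw [if_neg (by omega), if_neg (by omega), add_zero, sub_zero]
    · rw [if_neg (by omega), if_pos (by omega), add_zero]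
  · refine Finset.sum_congr rfl fun t ht => ?_
    rw [Finset.mem_Ioc] at ht
    rw [if_pos (by omega), if_pos (by omega)]

/-- The anchors needed for the analysis of a sample: its two ends and the true break date. -/
structure SampleGood (κ : ℝ) (N : ℕ) (Sig : Matrix (Fin d) (Fin d) ℝ) (v : ℝ) (a : ℤ → Fin d → ℝ)
    (e : ℤ → ℝ) (T : ℕ) (k₀ : ℤ) : Prop where
  left : AnchorGood κ N Sig v a e 0
  mid : AnchorGood κ N Sig v a e k₀
  right : AnchorGood κ N Sig v a e T

theorem SampleGood.mono {κ' : ℝ} (h : SampleGood κ N Sig s a e T k₀) (hκ : κ ≤ κ') :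
    SampleGood κ' N Sig s a e T k₀ :=
  ⟨h.left.mono hκ, h.mid.mono hκ, h.right.mono hκ⟩

/-- Quadratic growth of the sum of squared residuals, in terms of the coefficients on the three
blocks into which the true break date and the break date `k` divide the sample. -/
theorem SampleGood.le_residualSq (h : SampleGood κ N Sig s a e T k₀)
    (hκ : 0 ≤ κ) (hκl : κ * d ≤ l) (hl : 0 < l)
    (hSig : ∀ v, 2 * l * (v ⬝ᵥ v) ≤ v ⬝ᵥ (Sig *ᵥ v)) (hs : 0 ≤ s)
    (hk₀ : 0 ≤ k₀) (hk₀T : k₀ ≤ T) (hk : 0 ≤ k) (hkT : k ≤ T) (u w : Fin d → ℝ) :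
    ∑ t ∈ Finset.Ioc (0 : ℤ) T, e t ^ 2
      + l / 2 * (max (min (k₀ : ℝ) k - N) 0 * (u ⬝ᵥ u)
        + max (|(k : ℝ) - k₀| - N) 0 * ((u + if k ≤ k₀ then w else -w₀) ⬝ᵥ
            (u + if k ≤ k₀ then w else -w₀))
        + max ((T : ℝ) - max (k₀ : ℝ) k - N) 0 * ((u + w - w₀) ⬝ᵥ (u + w - w₀)))
      - 2 * d * κ ^ 2 / l * T - 3 * (s + κ) * N ≤ residualSq T a e w₀ k₀ k u w := by
  rcases le_total k k₀ with hkk | hkk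
  · have hr : (k : ℝ) ≤ k₀ := by exact_mod_cast hkk
    rw [residualSq_of_le hk hkk hk₀T, ← sum_Ioc_add_sum_Ioc hk₀ hk₀T, ← sum_Ioc_add_sum_Ioc hk hkk,
      if_pos hkk, min_eq_right hr, max_eq_left hr, abs_of_nonpos (by linarith)]
    have h1 := h.left.le_sum_sq_sub (B := Finset.Ioc 0 k) ⟨k, Or.inl rfl⟩ hκ hκl hl hSig hs u
    have h2 := h.mid.le_sum_sq_sub (B := Finset.Ioc k k₀) ⟨k, Or.inr rfl⟩ hκ hκl hl hSig hs (u + w)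
    have h3 := h.right.le_sum_sq_sub (B := Finset.Ioc k₀ T) ⟨k₀, Or.inr rfl⟩ hκ hκl hl hSig hs
      (u + w - w₀)
    rw [card_Ioc_cast (by assumption)] at h1 h2 h3
    push_cast at h1 h3
    rw [sub_zero] at h1
    rw [neg_sub]
    linarith
  · have hr : (k₀ : ℝ) ≤ k := by exact_mod_cast hkk
    -- At `k = k₀` the convention selects `w` instead of `-w₀`, which is harmless because the middle
    -- block is then empty and its weight is zero.
    have hv : (u + if k ≤ k₀ then w else -w₀) ⬝ᵥ (u + if k ≤ k₀ then w else -w₀)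
        = (u - w₀) ⬝ᵥ (u - w₀) ∨ |(k : ℝ) - k₀| - N ≤ 0 := by
      rcases eq_or_lt_of_le hkk with h' | h'
      · right
        simp [h']
      · left
        rw [if_neg (by omega), ← sub_eq_add_neg]
    have hmid : max (|(k : ℝ) - k₀| - N) 0 * ((u + if k ≤ k₀ then w else -w₀) ⬝ᵥ
        (u + if k ≤ k₀ then w else -w₀))
        = max (|(k : ℝ) - k₀| - N) 0 * ((u - w₀) ⬝ᵥ (u - w₀)) := by
      rcases hv with hv | hv
      · rw [hv]
      · rw [max_eq_right hv, zero_mul, zero_mul]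
    rw [hmid, residualSq_of_ge hk₀ hkk hkT, ← sum_Ioc_add_sum_Ioc hk hkT,
      ← sum_Ioc_add_sum_Ioc hk₀ hkk, min_eq_left hr, max_eq_right hr, abs_of_nonneg (by linarith)]
    have h1 := h.left.le_sum_sq_sub (B := Finset.Ioc 0 k₀) ⟨k₀, Or.inl rfl⟩ hκ hκl hl hSig hs u
    have h2 := h.mid.le_sum_sq_sub (B := Finset.Ioc k₀ k) ⟨k, Or.inl rfl⟩ hκ hκl hl hSig hs (u - w₀)
    have h3 := h.right.le_sum_sq_sub (B := Finset.Ioc k T) ⟨k, Or.inr rfl⟩ hκ hκl hl hSig hs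
      (u + w - w₀)
    rw [card_Ioc_cast (by assumption)] at h1 h2 h3
    push_cast at h1 h3
    rw [sub_zero] at h1
    linarith

/-- At the true coefficients the sums of squared residuals differ by the walk. -/
theorem residualSq_true (hk₀ : 0 ≤ k₀) (hk₀T : k₀ ≤ T) (hk : 0 ≤ k) (hkT : k ≤ T) :
    residualSq T a e w₀ k₀ k 0 w₀
      = ∑ t ∈ Finset.Ioc (0 : ℤ) T, e t ^ 2 - walk a e w₀ k₀ k := by
  rcases lt_or_ge k k₀ with hkk | hkk
  · rw [residualSq_of_le hk hkk.le hk₀T, ← sum_Ioc_add_sum_Ioc hk₀ hk₀T,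
      ← sum_Ioc_add_sum_Ioc hk hkk.le, walk, if_pos hkk]
    have : ∑ t ∈ Finset.Ioc k k₀, (e t - a t ⬝ᵥ (0 + w₀)) ^ 2 = ∑ t ∈ Finset.Ioc k k₀, e t ^ 2
        + ∑ t ∈ Finset.Ioc k k₀, (a t ⬝ᵥ w₀) ^ 2
        - 2 * ∑ t ∈ Finset.Ioc k k₀, (a t ⬝ᵥ w₀) * e t := by
      rw [Finset.mul_sum, ← Finset.sum_add_distrib, ← Finset.sum_sub_distrib]
      exact Finset.sum_congr rfl fun t _ => by rw [zero_add]; ring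
    rw [this]
    simp only [dotProduct_zero, zero_add, sub_self, sub_zero]
    ring
  · rw [residualSq_of_ge hk₀ hkk hkT, ← sum_Ioc_add_sum_Ioc hk hkT,
      ← sum_Ioc_add_sum_Ioc hk₀ hkk, walk, if_neg (not_lt.2 hkk)]
    have : ∑ t ∈ Finset.Ioc k₀ k, (e t - a t ⬝ᵥ (0 - w₀)) ^ 2 = ∑ t ∈ Finset.Ioc k₀ k, e t ^ 2
        + ∑ t ∈ Finset.Ioc k₀ k, (a t ⬝ᵥ w₀) ^ 2
        + 2 * ∑ t ∈ Finset.Ioc k₀ k, (a t ⬝ᵥ w₀) * e t := by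
      rw [Finset.mul_sum, ← Finset.sum_add_distrib, ← Finset.sum_add_distrib]
      exact Finset.sum_congr rfl fun t _ => by rw [zero_sub, dotProduct_neg]; ring
    rw [this]
    simp only [dotProduct_zero, zero_add, sub_self, sub_zero]
    ring

/-- For coefficients close to the true ones, changing the break date from `k₀` to `k` changes the
sum of squared residuals by the walk, up to a small error. -/
theorem abs_residualSq_sub_add_walk_le (hk₀ : 0 ≤ k₀) (hk₀T : k₀ ≤ T) (hk : 0 ≤ k) (hkT : k ≤ T)
    {α c : ℝ} (hα : α ≤ 1) {u w : Fin d → ℝ}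
    (hw₀ : ∀ t, |a t ⬝ᵥ w₀| ≤ c) (hu : ∀ t, |a t ⬝ᵥ u| ≤ α)
    (hw : ∀ t, |a t ⬝ᵥ (w - w₀)| ≤ α) :
    |residualSq T a e w₀ k₀ k u w - residualSq T a e w₀ k₀ k₀ u w + walk a e w₀ k₀ k|
      ≤ α * (6 * c + 7) * ∑ t ∈ between k₀ k, (1 + e t ^ 2) := by
  have hα0 : 0 ≤ α := (abs_nonneg _).trans (hu 0)
  have hc0 : 0 ≤ c := (abs_nonneg _).trans (hw₀ 0)
  -- One observation between the two dates: `x` is the true shift, `y` the error in the shift, `z`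
  -- the remaining slope error and `f` the noise up to sign. The constant is `(2c + 1) + 2 + 4(c +
  -- 1) = 6c + 7`.
  have key : ∀ x y z f : ℝ, |x| ≤ c → |y| ≤ α → |z| ≤ 2 * α →
      |(x + y) ^ 2 - x ^ 2 + 2 * y * f + 2 * (x + y) * z| ≤ α * (6 * c + 7) * (1 + f ^ 2) := by
    intro x y z f hx hy hz
    have h1 : |f| ≤ 1 + f ^ 2 := by nlinarith [sq_abs f, sq_nonneg (|f| - 1)]
    have h2 : |(x + y) ^ 2 - x ^ 2| ≤ α * (2 * c + 1) := by
      have : (x + y) ^ 2 - x ^ 2 = y * (2 * x + y) := by ring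
      rw [this, abs_mul]
      refine mul_le_mul hy ((abs_add_le _ _).trans ?_) (abs_nonneg _) hα0
      rw [abs_mul, abs_two]
      linarith
    have h3 : |2 * y * f| ≤ 2 * α * (1 + f ^ 2) := by
      rw [abs_mul, abs_mul, abs_two]
      gcongr
    have h4 : |2 * (x + y) * z| ≤ 2 * (c + 1) * (2 * α) := by
      rw [abs_mul, abs_mul, abs_two]
      gcongr
      exact (abs_add_le _ _).trans (by linarith)
    have h5 := abs_add_three ((x + y) ^ 2 - x ^ 2) (2 * y * f) (2 * (x + y) * z)
    nlinarith [sq_nonneg f, mul_nonneg hα0 hc0, mul_nonneg hα0 (sq_nonneg f),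
      mul_nonneg (mul_nonneg hα0 hc0) (sq_nonneg f)]
  rcases lt_or_ge k k₀ with hkk | hkk
  · rw [residualSq_of_le hk hkk.le hk₀T, residualSq_of_le hk₀ le_rfl hk₀T,
      ← sum_Ioc_add_sum_Ioc hk hkk.le, Finset.Ioc_self, Finset.sum_empty, walk, if_pos hkk, between,
      min_eq_right hkk.le, max_eq_left hkk.le]
    have : ∑ t ∈ Finset.Ioc 0 k, (e t - a t ⬝ᵥ u) ^ 2
        + ∑ t ∈ Finset.Ioc k k₀, (e t - a t ⬝ᵥ (u + w)) ^ 2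
        + ∑ t ∈ Finset.Ioc k₀ (T : ℤ), (e t - a t ⬝ᵥ (u + w - w₀)) ^ 2
        - (∑ t ∈ Finset.Ioc 0 k, (e t - a t ⬝ᵥ u) ^ 2
          + ∑ t ∈ Finset.Ioc k k₀, (e t - a t ⬝ᵥ u) ^ 2 + 0
          + ∑ t ∈ Finset.Ioc k₀ (T : ℤ), (e t - a t ⬝ᵥ (u + w - w₀)) ^ 2)
        + (-∑ t ∈ Finset.Ioc k k₀, (a t ⬝ᵥ w₀) ^ 2
          + 2 * ∑ t ∈ Finset.Ioc k k₀, (a t ⬝ᵥ w₀) * e t)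
        = ∑ t ∈ Finset.Ioc k k₀, ((e t - a t ⬝ᵥ (u + w)) ^ 2 - (e t - a t ⬝ᵥ u) ^ 2
          - (a t ⬝ᵥ w₀) ^ 2 + 2 * ((a t ⬝ᵥ w₀) * e t)) := by
      rw [Finset.sum_add_distrib, Finset.sum_sub_distrib, Finset.sum_sub_distrib, ← Finset.mul_sum]
      ring
    rw [this, Finset.mul_sum]
    refine (Finset.abs_sum_le_sum_abs _ _).trans (Finset.sum_le_sum fun t _ => ?_)
    have h := key (a t ⬝ᵥ w₀) (a t ⬝ᵥ (w - w₀)) (a t ⬝ᵥ u) (-e t) (hw₀ t) (hw t)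
      ((hu t).trans (by linarith))
    rw [neg_sq] at h
    refine le_of_eq_of_le (congrArg _ ?_) h
    rw [dotProduct_add, dotProduct_sub]
    ring
  · rw [residualSq_of_ge hk₀ hkk hkT, residualSq_of_ge hk₀ le_rfl hk₀T,
      ← sum_Ioc_add_sum_Ioc hkk hkT, Finset.Ioc_self, Finset.sum_empty, walk,
      if_neg (not_lt.2 hkk), between, min_eq_left hkk, max_eq_right hkk]
    have : ∑ t ∈ Finset.Ioc 0 k₀, (e t - a t ⬝ᵥ u) ^ 2
        + ∑ t ∈ Finset.Ioc k₀ k, (e t - a t ⬝ᵥ (u - w₀)) ^ 2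
        + ∑ t ∈ Finset.Ioc k (T : ℤ), (e t - a t ⬝ᵥ (u + w - w₀)) ^ 2
        - (∑ t ∈ Finset.Ioc 0 k₀, (e t - a t ⬝ᵥ u) ^ 2 + 0
          + (∑ t ∈ Finset.Ioc k₀ k, (e t - a t ⬝ᵥ (u + w - w₀)) ^ 2
          + ∑ t ∈ Finset.Ioc k (T : ℤ), (e t - a t ⬝ᵥ (u + w - w₀)) ^ 2))
        + (-∑ t ∈ Finset.Ioc k₀ k, (a t ⬝ᵥ w₀) ^ 2
          - 2 * ∑ t ∈ Finset.Ioc k₀ k, (a t ⬝ᵥ w₀) * e t)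
        = ∑ t ∈ Finset.Ioc k₀ k, ((e t - a t ⬝ᵥ (u - w₀)) ^ 2 - (e t - a t ⬝ᵥ (u + w - w₀)) ^ 2
          - (a t ⬝ᵥ w₀) ^ 2 - 2 * ((a t ⬝ᵥ w₀) * e t)) := by
      rw [Finset.sum_sub_distrib, Finset.sum_sub_distrib, Finset.sum_sub_distrib, ← Finset.mul_sum]
      ring
    rw [this, Finset.mul_sum]
    refine (Finset.abs_sum_le_sum_abs _ _).trans (Finset.sum_le_sum fun t _ => ?_)
    have h := key (a t ⬝ᵥ w₀) (a t ⬝ᵥ (w - w₀)) (-(a t ⬝ᵥ u) - a t ⬝ᵥ (w - w₀)) (e t)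
      (hw₀ t) (hw t) (by
        have h1 := abs_sub (-(a t ⬝ᵥ u)) (a t ⬝ᵥ (w - w₀))
        rw [abs_neg] at h1
        linarith [hu t, hw t])
    refine le_of_eq_of_le (congrArg _ ?_) h
    rw [dotProduct_sub, dotProduct_sub, dotProduct_sub, dotProduct_add]
    ring

end Residuals

/-! ### Asymptotics of the profiled sum of squared residuals -/

section Profile

variable {d : ℕ}

/-- A sample of `T` observations with bounded regressors whose true break date `k₀` is bounded away
from both ends in relative terms. -/
structure InteriorBreak (C c : ℝ) (a : ℤ → Fin d → ℝ) (T : ℕ) (k₀ : ℤ) : Prop where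
  bound : ∀ t, a t ⬝ᵥ a t ≤ C ^ 2
  left : 2 * c * T ≤ k₀
  right : 2 * c * T ≤ T - k₀

/-- The penalized sum of squared residuals, minimized over the parameters `γ`. -/
noncomputable def profile {Γ : Type*} (u w : Γ → Fin d → ℝ) (pen : Γ → ℝ) (T : ℕ)
    (a : ℤ → Fin d → ℝ) (e : ℤ → ℝ) (w₀ : Fin d → ℝ) (k₀ k : ℤ) : ℝ :=
  ⨅ γ, (residualSq T a e w₀ k₀ k (u γ) (w γ) + pen γ)

variable {C c s l : ℝ} {Sig : Matrix (Fin d) (Fin d) ℝ} {w₀ : Fin d → ℝ}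

theorem InteriorBreak.pos {a : ℤ → Fin d → ℝ} {T : ℕ} {k₀ : ℤ} (h : InteriorBreak C c a T k₀)
    (hc : 0 < c) : 0 ≤ k₀ ∧ k₀ ≤ T := by
  have h1 := h.left
  have h2 := h.right
  have h3 : 0 ≤ 2 * c * T := by positivity
  constructor
  · have : (0 : ℝ) ≤ k₀ := by linarith
    exact_mod_cast this
  · have : (k₀ : ℝ) ≤ T := by linarith
    exact_mod_cast this

theorem InteriorBreak.abs_dotProduct_le {a : ℤ → Fin d → ℝ} {T : ℕ} {k₀ : ℤ}
    (h : InteriorBreak C c a T k₀) (hC : 0 ≤ C) {v : Fin d → ℝ} {r : ℝ} (hv : v ⬝ᵥ v ≤ r)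
    (t : ℤ) : |a t ⬝ᵥ v| ≤ C * √r := by
  have hr : 0 ≤ r := (dotProduct_self_nonneg' v).trans hv
  refine abs_le_of_sq_le_sq ?_ (by positivity)
  rw [mul_pow, Real.sq_sqrt hr]
  exact (sq_dotProduct_le _ _).trans
    (mul_le_mul (h.bound t) hv (dotProduct_self_nonneg' v) (sq_nonneg C))

theorem eventually_natCast_ge (x : ℝ) : ∀ᶠ T : ℕ in atTop, x ≤ T :=
  tendsto_natCast_atTop_atTop.eventually_ge_atTop x

theorem eventually_le_mul_natCast (x : ℝ) {y : ℝ} (hy : 0 < y) :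
    ∀ᶠ T : ℕ in atTop, x ≤ y * T := by
  filter_upwards [eventually_natCast_ge (x / y)] with T hT
  rw [div_le_iff₀ hy] at hT
  linarith

/-- Coefficients that fit at least as well as the true ones are close to the true ones, if the
break date is close to the true one. -/
theorem exists_localization (hl : 0 < l)
    (hSig : ∀ v, 2 * l * (v ⬝ᵥ v) ≤ v ⬝ᵥ (Sig *ᵥ v)) (hs : 0 ≤ s) (hC : 0 ≤ C) (hc : 0 < c)
    (w₀ : Fin d → ℝ) (p₀ : ℝ) {r : ℝ} (hr : 0 < r) :
    ∃ κ > 0, ∃ η > 0, η ≤ c ∧ ∀ N : ℕ, ∀ᶠ T : ℕ in atTop, ∀ a e k₀, InteriorBreak C c a T k₀ →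
      SampleGood κ N Sig s a e T k₀ → ∀ k : ℤ, 0 ≤ k → k ≤ T → |(k : ℝ) - k₀| ≤ η * T →
      ∀ u w, residualSq T a e w₀ k₀ k u w ≤ residualSq T a e w₀ k₀ k 0 w₀ + p₀ →
        u ⬝ᵥ u ≤ r ∧ (w - w₀) ⬝ᵥ (w - w₀) ≤ r := by
  set c₀ := C * √(w₀ ⬝ᵥ w₀) with hc₀
  set K := (c₀ ^ 2 + 2 * c₀) * (s + 2) with hK
  -- Deviations of total squared size `r / 4` on two outer blocks of effective length `c T / 2`
  -- raise the sum of squares by `β T`. The block error, the walk at the candidate date and the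
  -- bounded terms each get a budget of `β T / 4`.
  set β := l * c * r / 16 with hβ
  have hc₀0 : 0 ≤ c₀ := by positivity
  have hK0 : 0 ≤ K := by positivity
  have hβ0 : 0 < β := by positivity
  set κ := min (min 1 (l / (d + 1))) (β * l / (8 * (d + 1))) with hκdef
  have hκ : 0 < κ := by positivity
  have hκ1 : κ ≤ 1 := (min_le_left _ _).trans (min_le_left _ _)
  have hκl : κ * d ≤ l := by
    have h1 : κ ≤ l / (d + 1) := (min_le_left _ _).trans (min_le_right _ _)
    rw [le_div_iff₀ (by positivity)] at h1
    linarith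
  have hκ2 : 2 * d * κ ^ 2 / l ≤ β / 4 := by
    have h1 : κ ≤ β * l / (8 * (d + 1)) := min_le_right _ _
    rw [le_div_iff₀ (by positivity)] at h1
    rw [div_le_iff₀ hl]
    have h2 : κ ^ 2 ≤ κ := by nlinarith
    have h3 : d * κ ^ 2 ≤ d * κ := by gcongr
    nlinarith
  set η := min c (β / (4 * (K + 1))) with hηdef
  have hη : 0 < η := by positivity
  have hηK : K * η ≤ β / 4 := by
    have h1 : η ≤ β / (4 * (K + 1)) := min_le_right _ _
    rw [le_div_iff₀ (by positivity)] at h1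
    linarith
  refine ⟨κ, hκ, η, hη, min_le_left _ _, fun N => ?_⟩
  filter_upwards [eventually_le_mul_natCast (3 * (s + 1) * N + K * N + p₀)
      (show 0 < β / 4 by positivity), eventually_le_mul_natCast N (half_pos hc),
      eventually_gt_atTop 0] with T hT1 hT2 hT0 a e k₀ hbr hg k hk hkT hkη u w hle
  have hTpos : (0 : ℝ) < T := by exact_mod_cast hT0
  obtain ⟨hk₀, hk₀T⟩ := hbr.pos hc
  have hlow := hg.le_residualSq (w₀ := w₀) hκ.le hκl hl hSig hs hk₀ hk₀T hk hkT u w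
  rw [residualSq_true hk₀ hk₀T hk hkT] at hle
  have hηc : η * T ≤ c * T := by gcongr; exact min_le_left _ _
  have habs := abs_le.1 hkη
  -- The true date is `2 c T` away from both ends and `k` is within `c T` of it, so both outer
  -- blocks have length at least `c T`; the threshold `N` costs at most half of that.
  have hm1 : c * T / 2 ≤ max (min (k₀ : ℝ) k - N) 0 := by
    refine le_max_of_le_left ?_
    have : c * T ≤ min (k₀ : ℝ) k :=
      le_min (by linarith [hbr.left, mul_pos hc hTpos]) (by linarith [hbr.left, habs.1])
    linarith
  have hm3 : c * T / 2 ≤ max ((T : ℝ) - max (k₀ : ℝ) k - N) 0 := by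
    refine le_max_of_le_left ?_
    have : max (k₀ : ℝ) k ≤ T - c * T :=
      max_le (by linarith [hbr.right, mul_pos hc hTpos]) (by linarith [hbr.right, habs.2])
    linarith
  have hu := dotProduct_self_nonneg' u
  have hv := dotProduct_self_nonneg' (u + w - w₀)
  have hmid : 0 ≤ max (|(k : ℝ) - k₀| - N) 0 * ((u + if k ≤ k₀ then w else -w₀) ⬝ᵥ
            (u + if k ≤ k₀ then w else -w₀)) :=
    mul_nonneg (le_max_right _ _) (dotProduct_self_nonneg' _)
  have hw₀b := hbr.abs_dotProduct_le hC (le_refl (w₀ ⬝ᵥ w₀))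
  have hwalk : -walk a e w₀ k₀ k ≤ K * (η * T + N) := by
    refine (neg_le_abs _).trans ((abs_walk_le_sum hc₀0 hw₀b k₀ k).trans ?_)
    refine (mul_le_mul_of_nonneg_left (hg.mid.sum_between_le_of_le_one hκ1)
      (by positivity)).trans ?_
    rw [hK, mul_assoc]
    gcongr
  have h1 := mul_le_mul_of_nonneg_right hm1 hu
  have h3 := mul_le_mul_of_nonneg_right hm3 hv
  have hsN : 3 * (s + κ) * N ≤ 3 * (s + 1) * N := by gcongr
  have hκT : 2 * d * κ ^ 2 / l * T ≤ β / 4 * T := by gcongr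
  have hKηT : K * η * T ≤ β / 4 * T := by gcongr
  have hmain : l / 2 * (c * T / 2 * (u ⬝ᵥ u) + c * T / 2 * ((u + w - w₀) ⬝ᵥ (u + w - w₀)))
      ≤ 3 / 4 * β * T := by
    have : l / 2 * (c * T / 2 * (u ⬝ᵥ u) + c * T / 2 * ((u + w - w₀) ⬝ᵥ (u + w - w₀)))
        ≤ l / 2 * (max (min (k₀ : ℝ) k - N) 0 * (u ⬝ᵥ u)
          + max (|(k : ℝ) - k₀| - N) 0 * ((u + if k ≤ k₀ then w else -w₀) ⬝ᵥ
              (u + if k ≤ k₀ then w else -w₀))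
          + max ((T : ℝ) - max (k₀ : ℝ) k - N) 0 * ((u + w - w₀) ⬝ᵥ (u + w - w₀))) := by
      exact mul_le_mul_of_nonneg_left (by linarith only [h1, h3, hmid]) (by positivity)
    linarith only [this, hlow, hle, hwalk, hsN, hκT, hKηT, hT1]
  have hsum : u ⬝ᵥ u + (u + w - w₀) ⬝ᵥ (u + w - w₀) ≤ r / 4 := by
    have hpos : 0 < l * c * T / 4 := by positivity
    refine le_of_mul_le_mul_left ?_ hpos
    have h5 : l * c * T / 4 * (r / 4) = β * T := by rw [hβ]; ring
    rw [h5]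
    have h6 := mul_pos hβ0 hTpos
    linarith only [h6, hmain]
  constructor
  · linarith only [hsum, hv, hr]
  · have h7 : w - w₀ = (u + w - w₀) - u := by abel
    rw [h7]
    have := dotProduct_self_sub_le (u + w - w₀) u
    linarith only [this, hsum, hr]

/-! ### Comparison of profiles at two break dates -/

section

variable {Γ : Type*} {u w : Γ → Fin d → ℝ} {pen : Γ → ℝ} {γ₀ : Γ} {T : ℕ}
  {a : ℤ → Fin d → ℝ} {e : ℤ → ℝ} {k₀ k k' : ℤ}

theorem residualSq_nonneg (u w : Fin d → ℝ) : 0 ≤ residualSq T a e w₀ k₀ k u w :=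
  Finset.sum_nonneg fun _ _ => sq_nonneg _

theorem bddBelow_profile (hpen : ∀ γ, 0 ≤ pen γ) :
    BddBelow (Set.range fun γ => residualSq T a e w₀ k₀ k (u γ) (w γ) + pen γ) :=
  ⟨0, by rintro _ ⟨γ, rfl⟩; exact add_nonneg (residualSq_nonneg _ _) (hpen γ)⟩

theorem profile_le (hpen : ∀ γ, 0 ≤ pen γ) (γ : Γ) :
    profile u w pen T a e w₀ k₀ k ≤ residualSq T a e w₀ k₀ k (u γ) (w γ) + pen γ :=
  ciInf_le (bddBelow_profile hpen) γ

theorem profile_true_le (hpen : ∀ γ, 0 ≤ pen γ) (hu : u γ₀ = 0) (hw : w γ₀ = w₀)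
    (hk₀ : 0 ≤ k₀) (hk₀T : k₀ ≤ T) :
    profile u w pen T a e w₀ k₀ k₀ ≤ ∑ t ∈ Finset.Ioc (0 : ℤ) T, e t ^ 2 + pen γ₀ := by
  have h := profile_le (T := T) (a := a) (e := e) (w₀ := w₀) (k₀ := k₀) (k := k₀)
    (u := u) (w := w) hpen γ₀
  rwa [hu, hw, residualSq_true hk₀ hk₀T hk₀ hk₀T, walk_self, sub_zero] at h

/-- Parameters fitting better than the true ones are localized, so the increment `D` is available
for them. All others are beaten by `γ₀`, which is itself localized. It therefore suffices to compare
sums of squares near the true coefficients. -/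
theorem add_le_profile_of_localized (hpen : ∀ γ, 0 ≤ pen γ) (hu : u γ₀ = 0) (hw : w γ₀ = w₀)
    {r D : ℝ} (hr : 0 ≤ r)
    (hloc : ∀ u w, residualSq T a e w₀ k₀ k u w ≤ residualSq T a e w₀ k₀ k 0 w₀ + pen γ₀ →
        u ⬝ᵥ u ≤ r ∧ (w - w₀) ⬝ᵥ (w - w₀) ≤ r)
    (hD : ∀ u w, u ⬝ᵥ u ≤ r → (w - w₀) ⬝ᵥ (w - w₀) ≤ r →
      residualSq T a e w₀ k₀ k' u w + D ≤ residualSq T a e w₀ k₀ k u w) :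
    profile u w pen T a e w₀ k₀ k' + D ≤ profile u w pen T a e w₀ k₀ k := by
  have : Nonempty Γ := ⟨γ₀⟩
  refine le_ciInf fun γ => ?_
  have key : ∀ γ, u γ ⬝ᵥ u γ ≤ r → (w γ - w₀) ⬝ᵥ (w γ - w₀) ≤ r →
      profile u w pen T a e w₀ k₀ k' + D ≤ residualSq T a e w₀ k₀ k (u γ) (w γ) + pen γ := by
    intro γ h1 h2
    linarith [hD _ _ h1 h2, profile_le (T := T) (a := a) (e := e) (w₀ := w₀) (k₀ := k₀) (k := k')
      (u := u) (w := w) hpen γ]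
  by_cases h : residualSq T a e w₀ k₀ k (u γ) (w γ) + pen γ
      ≤ residualSq T a e w₀ k₀ k 0 w₀ + pen γ₀
  · obtain ⟨h1, h2⟩ := hloc (u γ) (w γ) (by linarith [hpen γ])
    exact key γ h1 h2
  · have h0 := key γ₀ (by simpa [hu] using hr) (by simpa [hw] using hr)
    rw [hu, hw] at h0
    linarith

end

variable {Γ : Type*} {u w : Γ → Fin d → ℝ} {pen : Γ → ℝ} {γ₀ : Γ}

/-- The profile grows linearly in the distance from the true break date. -/
theorem exists_profile_growth (hl : 0 < l)
    (hSig : ∀ v, 2 * l * (v ⬝ᵥ v) ≤ v ⬝ᵥ (Sig *ᵥ v)) (hs : 0 ≤ s) (hC : 0 ≤ C) (hc : 0 < c)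
    (hw₀ : w₀ ≠ 0) (hpen : ∀ γ, 0 ≤ pen γ) (hu : u γ₀ = 0) (hw : w γ₀ = w₀) :
    ∃ κ > 0, κ ≤ 1 ∧ ∃ g > 0, ∀ N : ℕ, ∀ᶠ T : ℕ in atTop, ∀ a e k₀, InteriorBreak C c a T k₀ →
      SampleGood κ N Sig s a e T k₀ → ∀ k : ℤ, 0 ≤ k → k ≤ T → (N : ℝ) ≤ |(k : ℝ) - k₀| →
        profile u w pen T a e w₀ k₀ k₀ + g * |(k : ℝ) - k₀| ≤ profile u w pen T a e w₀ k₀ k := by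
  set b := w₀ ⬝ᵥ w₀ with hb
  have hb0 : 0 < b := by
    refine lt_of_le_of_ne (dotProduct_self_nonneg' _) fun h => hw₀ ?_
    exact dotProduct_self_eq_zero.1 h.symm
  set c₀ := C * √b with hc₀
  have hc₀0 : 0 ≤ c₀ := by positivity
  -- The factor `2` arises from `|k - k₀| + N ≤ 2 |k - k₀|`. The radius `α` keeps the slope error
  -- below a quarter of the drift `l * b`; the noise takes another quarter.
  set E := (6 * c₀ + 7) * (s + 2) * 2 with hE
  have hE0 : 0 < E := by positivity
  -- the radius of the neighbourhood of the true coefficients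
  set α := min 1 (l * b / (4 * E)) with hαdef
  have hα0 : 0 < α := by positivity
  have hαE : α * E ≤ l * b / 4 := by
    have h1 : α ≤ l * b / (4 * E) := min_le_right _ _
    rw [le_div_iff₀ (by positivity)] at h1
    linarith
  -- With regressors of norm at most `C`, coefficients of squared norm at most `r` change fitted
  -- values by at most `α`.
  set r := (α / (C + 1)) ^ 2 with hrdef
  have hr0 : 0 < r := by positivity
  have hrα : C * √r ≤ α := by
    rw [hrdef, Real.sqrt_sq (by positivity), mul_div_assoc', div_le_iff₀ (by positivity)]
    nlinarith
  obtain ⟨κ₁, hκ₁, η, hη, hηc, hloc⟩ := exists_localization hl hSig hs hC hc w₀ (pen γ₀) hr0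
  set G := l * η * b / 32 with hG
  have hG0 : 0 < G := by positivity
  set A := ∑ i, |w₀ i| with hA
  have hA0 : 0 ≤ A := Finset.sum_nonneg fun i _ => abs_nonneg _
  obtain ⟨κ, hκ, hκκ₁, hκ1, hκl, hκG, hκA⟩ : ∃ κ > 0, κ ≤ κ₁ ∧ κ ≤ 1 ∧ κ * d ≤ l ∧
      2 * d * κ ^ 2 / l ≤ G ∧ 2 * κ * A ≤ l * b / 4 := by
    refine ⟨min (min κ₁ 1) (min (min (l / (d + 1)) (G * l / (2 * (d + 1))))
      (l * b / (8 * (A + 1)))), by positivity, (min_le_left _ _).trans (min_le_left _ _),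
      (min_le_left _ _).trans (min_le_right _ _), ?_, ?_, ?_⟩
    all_goals
      set κ := min (min κ₁ 1) (min (min (l / (d + 1)) (G * l / (2 * (d + 1))))
        (l * b / (8 * (A + 1)))) with hκdef
      have hκ : 0 < κ := by positivity
    · have h1 : κ ≤ l / (d + 1) :=
        (min_le_right _ _).trans ((min_le_left _ _).trans (min_le_left _ _))
      rw [le_div_iff₀ (by positivity)] at h1
      linarith
    · have h1 : κ ≤ G * l / (2 * (d + 1)) :=
        (min_le_right _ _).trans ((min_le_left _ _).trans (min_le_right _ _))
      have h4 : κ ≤ 1 := (min_le_left _ _).trans (min_le_right _ _)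
      rw [le_div_iff₀ (by positivity)] at h1
      rw [div_le_iff₀ hl]
      have h2 : κ ^ 2 ≤ κ := by nlinarith
      have h3 : d * κ ^ 2 ≤ d * κ := by gcongr
      nlinarith
    · have h1 : κ ≤ l * b / (8 * (A + 1)) := (min_le_right _ _).trans (min_le_right _ _)
      rw [le_div_iff₀ (by positivity)] at h1
      linarith
  refine ⟨κ, hκ, hκ1, min G (l * b / 2), by positivity, fun N => ?_⟩
  filter_upwards [hloc N, eventually_le_mul_natCast (3 * (s + 1) * N + pen γ₀) hG0,
    eventually_le_mul_natCast (N : ℝ) (half_pos hη)] with T hlocT hT1 hT2 a e k₀ hbr hg k hk hkT hN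
  obtain ⟨hk₀, hk₀T⟩ := hbr.pos hc
  have habs0 : 0 ≤ |(k : ℝ) - k₀| := abs_nonneg _
  have hT0 : (0 : ℝ) ≤ T := Nat.cast_nonneg _
  have hw₀b := hbr.abs_dotProduct_le hC (le_refl (w₀ ⬝ᵥ w₀))
  rcases le_total |(k : ℝ) - k₀| (η * T) with hnear | hfar
  · refine add_le_profile_of_localized hpen hu hw hr0.le
      (hlocT a e k₀ hbr (hg.mono hκκ₁) k hk hkT hnear) fun u' w' hu' hw' => ?_
    have h1 := abs_residualSq_sub_add_walk_le (e := e) hk₀ hk₀T hk hkT (α := α) (min_le_left _ _)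
      hw₀b (fun t => (hbr.abs_dotProduct_le hC hu' t).trans hrα)
      (fun t => (hbr.abs_dotProduct_le hC hw' t).trans hrα)
    have h2 : α * (6 * c₀ + 7) * ∑ t ∈ between k₀ k, (1 + e t ^ 2)
        ≤ l * b / 4 * |(k : ℝ) - k₀| := by
      calc α * (6 * c₀ + 7) * ∑ t ∈ between k₀ k, (1 + e t ^ 2)
          ≤ α * (6 * c₀ + 7) * ((s + 2) * (|(k : ℝ) - k₀| + N)) := by
            gcongr
            exact hg.mid.sum_between_le_of_le_one hκ1
        _ ≤ α * (6 * c₀ + 7) * ((s + 2) * (2 * |(k : ℝ) - k₀|)) := by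
            gcongr
            linarith
        _ = α * E * |(k : ℝ) - k₀| := by rw [hE]; ring
        _ ≤ _ := by gcongr
    have h3 := hg.mid.walk_le (w₀ := w₀) hκl hSig hN
    have h4 : 2 * κ * A * |(k : ℝ) - k₀| ≤ l * b / 4 * |(k : ℝ) - k₀| := by gcongr
    have h5 : min G (l * b / 2) * |(k : ℝ) - k₀| ≤ l * b / 2 * |(k : ℝ) - k₀| := by
      gcongr
      exact min_le_right _ _
    have h6 := (abs_le.1 h1).1
    linarith only [h2, h3, h4, h5, h6]
  · have hkT' : |(k : ℝ) - k₀| ≤ T := by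
      have h1 : (0 : ℝ) ≤ k := by exact_mod_cast hk
      have h2 : (k : ℝ) ≤ T := by exact_mod_cast hkT
      have h3 : (0 : ℝ) ≤ k₀ := by exact_mod_cast hk₀
      have h4 : (k₀ : ℝ) ≤ T := by exact_mod_cast hk₀T
      rw [abs_le]
      constructor <;> linarith
    have hlow : ∑ t ∈ Finset.Ioc (0 : ℤ) T, e t ^ 2 + pen γ₀ + 2 * G * T
        ≤ profile u w pen T a e w₀ k₀ k := by
      have : Nonempty Γ := ⟨γ₀⟩
      refine le_ciInf fun γ => ?_
      have h1 := hg.le_residualSq (w₀ := w₀) hκ.le hκl hl hSig hs hk₀ hk₀T hk hkT (u γ) (w γ)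
      have hmid : η * T / 2 ≤ max (|(k : ℝ) - k₀| - N) 0 := le_max_of_le_left (by linarith)
      have hηcT : η * T ≤ c * T := by gcongr
      -- The middle block and the outer block beyond `k₀` have coefficient errors that differ by
      -- exactly `w₀`. They cannot both be small: their squared norms add up to at least `b / 2`,
      -- and both blocks have length of order `T`.
      have hgain : l / 2 * (η * T / 2 * (b / 2))
          ≤ l / 2 * (max (min (k₀ : ℝ) k - N) 0 * (u γ ⬝ᵥ u γ)
          + max (|(k : ℝ) - k₀| - N) 0 * ((u γ + if k ≤ k₀ then w γ else -w₀) ⬝ᵥ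
            (u γ + if k ≤ k₀ then w γ else -w₀))
          + max ((T : ℝ) - max (k₀ : ℝ) k - N) 0 *
            ((u γ + w γ - w₀) ⬝ᵥ (u γ + w γ - w₀))) := by
        refine mul_le_mul_of_nonneg_left ?_ (by positivity)
        have hηT : 0 ≤ η * T / 2 := by positivity
        rcases le_or_gt k k₀ with hkk | hkk
        · have hkk' : (k : ℝ) ≤ k₀ := by exact_mod_cast hkk
          rw [if_pos hkk, max_eq_left hkk']
          have hr3 : η * T / 2 ≤ max ((T : ℝ) - k₀ - N) 0 :=
            le_max_of_le_left (by linarith [hbr.right])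
          have h2 := dotProduct_self_sub_le (u γ + w γ) (u γ + w γ - w₀)
          rw [sub_sub_cancel] at h2
          have h3 := mul_le_mul_of_nonneg_right hmid (dotProduct_self_nonneg' (u γ + w γ))
          have h4 := mul_le_mul_of_nonneg_right hr3 (dotProduct_self_nonneg' (u γ + w γ - w₀))
          have h5 := mul_nonneg (le_max_right (min (k₀ : ℝ) k - N) 0)
            (dotProduct_self_nonneg' (u γ))
          have h6 := mul_le_mul_of_nonneg_left h2 hηT
          linarith only [h3, h4, h5, h6, hb]
        · have hkk' : (k₀ : ℝ) ≤ k := by exact_mod_cast hkk.le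
          rw [if_neg (by omega), min_eq_left hkk', ← sub_eq_add_neg]
          have hr3 : η * T / 2 ≤ max ((k₀ : ℝ) - N) 0 :=
            le_max_of_le_left (by linarith [hbr.left])
          have h2 := dotProduct_self_sub_le (u γ) (u γ - w₀)
          rw [sub_sub_cancel] at h2
          have h3 := mul_le_mul_of_nonneg_right hmid (dotProduct_self_nonneg' (u γ - w₀))
          have h4 := mul_le_mul_of_nonneg_right hr3 (dotProduct_self_nonneg' (u γ))
          have h5 := mul_nonneg (le_max_right ((T : ℝ) - max (k₀ : ℝ) k - N) 0)
            (dotProduct_self_nonneg' (u γ + w γ - w₀))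
          have h6 := mul_le_mul_of_nonneg_left h2 hηT
          linarith only [h3, h4, h5, h6, hb]
      have h6 : l / 2 * (η * T / 2 * (b / 2)) = 4 * G * T := by rw [hG]; ring
      have h7 : 2 * d * κ ^ 2 / l * T ≤ G * T := by gcongr
      have h8 : 3 * (s + κ) * N ≤ 3 * (s + 1) * N := by gcongr
      linarith only [hpen γ, h1, hgain, h6, h7, h8, hT1]
    have hup := profile_true_le (T := T) (a := a) (e := e) (w₀ := w₀) hpen hu hw hk₀ hk₀T
    have h5 : min G (l * b / 2) * |(k : ℝ) - k₀| ≤ G * T := by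
      gcongr
      exact min_le_left _ _
    have h6 := mul_nonneg hG0.le hT0
    linarith only [hlow, hup, h5, h6]

/-- Close to the true break date the profile differs from its value there by the walk. -/
theorem exists_profile_near (hl : 0 < l)
    (hSig : ∀ v, 2 * l * (v ⬝ᵥ v) ≤ v ⬝ᵥ (Sig *ᵥ v)) (hs : 0 ≤ s) (hC : 0 ≤ C) (hc : 0 < c)
    (hpen : ∀ γ, 0 ≤ pen γ) (hu : u γ₀ = 0) (hw : w γ₀ = w₀) (M N' : ℕ)
    {ρ : ℝ} (hρ : 0 < ρ) :
    ∃ κ > 0, ∀ N : ℕ, ∀ᶠ T : ℕ in atTop, ∀ a e k₀, InteriorBreak C c a T k₀ →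
      SampleGood κ N Sig s a e T k₀ → AnchorGood 1 N' Sig s a e k₀ →
      ∀ k : ℤ, 0 ≤ k → k ≤ T → |(k : ℝ) - k₀| ≤ M →
        |profile u w pen T a e w₀ k₀ k₀ - profile u w pen T a e w₀ k₀ k - walk a e w₀ k₀ k|
          ≤ ρ := by
  set c₀ := C * √(w₀ ⬝ᵥ w₀) with hc₀
  have hc₀0 : 0 ≤ c₀ := by positivity
  -- The error sums are bounded through the coarse anchor with threshold `N'`, fixed in advance. The
  -- fine threshold `N` may depend on `κ`, hence on `E`, so it must not enter here.
  set E := (6 * c₀ + 7) * ((s + 2) * (M + N')) + 1 with hE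
  have hE0 : 0 < E := by positivity
  set α := min 1 (ρ / E) with hαdef
  have hα0 : 0 < α := by positivity
  have hαE : α * E ≤ ρ := by
    have h1 : α ≤ ρ / E := min_le_right _ _
    rwa [le_div_iff₀ (by positivity)] at h1
  set r := (α / (C + 1)) ^ 2 with hrdef
  have hr0 : 0 < r := by positivity
  have hrα : C * √r ≤ α := by
    rw [hrdef, Real.sqrt_sq (by positivity), mul_div_assoc', div_le_iff₀ (by positivity)]
    nlinarith
  obtain ⟨κ, hκ, η, hη, hηc, hloc⟩ := exists_localization hl hSig hs hC hc w₀ (pen γ₀) hr0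
  refine ⟨κ, hκ, fun N => ?_⟩
  filter_upwards [hloc N, eventually_le_mul_natCast (M : ℝ) hη]
    with T hlocT hT a e k₀ hbr hg hg' k hk hkT hM
  obtain ⟨hk₀, hk₀T⟩ := hbr.pos hc
  have hw₀b := hbr.abs_dotProduct_le hC (le_refl (w₀ ⬝ᵥ w₀))
  have hdiff : ∀ u' w', u' ⬝ᵥ u' ≤ r → (w' - w₀) ⬝ᵥ (w' - w₀) ≤ r →
      |residualSq T a e w₀ k₀ k u' w' - residualSq T a e w₀ k₀ k₀ u' w' + walk a e w₀ k₀ k|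
        ≤ ρ := by
    intro u' w' hu' hw'
    refine (abs_residualSq_sub_add_walk_le (e := e) hk₀ hk₀T hk hkT (α := α) (min_le_left _ _)
      hw₀b (fun t => (hbr.abs_dotProduct_le hC hu' t).trans hrα)
      (fun t => (hbr.abs_dotProduct_le hC hw' t).trans hrα)).trans ?_
    calc α * (6 * c₀ + 7) * ∑ t ∈ between k₀ k, (1 + e t ^ 2)
        ≤ α * (6 * c₀ + 7) * ((s + 2) * (|(k : ℝ) - k₀| + N')) := by
          gcongr
          exact hg'.sum_between_le_of_le_one le_rfl
      _ ≤ α * (6 * c₀ + 7) * ((s + 2) * (M + N')) := by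
          gcongr
      _ ≤ α * E := by
          rw [hE]
          linarith only [hα0]
      _ ≤ ρ := hαE
  have hTη : |(k₀ : ℝ) - k₀| ≤ η * T := by
    rw [sub_self, abs_zero]
    positivity
  -- Both inequalities come from the same comparison, applied from `k` to `k₀` and back.
  have h1 := add_le_profile_of_localized (k := k) (k' := k₀) (D := -walk a e w₀ k₀ k - ρ)
    hpen hu hw hr0.le (hlocT a e k₀ hbr hg k hk hkT (hM.trans hT)) fun u' w' hu' hw' => by
      linarith [(abs_le.1 (hdiff u' w' hu' hw')).1]
  have h2 := add_le_profile_of_localized (k := k₀) (k' := k) (D := walk a e w₀ k₀ k - ρ)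
    hpen hu hw hr0.le (hlocT a e k₀ hbr hg k₀ hk₀ hk₀T hTη) fun u' w' hu' hw' => by
      linarith [(abs_le.1 (hdiff u' w' hu' hw')).2]
  rw [abs_le]
  constructor <;> linarith

/-- The profile is of the order of the sample size. -/
theorem exists_profile_bounds (hl : 0 < l)
    (hSig : ∀ v, 2 * l * (v ⬝ᵥ v) ≤ v ⬝ᵥ (Sig *ᵥ v)) (hs : 0 < s) (hc : 0 < c)
    (hpen : ∀ γ, 0 ≤ pen γ) (hu : u γ₀ = 0) (hw : w γ₀ = w₀) :
    ∃ κ > 0, ∀ N : ℕ, ∀ᶠ T : ℕ in atTop, ∀ a e k₀, InteriorBreak C c a T k₀ →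
      SampleGood κ N Sig s a e T k₀ →
      profile u w pen T a e w₀ k₀ k₀ ≤ (s + 2) * T ∧
      ∀ k : ℤ, 0 ≤ k → k ≤ T → 0 < profile u w pen T a e w₀ k₀ k := by
  obtain ⟨κ, hκ, hκ1, hκl, hκs, hκs'⟩ : ∃ κ > 0, κ ≤ 1 ∧ κ * d ≤ l ∧
      2 * d * κ ^ 2 / l ≤ s / 4 ∧ κ ≤ s / 4 := by
    refine ⟨min (min 1 (l / (d + 1))) (min (s * l / (8 * (d + 1))) (s / 4)), by positivity,
      (min_le_left _ _).trans (min_le_left _ _), ?_, ?_,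
      (min_le_right _ _).trans (min_le_right _ _)⟩
    all_goals
      set κ := min (min 1 (l / (d + 1))) (min (s * l / (8 * (d + 1))) (s / 4)) with hκdef
      have hκ : 0 < κ := by positivity
    · have h1 : κ ≤ l / (d + 1) := (min_le_left _ _).trans (min_le_right _ _)
      rw [le_div_iff₀ (by positivity)] at h1
      linarith
    · have h1 : κ ≤ s * l / (8 * (d + 1)) := (min_le_right _ _).trans (min_le_left _ _)
      have h4 : κ ≤ 1 := (min_le_left _ _).trans (min_le_left _ _)
      rw [le_div_iff₀ (by positivity)] at h1
      rw [div_le_iff₀ hl]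
      have h2 : κ ^ 2 ≤ κ := by nlinarith
      have h3 : d * κ ^ 2 ≤ d * κ := by gcongr
      nlinarith
  refine ⟨κ, hκ, fun N => ?_⟩
  filter_upwards [eventually_ge_atTop N, eventually_le_mul_natCast (3 * (s + 1) * N + 1)
    (show 0 < s / 4 by positivity), eventually_natCast_ge (pen γ₀)]
    with T hTN hT1 hT2 a e k₀ hbr hg
  obtain ⟨hk₀, hk₀T⟩ := hbr.pos hc
  have hT0 : (0 : ℝ) ≤ T := Nat.cast_nonneg _
  have hB := hg.left.blockGood (B := Finset.Ioc (0 : ℤ) T) ⟨T, Or.inl rfl⟩ (by simpa using hTN)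
  have hee := abs_le.1 hB.ee
  rw [card_Ioc_cast (by omega)] at hee
  push_cast at hee
  rw [sub_zero] at hee
  have hκT : κ * T ≤ s / 4 * T := by gcongr
  have hκT1 : κ * T ≤ 1 * T := by gcongr
  refine ⟨?_, fun k hk hkT => ?_⟩
  · have hup := profile_true_le (T := T) (a := a) (e := e) (w₀ := w₀) hpen hu hw hk₀ hk₀T
    linarith
  · have : Nonempty Γ := ⟨γ₀⟩
    refine lt_of_lt_of_le one_pos (le_ciInf fun γ => ?_)
    have h1 := hg.le_residualSq (w₀ := w₀) hκ.le hκl hl hSig hs.le hk₀ hk₀T hk hkT (u γ) (w γ)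
    have h2 : 0 ≤ l / 2 * (max (min (k₀ : ℝ) k - N) 0 * (u γ ⬝ᵥ u γ)
          + max (|(k : ℝ) - k₀| - N) 0 * ((u γ + if k ≤ k₀ then w γ else -w₀) ⬝ᵥ
            (u γ + if k ≤ k₀ then w γ else -w₀))
          + max ((T : ℝ) - max (k₀ : ℝ) k - N) 0 *
            ((u γ + w γ - w₀) ⬝ᵥ (u γ + w γ - w₀))) := by
      have := dotProduct_self_nonneg' (u γ)
      have := dotProduct_self_nonneg' (u γ + w γ - w₀)
      have := dotProduct_self_nonneg' (u γ + if k ≤ k₀ then w γ else -w₀)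
      positivity
    have h7 : 2 * d * κ ^ 2 / l * T ≤ s / 4 * T := by gcongr
    have h8 : 3 * (s + κ) * N ≤ 3 * (s + 1) * N := by gcongr
    linarith [hpen γ, mul_nonneg hs.le hT0]

end Profile

/-! ### Stationarity and almost sure bounds for all blocks at an anchor -/

theorem sum_Ioc_comp_add (p q h : ℤ) (f : ℤ → ℝ) :
    ∑ t ∈ Finset.Ioc p q, f (t + h) = ∑ t ∈ Finset.Ioc (p + h) (q + h), f t := by
  refine Finset.sum_nbij' (fun t => t + h) (fun t => t - h) ?_ ?_ ?_ ?_ ?_ <;> intro t ht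
  all_goals
    try rw [Finset.mem_Ioc] at ht
    try rw [Finset.mem_Ioc]
    try omega

section Stationary

variable {d : ℕ}

/-- The path `t ↦ (x_t, ε_t)` of the process. -/
def samplePath {Ω : Type*} (x : ℤ → Ω → Fin d → ℝ) (ε : ℤ → Ω → ℝ) (ω : Ω) :
    ℤ → (Fin d → ℝ) × ℝ := fun t => (x t ω, ε t ω)

/-- The shift of a path by `h`. -/
def shiftPath (h : ℤ) (p : ℤ → (Fin d → ℝ) × ℝ) : ℤ → (Fin d → ℝ) × ℝ := fun t => p (t + h)

theorem measurable_shiftPath (h : ℤ) : Measurable (shiftPath (d := d) h) :=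
  measurable_pi_lambda _ fun _ => measurable_pi_apply _

theorem shiftPath_iterate (h : ℤ) (n : ℕ) (p : ℤ → (Fin d → ℝ) × ℝ) (t : ℤ) :
    (shiftPath h)^[n] p t = p (t + n * h) := by
  induction n generalizing t with
  | zero => simp
  | succ n ih =>
    rw [Function.iterate_succ_apply', shiftPath, ih]
    congr 1
    push_cast
    ring

theorem birkhoffSum_shiftPath_one (F : (Fin d → ℝ) × ℝ → ℝ) (n : ℕ) (p : ℤ → (Fin d → ℝ) × ℝ) :
    birkhoffSum (shiftPath 1) (fun p => F (p 1)) n p = ∑ t ∈ Finset.Ioc (0 : ℤ) n, F (p t) := by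
  induction n with
  | zero => simp
  | succ n ih =>
    rw [birkhoffSum_succ, ih, shiftPath_iterate]
    rw [← sum_Ioc_add_sum_Ioc (q := (n : ℤ)) (r := ((n + 1 : ℕ) : ℤ)) (by omega)
      (by push_cast; omega)]
    congr 1
    have : Finset.Ioc (n : ℤ) ((n + 1 : ℕ) : ℤ) = {1 + (n : ℤ) * 1} := by
      ext t
      rw [Finset.mem_Ioc, Finset.mem_singleton]
      push_cast
      omega
    rw [this, Finset.sum_singleton]

theorem birkhoffSum_shiftPath_neg_one (F : (Fin d → ℝ) × ℝ → ℝ) (n : ℕ)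
    (p : ℤ → (Fin d → ℝ) × ℝ) :
    birkhoffSum (shiftPath (-1)) (fun p => F (p 0)) n p
      = ∑ t ∈ Finset.Ioc (-n : ℤ) 0, F (p t) := by
  induction n with
  | zero => simp
  | succ n ih =>
    rw [birkhoffSum_succ, ih, shiftPath_iterate]
    rw [← sum_Ioc_add_sum_Ioc (p := -((n + 1 : ℕ) : ℤ)) (q := -(n : ℤ)) (by push_cast; omega)
      (by omega), add_comm]
    congr 1
    have : Finset.Ioc (-((n + 1 : ℕ) : ℤ)) (-(n : ℤ)) = {0 + (n : ℤ) * (-1)} := by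
      ext t
      rw [Finset.mem_Ioc, Finset.mem_singleton]
      push_cast
      omega
    rw [this, Finset.sum_singleton]

/-! ### Good blocks as events in path space -/

variable {Ω : Type*} {x : ℤ → Ω → Fin d → ℝ} {ε : ℤ → Ω → ℝ}

/-- The paths all of whose blocks of length at least `N` at the origin are good. -/
def goodPaths (κ : ℝ) (Sig : Matrix (Fin d) (Fin d) ℝ) (s : ℝ) (N : ℕ) :
    Set (ℤ → (Fin d → ℝ) × ℝ) :=
  {p | AnchorGood κ N Sig s (fun t => (p t).1) (fun t => (p t).2) 0}

/-- Goodness at the anchor `h` is goodness at the origin of the shifted path, so under stationarity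
its probability is the same for all anchors. -/
theorem anchorGood_iff_shiftPath_mem {κ s : ℝ} {Sig : Matrix (Fin d) (Fin d) ℝ} {N : ℕ} {h : ℤ}
    {ω : Ω} : AnchorGood κ N Sig s (fun t => x t ω) (fun t => ε t ω) h ↔
      shiftPath h (samplePath x ε ω) ∈ goodPaths κ Sig s N := by
  have hB : ∀ p q : ℤ, BlockGood κ Sig s (fun t => x (t + h) ω) (fun t => ε (t + h) ω)
      (Finset.Ioc p q) ↔ BlockGood κ Sig s (fun t => x t ω) (fun t => ε t ω)
      (Finset.Ioc (p + h) (q + h)) := by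
    intro p q
    have hc : (Finset.Ioc (p + h) (q + h)).card = (Finset.Ioc p q).card := by
      simp [Int.card_Ioc]
    constructor
    · intro hb
      refine ⟨fun i j => ?_, fun i => ?_, ?_⟩
      · rw [hc, ← sum_Ioc_comp_add p q h fun t => x t ω i * x t ω j]; exact hb.xx i j
      · rw [hc, ← sum_Ioc_comp_add p q h fun t => x t ω i * ε t ω]; exact hb.xe i
      · rw [hc, ← sum_Ioc_comp_add p q h fun t => ε t ω ^ 2]; exact hb.ee
    · intro hb
      refine ⟨fun i j => ?_, fun i => ?_, ?_⟩
      · have := hb.xx i j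
        rwa [hc, ← sum_Ioc_comp_add p q h fun t => x t ω i * x t ω j] at this
      · have := hb.xe i
        rwa [hc, ← sum_Ioc_comp_add p q h fun t => x t ω i * ε t ω] at this
      · have := hb.ee
        rwa [hc, ← sum_Ioc_comp_add p q h fun t => ε t ω ^ 2] at this
  constructor
  · intro hg q hq
    have := hg (q + h) (by simpa using hq)
    constructor
    · refine (hB 0 q).2 ?_
      rw [zero_add]; exact this.1
    · refine (hB q 0).2 ?_
      rw [zero_add]; exact this.2
  · intro hg q hq
    have := hg (q - h) (by simpa using hq)
    constructor
    · have h1 := (hB 0 (q - h)).1 this.1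
      rwa [zero_add, sub_add_cancel] at h1
    · have h1 := (hB (q - h) 0).1 this.2
      rwa [zero_add, sub_add_cancel] at h1

variable [MeasurableSpace Ω] {P : Measure Ω}

theorem measurable_samplePath (hx : ∀ t, Measurable (x t)) (hε : ∀ t, Measurable (ε t)) :
    Measurable (samplePath x ε) :=
  measurable_pi_lambda _ fun t => (hx t).prodMk (hε t)

theorem measurePreserving_shiftPath (hx : ∀ t, Measurable (x t)) (hε : ∀ t, Measurable (ε t))
    (hstat : IsStrictlyStationary P x ε) (h : ℤ) :
    MeasurePreserving (shiftPath h) (P.map (samplePath x ε)) (P.map (samplePath x ε)) := by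
  refine ⟨measurable_shiftPath h, ?_⟩
  rw [Measure.map_map (measurable_shiftPath h) (measurable_samplePath hx hε)]
  exact hstat h

theorem measure_shiftPath_mem (hx : ∀ t, Measurable (x t)) (hε : ∀ t, Measurable (ε t))
    (hstat : IsStrictlyStationary P x ε) (h : ℤ) {G : Set (ℤ → (Fin d → ℝ) × ℝ)}
    (hG : MeasurableSet G) :
    P {ω | shiftPath h (samplePath x ε ω) ∈ G} = P {ω | samplePath x ε ω ∈ G} := by
  have hm := measurable_samplePath hx hε
  have h1 := (measurePreserving_shiftPath hx hε hstat h).measure_preimage hG.nullMeasurableSet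
  rw [Measure.map_apply hm (measurable_shiftPath h hG), Measure.map_apply hm hG] at h1
  exact h1

/-- If a.e. path lies in one of the increasing sets `G n`, then one of them contains all shifted
paths with high probability. -/
theorem exists_measure_shiftPath_notMem_le [IsProbabilityMeasure P]
    (hx : ∀ t, Measurable (x t)) (hε : ∀ t, Measurable (ε t))
    (hstat : IsStrictlyStationary P x ε) {G : ℕ → Set (ℤ → (Fin d → ℝ) × ℝ)}
    (hG : ∀ n, MeasurableSet (G n)) (hmono : Monotone G)
    (hae : ∀ᵐ ω ∂P, ∃ n, samplePath x ε ω ∈ G n) {η : ENNReal} (hη : 0 < η) :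
    ∃ n, ∀ h : ℤ, P {ω | shiftPath h (samplePath x ε ω) ∉ G n} ≤ η := by
  have hm := measurable_samplePath hx hε
  have h1 : Tendsto (P ∘ fun n => {ω | samplePath x ε ω ∉ G n}) atTop
      (𝓝 (P (⋂ n, {ω | samplePath x ε ω ∉ G n}))) := by
    refine tendsto_measure_iInter_atTop (fun n => ?_) ?_ ⟨0, measure_ne_top _ _⟩
    · exact (hm (hG n).compl).nullMeasurableSet
    · intro n m hnm ω hω hω'
      exact hω (hmono hnm hω')
  have h2 : P (⋂ n, {ω | samplePath x ε ω ∉ G n}) = 0 := by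
    rw [measure_eq_zero_iff_ae_notMem]
    filter_upwards [hae] with ω ⟨n, hn⟩ hω
    exact Set.mem_iInter.1 hω n hn
  rw [h2] at h1
  obtain ⟨n, hn⟩ := ((ENNReal.tendsto_nhds_zero.1 h1) η hη).exists
  -- Continuity from above gives `n` for the unshifted path; stationarity makes it valid for every
  -- shift.
  refine ⟨n, fun h => ?_⟩
  exact (measure_shiftPath_mem hx hε hstat h (hG n).compl).trans_le hn

/-- Two-sided pointwise ergodic theorem for a function of one observation. -/
theorem ae_two_sided_sum_near [IsProbabilityMeasure P]
    (hx : ∀ t, Measurable (x t)) (hε : ∀ t, Measurable (ε t))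
    (hstat : IsStrictlyStationary P x ε) {F : (Fin d → ℝ) × ℝ → ℝ} (hF : Measurable F)
    (hFi : ∀ t, Integrable (fun ω => F (x t ω, ε t ω)) P) (c : ℝ)
    (hL : ∀ δ : ℝ, 0 < δ → Tendsto (fun n : ℕ => P {ω | δ ≤
      |(n : ℝ)⁻¹ * ∑ t ∈ Finset.Ioc (0 : ℤ) n, F (x t ω, ε t ω) - c|}) atTop (𝓝 0))
    {κ : ℝ} (hκ : 0 < κ) :
    ∀ᵐ ω ∂P, ∃ N : ℕ, ∀ n : ℕ, N ≤ n →
      |∑ t ∈ Finset.Ioc (0 : ℤ) n, F (x t ω, ε t ω) - n * c| ≤ κ * n ∧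
      |∑ t ∈ Finset.Ioc (-n : ℤ) 0, F (x t ω, ε t ω) - n * c| ≤ κ * n := by
  have hm := measurable_samplePath hx hε
  have : IsProbabilityMeasure (P.map (samplePath x ε)) :=
    Measure.isProbabilityMeasure_map hm.aemeasurable
  have hFt : ∀ t : ℤ, Measurable fun p : ℤ → (Fin d → ℝ) × ℝ => F (p t) := fun t =>
    hF.comp (measurable_pi_apply t)
  have hFit : ∀ t : ℤ, Integrable (fun p : ℤ → (Fin d → ℝ) × ℝ => F (p t))
      (P.map (samplePath x ε)) := fun t =>
    (integrable_map_measure (hFt t).aestronglyMeasurable hm.aemeasurable).2 (hFi t)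
  have hset : ∀ (n : ℕ) (δ : ℝ) (a b : ℤ), MeasurableSet {p : ℤ → (Fin d → ℝ) × ℝ | δ ≤
      ‖(n : ℝ)⁻¹ * ∑ t ∈ Finset.Ioc a b, F (p t) - c‖} := by
    intro n δ a b
    refine measurableSet_le measurable_const (Measurable.norm ?_)
    exact ((Finset.measurable_sum _ fun t _ => hFt t).const_mul _).sub_const _
  have h1 := ae_tendsto_birkhoffSum (measurePreserving_shiftPath hx hε hstat 1) (hFt 1) (hFit 1) c
    (by
      rw [tendstoInMeasure_iff_norm]
      intro δ hδ
      simp only [birkhoffSum_shiftPath_one]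
      refine (hL δ hδ).congr fun n => ?_
      rw [Measure.map_apply hm (hset n δ 0 n)]
      rfl) hκ
  have h2 := ae_tendsto_birkhoffSum (measurePreserving_shiftPath hx hε hstat (-1)) (hFt 0) (hFit 0)
    c (by
      rw [tendstoInMeasure_iff_norm]
      intro δ hδ
      simp only [birkhoffSum_shiftPath_neg_one]
      refine (hL δ hδ).congr fun n => ?_
      rw [Measure.map_apply hm (hset n δ (-n) 0)]
      -- The hypothesis concerns forward sums only. By stationarity the sum over `(-n, 0]` has the
      -- law of the sum over `(0, n]`.
      have := measure_shiftPath_mem hx hε hstat n (hset n δ (-n) 0)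
      refine Eq.trans ?_ this
      congr 1
      ext ω
      have h3 : ∑ t ∈ Finset.Ioc (-n : ℤ) 0, F (samplePath x ε ω (t + n))
          = ∑ t ∈ Finset.Ioc (0 : ℤ) n, F (x t ω, ε t ω) := by
        rw [sum_Ioc_comp_add _ _ _ fun t => F (samplePath x ε ω t), neg_add_cancel, zero_add]
        rfl
      change _ ↔ δ ≤ ‖(n : ℝ)⁻¹ * ∑ t ∈ Finset.Ioc (-n : ℤ) 0, F (samplePath x ε ω (t + n)) - c‖
      rw [h3]
      rfl) hκ
  filter_upwards [ae_of_ae_map hm.aemeasurable h1, ae_of_ae_map hm.aemeasurable h2] with ω h1 h2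
  obtain ⟨N1, h1⟩ := h1
  obtain ⟨N2, h2⟩ := h2
  simp only [birkhoffSum_shiftPath_one] at h1
  simp only [birkhoffSum_shiftPath_neg_one] at h2
  exact ⟨max N1 N2, fun n hn => ⟨h1 n (le_of_max_le_left hn), h2 n (le_of_max_le_right hn)⟩⟩

theorem measurableSet_goodPaths (κ : ℝ) (Sig : Matrix (Fin d) (Fin d) ℝ) (s : ℝ) (N : ℕ) :
    MeasurableSet (goodPaths κ Sig s N) := by
  have hB : ∀ B : Finset ℤ, MeasurableSet {p : ℤ → (Fin d → ℝ) × ℝ |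
      BlockGood κ Sig s (fun t => (p t).1) (fun t => (p t).2) B} := by
    intro B
    have : {p : ℤ → (Fin d → ℝ) × ℝ |
        BlockGood κ Sig s (fun t => (p t).1) (fun t => (p t).2) B}
      = (⋂ i, ⋂ j, {p | |∑ t ∈ B, (p t).1 i * (p t).1 j - B.card * Sig i j| ≤ κ * B.card}) ∩
        (⋂ i, {p | |∑ t ∈ B, (p t).1 i * (p t).2| ≤ κ * B.card}) ∩
        {p | |∑ t ∈ B, (p t).2 ^ 2 - B.card * s| ≤ κ * B.card} := by
      ext p
      simp only [Set.mem_inter_iff, Set.mem_iInter, Set.mem_ofPred_eq]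
      exact ⟨fun h => ⟨⟨h.xx, h.xe⟩, h.ee⟩, fun h => ⟨h.1.1, h.1.2, h.2⟩⟩
    rw [this]
    refine ((MeasurableSet.iInter fun i => MeasurableSet.iInter fun j =>
      measurableSet_le ?_ measurable_const).inter
      (MeasurableSet.iInter fun i => measurableSet_le ?_ measurable_const)).inter
      (measurableSet_le ?_ measurable_const)
    all_goals fun_prop
  have : goodPaths κ Sig s N = ⋂ q : ℤ, ⋂ _ : (N : ℤ) ≤ |q - 0|,
      {p | BlockGood κ Sig s (fun t => (p t).1) (fun t => (p t).2) (Finset.Ioc 0 q)} ∩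
      {p | BlockGood κ Sig s (fun t => (p t).1) (fun t => (p t).2) (Finset.Ioc q 0)} := by
    ext p
    simp [goodPaths, AnchorGood]
  rw [this]
  exact MeasurableSet.iInter fun q => MeasurableSet.iInter fun _ => (hB _).inter (hB _)

theorem monotone_goodPaths (κ : ℝ) (Sig : Matrix (Fin d) (Fin d) ℝ) (s : ℝ) :
    Monotone (goodPaths κ Sig s) := by
  intro N M hNM p hp q hq
  exact hp q (le_trans (by exact_mod_cast hNM) hq)

theorem exists_bound_of_ae_mem [IsProbabilityMeasure P] {𝒳 : Set (Fin d → ℝ)}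
    (h𝒳b : Bornology.IsBounded 𝒳) (hx𝒳 : ∀ t, ∀ᵐ ω ∂P, x t ω ∈ 𝒳) :
    ∃ C : ℝ, 0 ≤ C ∧ (∀ᵐ ω ∂P, ∀ t, x t ω ⬝ᵥ x t ω ≤ C ^ 2) ∧
      ∀ᵐ ω ∂P, ∀ t i, |x t ω i| ≤ C := by
  obtain ⟨R, hR⟩ := h𝒳b.subset_closedBall 0
  have hall : ∀ᵐ ω ∂P, ∀ t i, |x t ω i| ≤ |R| := by
    rw [ae_all_iff]
    intro t
    filter_upwards [hx𝒳 t] with ω hω i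
    have h1 := mem_closedBall_zero_iff.1 (hR hω)
    exact (norm_le_pi_norm (x t ω) i).trans (h1.trans (le_abs_self R))
  refine ⟨|R| * (d + 1), by positivity, ?_, ?_⟩
  · filter_upwards [hall] with ω hω t
    have h1 : x t ω ⬝ᵥ x t ω ≤ ∑ _i : Fin d, |R| ^ 2 := by
      refine Finset.sum_le_sum fun i _ => ?_
      rw [← pow_two, ← sq_abs]
      exact pow_le_pow_left₀ (abs_nonneg _) (hω t i) 2
    rw [Finset.sum_const, Finset.card_univ, Fintype.card_fin, nsmul_eq_mul] at h1
    refine h1.trans ?_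
    rw [mul_pow, mul_comm]
    gcongr
    nlinarith [Nat.cast_nonneg (α := ℝ) d]
  · filter_upwards [hall] with ω hω t i
    refine (hω t i).trans ?_
    nlinarith [Nat.cast_nonneg (α := ℝ) d, abs_nonneg R]

/-- Almost every path has good blocks at the origin from some length on. -/
theorem ae_exists_mem_goodPaths [IsProbabilityMeasure P] {dz : ℕ}
    (hx : ∀ t, Measurable (x t)) (hε : ∀ t, Measurable (ε t))
    {C : ℝ} (hC : ∀ᵐ ω ∂P, ∀ t i, |x t ω i| ≤ C) {δ₀ : Fin dz → ℝ} {σsq₀ : ℝ}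
    {SigX : Matrix (Fin d) (Fin d) ℝ} (hdgp : DGPAssumption P x ε δ₀ σsq₀ SigX)
    (hstat : IsStrictlyStationary P x ε) {κ : ℝ} (hκ : 0 < κ) :
    ∀ᵐ ω ∂P, ∃ N, samplePath x ε ω ∈ goodPaths κ SigX σsq₀ N := by
  have hm := measurable_samplePath hx hε
  have hxi : ∀ t i, Measurable fun ω => x t ω i := fun t i => (measurable_pi_apply i).comp (hx t)
  have hbd : ∀ t i, ∀ᵐ ω ∂P, ‖x t ω i‖ ≤ C := fun t i => by
    filter_upwards [hC] with ω hω using hω t i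
  have hxx : ∀ i j, ∀ᵐ ω ∂P, ∃ N : ℕ, ∀ n : ℕ, N ≤ n →
      |∑ t ∈ Finset.Ioc (0 : ℤ) n, x t ω i * x t ω j - n * SigX i j| ≤ κ * n ∧
      |∑ t ∈ Finset.Ioc (-n : ℤ) 0, x t ω i * x t ω j - n * SigX i j| ≤ κ * n := by
    intro i j
    refine ae_two_sided_sum_near hx hε hstat (F := fun v => v.1 i * v.1 j) (by fun_prop) ?_ _ ?_ hκ
    · intro t
      refine Integrable.bdd_mul (c := C) ?_ (hxi t i).aestronglyMeasurable (hbd t i)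
      exact Integrable.of_bound (hxi t j).aestronglyMeasurable C (hbd t j)
    · intro δ hδ
      have h1 := (tendstoInMeasure_iff_norm.1 (hdgp.secondMoment_plim i j)) δ hδ
      refine h1.congr fun n => ?_
      congr 1
      ext ω
      simp only [Set.mem_ofPred_eq, Real.norm_eq_abs, one_div]
      rw [← zero_add (1 : ℤ), Finset.Icc_add_one_left_eq_Ioc]
  have hxe : ∀ i, ∀ᵐ ω ∂P, ∃ N : ℕ, ∀ n : ℕ, N ≤ n →
      |∑ t ∈ Finset.Ioc (0 : ℤ) n, x t ω i * ε t ω - n * 0| ≤ κ * n ∧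
      |∑ t ∈ Finset.Ioc (-n : ℤ) 0, x t ω i * ε t ω - n * 0| ≤ κ * n := by
    intro i
    refine ae_two_sided_sum_near hx hε hstat (F := fun v => v.1 i * v.2) (by fun_prop) ?_ _ ?_ hκ
    · intro t
      exact Integrable.bdd_mul (c := C) ((hdgp.eps_memLp t).integrable (by norm_num))
        (hxi t i).aestronglyMeasurable (hbd t i)
    · intro δ hδ
      rw [ENNReal.tendsto_nhds_zero]
      intro η hη
      obtain ⟨η', hη', hη'η⟩ : ∃ η' : ℝ, 0 < η' ∧ ENNReal.ofReal η' ≤ η := by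
        rcases eq_or_ne η ⊤ with rfl | hne
        · exact ⟨1, one_pos, le_top⟩
        · exact ⟨η.toReal, ENNReal.toReal_pos hη.ne' hne, by rw [ENNReal.ofReal_toReal hne]⟩
      -- The assumption excludes `τ₁ = 0`, so the initial block is not covered directly. With sample
      -- size `3 n` the fractions `1/3` and `2/3` cut out exactly `(n, 2n]`, a translate of `(0,
      -- n]`.
      obtain ⟨M, hM⟩ := hdgp.partialSum_xε (1 / 3) (2 / 3) (by norm_num) (by norm_num)
        (by norm_num) i η' hη'
      have h3 : Tendsto (fun n : ℕ => 3 * n) atTop atTop :=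
        tendsto_id.const_mul_atTop' (by norm_num)
      have hlim : Tendsto (fun n : ℕ => M * ((3 * n : ℕ) : ℝ) ^ (-(1 / 2) : ℝ)) atTop (𝓝 0) := by
        have h4 := ((tendsto_rpow_neg_atTop (show (0 : ℝ) < 1 / 2 by norm_num)).comp
          (tendsto_natCast_atTop_atTop.comp h3)).const_mul M
        simpa using h4
      filter_upwards [h3.eventually hM, hlim.eventually_lt_const (show 0 < δ / 3 by positivity),
        eventually_gt_atTop 0] with n hn hn2 hn0
      refine le_trans ?_ (hn.trans hη'η)
      have hn0' : (0 : ℝ) < n := by exact_mod_cast hn0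
      have hb1 : breakDate (3 * n) (1 / 3) = n := by
        have : (1 / 3 : ℝ) * ((3 * n : ℕ) : ℝ) = ((n : ℤ) : ℝ) := by push_cast; ring
        rw [breakDate, this, Int.floor_intCast]
      have hb2 : breakDate (3 * n) (2 / 3) = n + n := by
        have : (2 / 3 : ℝ) * ((3 * n : ℕ) : ℝ) = ((n + n : ℤ) : ℝ) := by push_cast; ring
        rw [breakDate, this, Int.floor_intCast]
      have hset : MeasurableSet {p : ℤ → (Fin d → ℝ) × ℝ | δ ≤
          |(n : ℝ)⁻¹ * ∑ t ∈ Finset.Ioc (0 : ℤ) n, (p t).1 i * (p t).2 - 0|} := by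
        refine measurableSet_le measurable_const ?_
        fun_prop
      rw [show P {ω | δ ≤ |(n : ℝ)⁻¹ * ∑ t ∈ Finset.Ioc (0 : ℤ) n, x t ω i * ε t ω - 0|} = _ from
        (measure_shiftPath_mem hx hε hstat n hset).symm]
      refine measure_mono fun ω hω => ?_
      simp only [Set.mem_ofPred_eq, hb1, hb2, Finset.Icc_add_one_left_eq_Ioc] at hω ⊢
      have h5 := sum_Ioc_comp_add 0 n n fun t => x t ω i * ε t ω
      simp only [shiftPath, samplePath] at hω
      rw [h5, zero_add, sub_zero] at hω
      refine hn2.trans_le ?_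
      have h6 : (1 / ((3 * n : ℕ) : ℝ)) * ∑ t ∈ Finset.Ioc (n : ℤ) (n + n), x t ω i * ε t ω
          = (n : ℝ)⁻¹ * (∑ t ∈ Finset.Ioc (n : ℤ) (n + n), x t ω i * ε t ω) / 3 := by
        push_cast
        field_simp
      rw [h6, abs_div, abs_of_pos (show (0 : ℝ) < 3 by norm_num)]
      gcongr
  have hee : ∀ᵐ ω ∂P, ∃ N : ℕ, ∀ n : ℕ, N ≤ n →
      |∑ t ∈ Finset.Ioc (0 : ℤ) n, ε t ω ^ 2 - n * σsq₀| ≤ κ * n ∧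
      |∑ t ∈ Finset.Ioc (-n : ℤ) 0, ε t ω ^ 2 - n * σsq₀| ≤ κ * n := by
    have hint : ∀ t, Integrable (fun ω => ε t ω ^ 2) P := fun t => (hdgp.eps_memLp t).integrable_sq
    have hmean : ∀ t, ∫ ω, ε t ω ^ 2 ∂P = σsq₀ := by
      intro t
      have h1 := integral_condExp (μ := P) (f := fun ω => ε t ω ^ 2) (hx t).comap_le
      rw [integral_congr_ae (hdgp.eps_condVar t)] at h1
      simpa using h1.symm
    refine ae_two_sided_sum_near hx hε hstat (F := fun v => v.2 ^ 2) (by fun_prop) hint _ ?_ hκ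
    have hsum : ∀ (n : ℕ) ω, ∑ t ∈ Finset.Ioc (0 : ℤ) n, ε t ω ^ 2
        = ∑ i ∈ Finset.range n, ε (i + 1) ω ^ 2 := by
      intro n ω
      induction n with
      | zero => simp
      | succ n ih =>
        rw [Finset.sum_range_succ, ← ih, ← sum_Ioc_add_sum_Ioc (q := (n : ℤ)) (by omega)
          (by push_cast; omega)]
        congr 1
        have : Finset.Ioc (n : ℤ) ((n + 1 : ℕ) : ℤ) = {(n : ℤ) + 1} := by
          ext t
          rw [Finset.mem_Ioc, Finset.mem_singleton]
          push_cast
          omega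
        rw [this, Finset.sum_singleton]
    -- The squared errors are independent and identically distributed, so here convergence of the
    -- averages follows from the strong law.
    have hslln := strong_law_ae_real (μ := P) (fun (i : ℕ) ω => ε (i + 1) ω ^ 2)
      (hint _) (by
        intro i j hij
        have h1 : IndepFun (ε ((i : ℤ) + 1)) (ε ((j : ℤ) + 1)) P :=
          hdgp.eps_indep.indepFun (by intro h; apply hij; omega)
        exact h1.comp (measurable_id.pow_const 2) (measurable_id.pow_const 2))
      (fun i => (hdgp.eps_identDistrib _ _).comp (measurable_id.pow_const 2))
    have hmeas : ∀ n : ℕ, AEStronglyMeasurable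
        (fun ω => (∑ i ∈ Finset.range n, ε (i + 1) ω ^ 2) / (n : ℝ)) P := fun n =>
      ((Finset.measurable_sum _ fun i _ => (hε _).pow_const 2).div_const _).aestronglyMeasurable
    have h1 := tendstoInMeasure_of_tendsto_ae hmeas hslln
    intro δ hδ
    have h2 := (tendstoInMeasure_iff_norm.1 h1) δ hδ
    refine h2.congr fun n => ?_
    congr 1
    ext ω
    simp only [Set.mem_ofPred_eq, Real.norm_eq_abs, hmean]
    rw [hsum, div_eq_inv_mul]
  filter_upwards [ae_all_iff.2 fun i => ae_all_iff.2 fun j => hxx i j, ae_all_iff.2 hxe, hee]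
    with ω hxx hxe ⟨N3, hee⟩
  choose N1 hxx using hxx
  choose N2 hxe using hxe
  obtain ⟨N, hN1, hN2, hN3⟩ : ∃ N, (∀ i j, N1 i j ≤ N) ∧ (∀ i, N2 i ≤ N) ∧ N3 ≤ N := by
    refine ⟨∑ i, ∑ j, N1 i j + ∑ i, N2 i + N3, fun i j => ?_, fun i => ?_, by omega⟩
    · have h1 : N1 i j ≤ ∑ j, N1 i j := Finset.single_le_sum
        (f := fun j => N1 i j) (fun _ _ => Nat.zero_le _)
        (Finset.mem_univ j)
      have h2 : ∑ j, N1 i j ≤ ∑ i, ∑ j, N1 i j := Finset.single_le_sum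
        (f := fun i => ∑ j, N1 i j) (fun _ _ => Nat.zero_le _)
        (Finset.mem_univ i)
      omega
    · have h1 := Finset.single_le_sum (f := N2) (fun _ _ => Nat.zero_le _) (Finset.mem_univ i)
      omega
  have hempty : BlockGood κ SigX σsq₀ (fun t => x t ω) (fun t => ε t ω) ∅ := by
    constructor <;> simp
  have hfwd : ∀ n : ℕ, N ≤ n → BlockGood κ SigX σsq₀ (fun t => x t ω) (fun t => ε t ω)
      (Finset.Ioc 0 (n : ℤ)) := by
    intro n hn
    refine ⟨fun i j => ?_, fun i => ?_, ?_⟩ <;>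
      simp only [Int.card_Ioc, sub_zero, Int.toNat_natCast]
    · exact (hxx i j n ((hN1 i j).trans hn)).1
    · simpa using (hxe i n ((hN2 i).trans hn)).1
    · exact (hee n (hN3.trans hn)).1
  have hbwd : ∀ n : ℕ, N ≤ n → BlockGood κ SigX σsq₀ (fun t => x t ω) (fun t => ε t ω)
      (Finset.Ioc (-n : ℤ) 0) := by
    intro n hn
    refine ⟨fun i j => ?_, fun i => ?_, ?_⟩ <;>
      simp only [Int.card_Ioc, sub_neg_eq_add, zero_add, Int.toNat_natCast]
    · exact (hxx i j n ((hN1 i j).trans hn)).2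
    · simpa using (hxe i n ((hN2 i).trans hn)).2
    · exact (hee n (hN3.trans hn)).2
  refine ⟨N, fun q hq => ?_⟩
  rw [sub_zero, le_abs] at hq
  rcases le_total 0 q with h0 | h0
  · obtain ⟨n, rfl⟩ := Int.eq_ofNat_of_zero_le h0
    refine ⟨hfwd n (by omega), ?_⟩
    rw [Finset.Ioc_eq_empty (by omega)]
    exact hempty
  · obtain ⟨n, hn⟩ := Int.eq_ofNat_of_zero_le (neg_nonneg.2 h0)
    obtain rfl : q = -n := by omega
    refine ⟨?_, hbwd n (by omega)⟩
    rw [Finset.Ioc_eq_empty (by omega)]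
    exact hempty

end Stationary

/-! ### The maximizer of the two-sided random walk -/

/-- Since `argmax` is made by choice, it is determined only when the maximizer is unique, which a
strict gap ensures. -/
theorem argmax_eq_of_gap {f : ℤ → ℝ} {m : ℤ} {ρ : ℝ} (hρ : 0 < ρ)
    (h : ∀ m', m' ≠ m → f m' ≤ f m - ρ) : argmax f = m := by
  have hm : IsArgmax f m := fun k => by
    rcases eq_or_ne k m with rfl | hk
    · exact le_rfl
    · linarith [h k hk]
  have hex : ∃ m, IsArgmax f m := ⟨m, hm⟩
  rw [argmax, dif_pos hex]
  by_contra hne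
  linarith [h _ hne, hex.choose_spec m]

/-- A two-sided sequence with negative drift and at most one maximizer has a maximizer which is
separated from all other values. -/
theorem exists_gap {f : ℤ → ℝ} (h0 : f 0 = 0) {g : ℝ} (hg : 0 < g) {N : ℕ}
    (hdrift : ∀ m : ℤ, (N : ℝ) ≤ |(m : ℝ)| → f m ≤ -(g * |(m : ℝ)|))
    (huniq : ∀ m m' : ℤ, IsArgmax f m → IsArgmax f m' → m = m') :
    ∃ (n : ℕ) (m : ℤ), |m| ≤ n ∧ ∀ m', m' ≠ m → f m' ≤ f m - 1 / ((n : ℝ) + 1) := by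
  -- Outside `[-K, K]` one has `|m| ≥ 1`, so the drift bound gives at most `-g`, strictly below `f 0
  -- = 0`.
  set K : ℤ := N + 1 with hK
  have hout : ∀ m : ℤ, m ∉ Finset.Icc (-K) K → f m ≤ -g := by
    intro m hm
    have h1 : K ≤ |m| := by
      rw [Finset.mem_Icc, not_and_or] at hm
      rw [le_abs]
      omega
    have h2 : ((N : ℝ) + 1) ≤ |(m : ℝ)| := by exact_mod_cast h1
    have h3 := hdrift m (by linarith)
    nlinarith [Nat.cast_nonneg (α := ℝ) N]
  obtain ⟨m, hm, hmax⟩ := Finset.exists_max_image (Finset.Icc (-K) K) f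
    ⟨0, by rw [Finset.mem_Icc]; omega⟩
  have hm0 : 0 ≤ f m := h0 ▸ hmax 0 (by rw [Finset.mem_Icc]; omega)
  have harg : IsArgmax f m := fun k => by
    by_cases hk : k ∈ Finset.Icc (-K) K
    · exact hmax k hk
    · linarith [hout k hk]
  have hlt : ∀ m', m' ≠ m → f m' < f m := fun m' hne => by
    refine lt_of_le_of_ne (harg m') fun heq => hne ?_
    exact huniq m' m (fun k => heq ▸ harg k) harg
  have hlim : Tendsto (fun n : ℕ => 1 / ((n : ℝ) + 1)) atTop (𝓝 0) :=
    tendsto_one_div_add_atTop_nhds_zero_nat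
  have hfin : ∀ᶠ n : ℕ in atTop, ∀ m' ∈ (Finset.Icc (-K) K).erase m,
      1 / ((n : ℝ) + 1) < f m - f m' := by
    rw [Filter.eventually_all_finset]
    intro m' hm'
    exact hlim.eventually_lt_const (by linarith [hlt m' (Finset.ne_of_mem_erase hm')])
  -- One `n` does three things: `1 / (n + 1)` is below the finitely many gaps inside the window, it
  -- is below the gap `g` to the outside, and `n` bounds the maximizer.
  obtain ⟨n, hn1, hn2, hn3⟩ := (hfin.and ((hlim.eventually_lt_const hg).and
    (eventually_ge_atTop m.natAbs))).exists
  refine ⟨n, m, by rw [abs_le]; omega, fun m' hne => ?_⟩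
  by_cases hm' : m' ∈ Finset.Icc (-K) K
  · linarith [hn1 m' (Finset.mem_erase.2 ⟨hne, hm'⟩)]
  · linarith [hout m' hm']

/-! ### The walk on path space: measurability and limit laws of its maximizer -/

section Walk

variable {d : ℕ}

/-- The random walk `W*` as a function of the path of the process. -/
noncomputable def pathWalk (w₀ : Fin d → ℝ) (p : ℤ → (Fin d → ℝ) × ℝ) (m : ℤ) : ℝ :=
  walk (fun t => (p t).1) (fun t => (p t).2) w₀ 0 m

theorem measurable_pathWalk (w₀ : Fin d → ℝ) (m : ℤ) :
    Measurable fun p => pathWalk w₀ p m := by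
  have h : ∀ t : ℤ, Measurable fun p : ℤ → (Fin d → ℝ) × ℝ => (p t).1 ⬝ᵥ w₀ := by
    intro t
    simp only [dotProduct]
    fun_prop
  unfold pathWalk walk
  split_ifs <;> fun_prop

theorem pathWalk_shiftPath {Ω : Type*} {x : ℤ → Ω → Fin d → ℝ} {ε : ℤ → Ω → ℝ} (w₀ : Fin d → ℝ)
    (ω : Ω) (k m : ℤ) : pathWalk w₀ (shiftPath k (samplePath x ε ω)) m
      = walk (fun t => x t ω) (fun t => ε t ω) w₀ k (k + m) := by
  have h1 : ∀ p q : ℤ, ∑ t ∈ Finset.Ioc p q, (x (t + k) ω ⬝ᵥ w₀) ^ 2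
      = ∑ t ∈ Finset.Ioc (p + k) (q + k), (x t ω ⬝ᵥ w₀) ^ 2 := fun p q =>
    sum_Ioc_comp_add p q k fun t => (x t ω ⬝ᵥ w₀) ^ 2
  have h2 : ∀ p q : ℤ, ∑ t ∈ Finset.Ioc p q, (x (t + k) ω ⬝ᵥ w₀) * ε (t + k) ω
      = ∑ t ∈ Finset.Ioc (p + k) (q + k), (x t ω ⬝ᵥ w₀) * ε t ω := fun p q =>
    sum_Ioc_comp_add p q k fun t => (x t ω ⬝ᵥ w₀) * ε t ω
  simp only [pathWalk, walk, shiftPath, samplePath, h1, h2, zero_add, add_comm m k,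
    add_lt_iff_neg_left]

theorem dotProduct_transpose_mulVec {dz : ℕ} (R : Matrix (Fin d) (Fin dz) ℝ) (δ : Fin dz → ℝ)
    (v : Fin d → ℝ) : δ ⬝ᵥ (Rᵀ *ᵥ v) = v ⬝ᵥ (R *ᵥ δ) := by
  rw [dotProduct_mulVec, vecMul_transpose, dotProduct_comm]

theorem Wstar_eq_pathWalk {Ω : Type*} {dz : ℕ} (R : Matrix (Fin d) (Fin dz) ℝ)
    (x : ℤ → Ω → Fin d → ℝ) (ε : ℤ → Ω → ℝ) (δ₀ : Fin dz → ℝ) (ω : Ω) :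
    Wstar R x ε δ₀ ω = pathWalk (R *ᵥ δ₀) (samplePath x ε ω) := by
  ext m
  have h1 : Finset.Icc 1 m = Finset.Ioc 0 m := by
    rw [← zero_add (1 : ℤ), Finset.Icc_add_one_left_eq_Ioc]
  simp only [Wstar, pathWalk, walk, samplePath, dotProduct_transpose_mulVec, h1,
    Finset.Icc_add_one_left_eq_Ioc]

/-- The paths whose walk has a maximizer in `[-n, n]`, separated by `1 / (n + 1)` from all other
values of the walk. -/
def gapPaths (w₀ : Fin d → ℝ) (n : ℕ) : Set (ℤ → (Fin d → ℝ) × ℝ) :=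
  {p | ∃ m : ℤ, |m| ≤ n ∧ ∀ m', m' ≠ m → pathWalk w₀ p m' ≤ pathWalk w₀ p m - 1 / ((n : ℝ) + 1)}

theorem measurableSet_gapPaths (w₀ : Fin d → ℝ) (n : ℕ) : MeasurableSet (gapPaths w₀ n) := by
  have : gapPaths w₀ n = ⋃ m : ℤ, ⋃ _ : |m| ≤ n, ⋂ m' : ℤ, ⋂ _ : m' ≠ m,
      {p | pathWalk w₀ p m' ≤ pathWalk w₀ p m - 1 / ((n : ℝ) + 1)} := by
    ext p
    simp [gapPaths]
  rw [this]
  exact MeasurableSet.iUnion fun m => MeasurableSet.iUnion fun _ => MeasurableSet.iInter fun m' =>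
    MeasurableSet.iInter fun _ => measurableSet_le (measurable_pathWalk w₀ m')
      ((measurable_pathWalk w₀ m).sub_const _)

theorem monotone_gapPaths (w₀ : Fin d → ℝ) : Monotone (gapPaths w₀) := by
  rintro n n' hn p ⟨m, hm, hgap⟩
  refine ⟨m, hm.trans (by exact_mod_cast hn), fun m' hne => (hgap m' hne).trans ?_⟩
  gcongr

theorem argmax_of_mem_gapPaths {w₀ : Fin d → ℝ} {n : ℕ} {p : ℤ → (Fin d → ℝ) × ℝ}
    (h : p ∈ gapPaths w₀ n) : |argmax (pathWalk w₀ p)| ≤ n ∧ ∀ m', m' ≠ argmax (pathWalk w₀ p) →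
      pathWalk w₀ p m' ≤ pathWalk w₀ p (argmax (pathWalk w₀ p)) - 1 / ((n : ℝ) + 1) := by
  obtain ⟨m, hm, hgap⟩ := h
  rw [argmax_eq_of_gap (by positivity) hgap]
  exact ⟨hm, hgap⟩

theorem isArgmax_of_mem_gapPaths {w₀ : Fin d → ℝ} {n : ℕ} {p : ℤ → (Fin d → ℝ) × ℝ}
    (h : p ∈ gapPaths w₀ n) : IsArgmax (pathWalk w₀ p) (argmax (pathWalk w₀ p)) := by
  intro k
  rcases eq_or_ne k (argmax (pathWalk w₀ p)) with hk | hk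
  · rw [hk]
  · have h1 : (0 : ℝ) < 1 / ((n : ℝ) + 1) := by positivity
    linarith [(argmax_of_mem_gapPaths h).2 k hk]

variable {Ω : Type*} [MeasurableSpace Ω] {P : Measure Ω}
  {x : ℤ → Ω → Fin d → ℝ} {ε : ℤ → Ω → ℝ} {dz : ℕ} {σsq₀ : ℝ} {SigX : Matrix (Fin d) (Fin d) ℝ}
  {w₀ : Fin d → ℝ}

/-- For `κ` small enough, good blocks at the origin give the walk negative drift from some distance
on. Together with uniqueness this yields a separated maximizer. -/
theorem ae_exists_mem_gapPaths [IsProbabilityMeasure P] (hx : ∀ t, Measurable (x t))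
    (hε : ∀ t, Measurable (ε t))
    {C : ℝ} (hC : ∀ᵐ ω ∂P, ∀ t i, |x t ω i| ≤ C) {δ₀ : Fin dz → ℝ}
    (hdgp : DGPAssumption P x ε δ₀ σsq₀ SigX)
    (hstat : IsStrictlyStationary P x ε) (hw₀ : w₀ ≠ 0)
    (huniq : ∀ᵐ ω ∂P, ∀ m m' : ℤ, IsArgmax (pathWalk w₀ (samplePath x ε ω)) m →
      IsArgmax (pathWalk w₀ (samplePath x ε ω)) m' → m = m') :
    ∀ᵐ ω ∂P, ∃ n, samplePath x ε ω ∈ gapPaths w₀ n := by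
  obtain ⟨l', hl', hSig'⟩ := exists_dotProduct_mulVec_ge hdgp.secondMoment_posDef
  set l := l' / 2 with hl
  have hl0 : 0 < l := half_pos hl'
  have hSig : ∀ v, 2 * l * (v ⬝ᵥ v) ≤ v ⬝ᵥ (SigX *ᵥ v) := fun v => by
    have : 2 * l = l' := by rw [hl]; ring
    rw [this]
    exact hSig' v
  set b := w₀ ⬝ᵥ w₀ with hb
  have hb0 : 0 < b := lt_of_le_of_ne (dotProduct_self_nonneg' _) fun h => hw₀
    (dotProduct_self_eq_zero.1 h.symm)
  set A := ∑ i, |w₀ i| with hA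
  have hA0 : 0 ≤ A := Finset.sum_nonneg fun i _ => abs_nonneg _
  set κ := min (l / (d + 1)) (l * b / (4 * (A + 1))) with hκdef
  have hκ : 0 < κ := by positivity
  have hκl : κ * d ≤ l := by
    have h1 : κ ≤ l / (d + 1) := min_le_left _ _
    rw [le_div_iff₀ (by positivity)] at h1
    linarith
  have hκA : 2 * κ * A ≤ l * b / 2 := by
    have h1 : κ ≤ l * b / (4 * (A + 1)) := min_le_right _ _
    rw [le_div_iff₀ (by positivity)] at h1
    linarith
  filter_upwards [ae_exists_mem_goodPaths hx hε hC hdgp hstat hκ, huniq] with ω ⟨N, hN⟩ hu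
  obtain ⟨n, m, hn⟩ := exists_gap (f := pathWalk w₀ (samplePath x ε ω)) (g := l * b / 2) (N := N)
    (walk_self 0) (by positivity) (fun m hm => by
      have h1 := AnchorGood.walk_le (w₀ := w₀) (k := m) hN hκl hSig (by simpa using hm)
      simp only [Int.cast_zero, sub_zero] at h1
      refine h1.trans ?_
      have := abs_nonneg (m : ℝ)
      nlinarith) hu
  exact ⟨n, m, hn⟩

/-- On the almost sure set of paths with a gap, the level set of `argmax` at `m` is the measurable
set where `m` is a maximizer. Elsewhere the choice is uncontrolled, so only null measurability is
available. -/
theorem aemeasurable_argmax_pathWalk (hx : ∀ t, Measurable (x t)) (hε : ∀ t, Measurable (ε t))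
    (hgap : ∀ᵐ ω ∂P, ∃ n, samplePath x ε ω ∈ gapPaths w₀ n) :
    AEMeasurable (fun p => argmax (pathWalk w₀ p)) (P.map (samplePath x ε)) := by
  have hm := measurable_samplePath hx hε
  have hmeas : MeasurableSet {p | ∃ n, p ∈ gapPaths w₀ n} := by
    have : {p | ∃ n, p ∈ gapPaths w₀ n} = ⋃ n, gapPaths w₀ n := by ext; simp
    rw [this]
    exact MeasurableSet.iUnion fun n => measurableSet_gapPaths w₀ n
  have hae : ∀ᵐ p ∂(P.map (samplePath x ε)), ∃ n, p ∈ gapPaths w₀ n :=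
    (ae_map_iff hm.aemeasurable hmeas).2 hgap
  refine NullMeasurable.aemeasurable fun s _ => ?_
  have hs : (fun p => argmax (pathWalk w₀ p)) ⁻¹' s
      = ⋃ m ∈ s, {p | argmax (pathWalk w₀ p) = m} := by
    ext p
    simp
  rw [hs]
  refine NullMeasurableSet.biUnion s.to_countable fun m _ => ?_
  have hA : MeasurableSet {p | IsArgmax (pathWalk w₀ p) m} := by
    have : {p | IsArgmax (pathWalk w₀ p) m} = ⋂ k, {p | pathWalk w₀ p k ≤ pathWalk w₀ p m} := by
      ext p
      simp [IsArgmax]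
    rw [this]
    exact MeasurableSet.iInter fun k =>
      measurableSet_le (measurable_pathWalk w₀ k) (measurable_pathWalk w₀ m)
  refine hA.nullMeasurableSet.congr ?_
  filter_upwards [hae] with p ⟨n, hn⟩
  refine propext ⟨fun h => ?_, fun h => ?_⟩
  · by_contra hne
    have hne' : m ≠ argmax (pathWalk w₀ p) := fun h' => hne h'.symm
    have h1 := (argmax_of_mem_gapPaths hn).2 m hne'
    have h2 : pathWalk w₀ p (argmax (pathWalk w₀ p)) ≤ pathWalk w₀ p m := h _
    have h3 : (0 : ℝ) < 1 / ((n : ℝ) + 1) := by positivity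
    linarith
  · have h' : argmax (pathWalk w₀ p) = m := h
    rw [← h']
    exact isArgmax_of_mem_gapPaths hn

/-- An integer-valued sequence which agrees with the maximizer of the walk started at `k T`, with
probability tending to one, converges in distribution to the maximizer of the walk. -/
theorem tendstoInDistribution_argmax [IsProbabilityMeasure P] (hx : ∀ t, Measurable (x t))
    (hε : ∀ t, Measurable (ε t))
    (hstat : IsStrictlyStationary P x ε)
    (hgap : ∀ᵐ ω ∂P, ∃ n, samplePath x ε ω ∈ gapPaths w₀ n) {Z : ℕ → Ω → ℤ}
    (hZ : ∀ T, AEMeasurable (Z T) P) (k : ℕ → ℤ)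
    (hprob : ∀ η : ENNReal, 0 < η → ∀ᶠ T in atTop,
      P {ω | Z T ω ≠ argmax (pathWalk w₀ (shiftPath (k T) (samplePath x ε ω)))} ≤ η) :
    TendstoInDistribution Z atTop (fun ω => argmax (pathWalk w₀ (samplePath x ε ω)))
      (fun _ => P) P := by
  have hm := measurable_samplePath hx hε
  have hA := aemeasurable_argmax_pathWalk (P := P) (w₀ := w₀) hx hε hgap
  have hmk : ∀ h : ℤ, Measurable fun ω => shiftPath h (samplePath x ε ω) := fun h =>
    (measurable_shiftPath h).comp hm
  have hident : ∀ h : ℤ, IdentDistrib (fun ω => shiftPath h (samplePath x ε ω))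
      (samplePath x ε) P P := fun h =>
    ⟨(hmk h).aemeasurable, hm.aemeasurable, hstat h⟩
  have hident' : ∀ h : ℤ, IdentDistrib
      (fun ω => argmax (pathWalk w₀ (shiftPath h (samplePath x ε ω))))
      (fun ω => argmax (pathWalk w₀ (samplePath x ε ω))) P P := fun h =>
    (hident h).comp_of_aemeasurable (u := fun p => argmax (pathWalk w₀ p))
      (by rw [(hident h).map_eq]; exact hA)
  -- The shifted argmaxes all have the same law, so convergence of that sequence is trivial; the
  -- difference from `Z` vanishes in probability.
  refine tendstoInDistribution_of_tendstoInMeasure_sub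
    (X := fun T ω => argmax (pathWalk w₀ (shiftPath (k T) (samplePath x ε ω)))) Z _ ?_ ?_ hZ
  · exact tendstoInDistribution_of_identDistrib 0
      (fun j => (hident' (k 0)).trans (hident' (k j)).symm) (hident' (k 0))
  · intro δ hδ
    rw [ENNReal.tendsto_nhds_zero]
    intro η hη
    filter_upwards [hprob η hη] with T hT
    refine (measure_mono fun ω hω => ?_).trans hT
    intro heq
    have h1 : δ ≤ edist ((Z - fun T ω => argmax (pathWalk w₀ (shiftPath (k T)
      (samplePath x ε ω)))) T ω) ((0 : ℕ → Ω → ℤ) T ω) := hω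
    simp only [Pi.sub_apply, heq, sub_self, Pi.zero_apply, edist_self] at h1
    exact hδ.not_ge h1

/-- Limit law of an estimator of the break date which, in good samples, agrees with the maximizer
of the walk started at the true break date. -/
theorem tendstoInDistribution_of_good_samples [IsProbabilityMeasure P] (hx : ∀ t, Measurable (x t))
    (hε : ∀ t, Measurable (ε t)) {C : ℝ} (hC : ∀ᵐ ω ∂P, ∀ t i, |x t ω i| ≤ C) {δ₀ : Fin dz → ℝ}
    (hdgp : DGPAssumption P x ε δ₀ σsq₀ SigX) (hstat : IsStrictlyStationary P x ε)
    (hgap : ∀ᵐ ω ∂P, ∃ n, samplePath x ε ω ∈ gapPaths w₀ n) {Z : ℕ → Ω → ℤ}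
    (hZ : ∀ T, AEMeasurable (Z T) P) (k : ℕ → ℤ)
    (hdet : ∃ κ₁ > 0, ∀ n N₁ : ℕ, ∃ κ₂ > 0, ∀ N₂ : ℕ, ∀ᶠ T in atTop, ∀ᵐ ω ∂P,
      SampleGood κ₁ N₁ SigX σsq₀ (fun t => x t ω) (fun t => ε t ω) T (k T) →
      SampleGood κ₂ N₂ SigX σsq₀ (fun t => x t ω) (fun t => ε t ω) T (k T) →
      shiftPath (k T) (samplePath x ε ω) ∈ gapPaths w₀ n →
      Z T ω = argmax (pathWalk w₀ (shiftPath (k T) (samplePath x ε ω)))) :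
    TendstoInDistribution Z atTop (fun ω => argmax (pathWalk w₀ (samplePath x ε ω)))
      (fun _ => P) P := by
  refine tendstoInDistribution_argmax hx hε hstat hgap hZ k fun η hη => ?_
  -- Seven exceptional events: a missing gap, and the failure of one of three anchors at each of two
  -- precision levels. The order of choice matters: `n` and `N₁` fix `κ₂`, which in turn fixes `N₂`.
  have hη7 : 0 < η / 7 := ENNReal.div_pos hη.ne' (by norm_num)
  obtain ⟨κ₁, hκ₁, hdet⟩ := hdet
  obtain ⟨n, hn⟩ := exists_measure_shiftPath_notMem_le hx hε hstat (measurableSet_gapPaths w₀)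
    (monotone_gapPaths w₀) hgap hη7
  obtain ⟨N₁, hN₁⟩ := exists_measure_shiftPath_notMem_le hx hε hstat
    (measurableSet_goodPaths κ₁ SigX σsq₀) (monotone_goodPaths κ₁ SigX σsq₀)
    (ae_exists_mem_goodPaths hx hε hC hdgp hstat hκ₁) hη7
  obtain ⟨κ₂, hκ₂, hdet⟩ := hdet n N₁
  obtain ⟨N₂, hN₂⟩ := exists_measure_shiftPath_notMem_le hx hε hstat
    (measurableSet_goodPaths κ₂ SigX σsq₀) (monotone_goodPaths κ₂ SigX σsq₀)
    (ae_exists_mem_goodPaths hx hε hC hdgp hstat hκ₂) hη7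
  filter_upwards [hdet N₂] with T hT
  set B : ℕ → ℝ → ℤ → Set Ω := fun N κ h =>
    {ω | shiftPath h (samplePath x ε ω) ∉ goodPaths κ SigX σsq₀ N} with hB
  set G : Set Ω := {ω | shiftPath (k T) (samplePath x ε ω) ∉ gapPaths w₀ n} with hG
  have hsub : {ω | Z T ω ≠ argmax (pathWalk w₀ (shiftPath (k T) (samplePath x ε ω)))} ≤ᵐ[P]
      (G ∪ (B N₁ κ₁ 0 ∪ B N₁ κ₁ (k T) ∪ B N₁ κ₁ T) ∪ (B N₂ κ₂ 0 ∪ B N₂ κ₂ (k T) ∪ B N₂ κ₂ T) :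
        Set Ω) := by
    filter_upwards [hT] with ω hω hne
    by_contra hcon
    have hcon' : ω ∉ G ∪ (B N₁ κ₁ 0 ∪ B N₁ κ₁ (k T) ∪ B N₁ κ₁ T) ∪
      (B N₂ κ₂ 0 ∪ B N₂ κ₂ (k T) ∪ B N₂ κ₂ T) := hcon
    simp only [Set.mem_union, not_or, hB, hG, Set.mem_ofPred_eq, not_not] at hcon'
    obtain ⟨⟨h0, ⟨h1, h2⟩, h3⟩, ⟨h4, h5⟩, h6⟩ := hcon'
    exact hne (hω
      ⟨anchorGood_iff_shiftPath_mem.2 h1, anchorGood_iff_shiftPath_mem.2 h2,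
        anchorGood_iff_shiftPath_mem.2 h3⟩
      ⟨anchorGood_iff_shiftPath_mem.2 h4, anchorGood_iff_shiftPath_mem.2 h5,
        anchorGood_iff_shiftPath_mem.2 h6⟩ h0)
  refine (measure_mono_ae hsub).trans ?_
  have hu3 : ∀ (N : ℕ) (κ : ℝ), (∀ h : ℤ, P (B N κ h) ≤ η / 7) →
      P (B N κ 0 ∪ B N κ (k T) ∪ B N κ T) ≤ η / 7 + η / 7 + η / 7 := fun N κ h =>
    (measure_union_le _ _).trans (add_le_add ((measure_union_le _ _).trans
      (add_le_add (h 0) (h (k T)))) (h T))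
  refine (measure_union_le _ _).trans ((add_le_add ((measure_union_le _ _).trans
    (add_le_add (hn (k T)) (hu3 N₁ κ₁ hN₁))) (hu3 N₂ κ₂ hN₂)).trans_eq ?_)
  have h7 : η / 7 + (η / 7 + η / 7 + η / 7) + (η / 7 + η / 7 + η / 7) = 7 * (η / 7) := by ring
  rw [h7, ENNReal.mul_div_cancel (by norm_num) (by norm_num)]

end Walk

/-! ### Break dates -/

section BreakDate

theorem breakDate_mem {T : ℕ} {τ : ℝ} (h : τ ∈ Set.Ioo (0 : ℝ) 1) :
    0 ≤ breakDate T τ ∧ breakDate T τ ≤ T := by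
  have hT : (0 : ℝ) ≤ T := Nat.cast_nonneg _
  refine ⟨Int.floor_nonneg.2 (mul_nonneg h.1.le hT), ?_⟩
  have : breakDate T τ ≤ ⌊(T : ℝ)⌋ := Int.floor_le_floor (mul_le_of_le_one_left hT h.2.le)
  simpa using this

theorem breakDate_lower {T : ℕ} {τ : ℝ} : τ * T - 1 ≤ breakDate T τ :=
  (Int.sub_one_lt_floor _).le

theorem breakDate_upper {T : ℕ} {τ : ℝ} : (breakDate T τ : ℝ) ≤ τ * T := Int.floor_le _

/-- The location `(⌊τ₀ T⌋ + m) / T` has exactly the required date and tends to `τ₀`. Thus every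
candidate date in a bounded window is attained within the space of break locations. -/
theorem eventually_exists_breakDate_eq {τ₀ : ℝ} {U : Set ℝ} (hU : U ∈ 𝓝 τ₀) (M : ℕ) :
    ∀ᶠ T : ℕ in atTop, ∀ m : ℤ, |m| ≤ M → ∃ τ ∈ U, breakDate T τ = breakDate T τ₀ + m := by
  obtain ⟨r, hr, hball⟩ := Metric.mem_nhds_iff.1 hU
  filter_upwards [eventually_le_mul_natCast (M + 2 : ℝ) hr, eventually_gt_atTop 0]
    with T hT hT0 m hm
  have hT0' : (0 : ℝ) < T := by exact_mod_cast hT0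
  have hm' : |(m : ℝ)| ≤ M := by exact_mod_cast hm
  refine ⟨((breakDate T τ₀ + m : ℤ) : ℝ) / T, hball ?_, ?_⟩
  · rw [Metric.mem_ball, Real.dist_eq]
    have h1 : ((breakDate T τ₀ + m : ℤ) : ℝ) / T - τ₀
        = ((breakDate T τ₀ : ℝ) - τ₀ * T + m) / T := by
      push_cast
      field_simp
      ring
    rw [h1, abs_div, abs_of_pos hT0', div_lt_iff₀ hT0', abs_lt]
    have h2 := breakDate_lower (T := T) (τ := τ₀)
    have h3 := breakDate_upper (T := T) (τ := τ₀)
    have h4 := abs_le.1 hm'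
    constructor <;> linarith
  · rw [breakDate, div_mul_cancel₀ _ hT0'.ne', Int.floor_intCast]

theorem eventually_mem_of_breakDate_near {τ₀ : ℝ} {U : Set ℝ} (hU : U ∈ 𝓝 τ₀) (M : ℕ) :
    ∀ᶠ T : ℕ in atTop, ∀ τ : ℝ, |breakDate T τ - breakDate T τ₀| ≤ M → τ ∈ U := by
  obtain ⟨r, hr, hball⟩ := Metric.mem_nhds_iff.1 hU
  filter_upwards [eventually_le_mul_natCast (M + 2 : ℝ) hr, eventually_gt_atTop 0]
    with T hT hT0 τ hτ
  have hT0' : (0 : ℝ) < T := by exact_mod_cast hT0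
  have hm' : |(breakDate T τ : ℝ) - breakDate T τ₀| ≤ M := by exact_mod_cast hτ
  refine hball ?_
  rw [Metric.mem_ball, Real.dist_eq]
  have h1 : τ - τ₀ = (τ * T - τ₀ * T) / T := by
    field_simp
  rw [h1, abs_div, abs_of_pos hT0', div_lt_iff₀ hT0', abs_lt]
  have h2 := breakDate_lower (T := T) (τ := τ₀)
  have h3 := breakDate_upper (T := T) (τ := τ₀)
  have h5 := breakDate_lower (T := T) (τ := τ)
  have h6 := breakDate_upper (T := T) (τ := τ)
  have h4 := abs_le.1 hm'
  constructor <;> linarith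

theorem exists_eventually_interiorBreak {d : ℕ} {τ₀ : ℝ} (hτ₀ : τ₀ ∈ Set.Ioo (0 : ℝ) 1) (C : ℝ) :
    ∃ c > 0, ∀ᶠ T : ℕ in atTop, ∀ a : ℤ → Fin d → ℝ, (∀ t, a t ⬝ᵥ a t ≤ C ^ 2) →
      InteriorBreak C c a T (breakDate T τ₀) := by
  have h0 := hτ₀.1
  have h1 : 0 < 1 - τ₀ := sub_pos.2 hτ₀.2
  -- Then `2 c` is half the distance of `τ₀` from the ends, which leaves room for the rounding in
  -- the break date.
  refine ⟨min τ₀ (1 - τ₀) / 4, by positivity, ?_⟩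
  filter_upwards [eventually_le_mul_natCast 1 (half_pos h0)] with T hT a ha
  have hT0 : (0 : ℝ) ≤ T := Nat.cast_nonneg _
  refine ⟨ha, ?_, ?_⟩
  · have h2 : min τ₀ (1 - τ₀) * T ≤ τ₀ * T := by gcongr; exact min_le_left _ _
    have h3 := breakDate_lower (T := T) (τ := τ₀)
    linarith
  · have h2 : min τ₀ (1 - τ₀) * T ≤ (1 - τ₀) * T := by gcongr; exact min_le_right _ _
    have h3 := breakDate_upper (T := T) (τ := τ₀)
    have h4 : 0 ≤ min τ₀ (1 - τ₀) * T := by positivity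
    linarith

end BreakDate

/-! ### The least-squares criterion -/

section LeastSquares

variable {dx dz : ℕ} (R : Matrix (Fin dx) (Fin dz) ℝ)

theorem designRow_dotProduct (T : ℕ) (τ : ℝ) (t : ℤ) (v : Fin dx → ℝ)
    (γ : Fin dx ⊕ Fin dz → ℝ) : designRow R T τ t v ⬝ᵥ γ
      = v ⬝ᵥ (γ ∘ Sum.inl + if breakDate T τ < t then R *ᵥ (γ ∘ Sum.inr) else 0) := by
  have h1 : designRow R T τ t v ⬝ᵥ γ = v ⬝ᵥ (γ ∘ Sum.inl)
      + (if breakDate T τ < t then Rᵀ *ᵥ v else 0) ⬝ᵥ (γ ∘ Sum.inr) := by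
    simp [designRow, dotProduct, Fintype.sum_sum_type]
  rw [h1, dotProduct_add]
  split_ifs
  · rw [dotProduct_comm (Rᵀ *ᵥ v), dotProduct_transpose_mulVec]
  · simp

variable {Ω : Type*} (x : ℤ → Ω → Fin dx → ℝ) (ε : ℤ → Ω → ℝ) (β₀ : Fin dx → ℝ)
  (δ₀ : Fin dz → ℝ) (τ₀ : ℝ)

theorem sum_sq_response_sub (T : ℕ) (ω : Ω) (τ : ℝ) (γ : Fin dx ⊕ Fin dz → ℝ) :
    ∑ t ∈ Finset.Icc (1 : ℤ) T,
      (response R x ε β₀ δ₀ τ₀ T ω t - designRow R T τ t (x t ω) ⬝ᵥ γ) ^ 2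
    = residualSq T (fun t => x t ω) (fun t => ε t ω) (R *ᵥ δ₀) (breakDate T τ₀) (breakDate T τ)
        (γ ∘ Sum.inl - β₀) (R *ᵥ (γ ∘ Sum.inr)) := by
  rw [← zero_add (1 : ℤ), Finset.Icc_add_one_left_eq_Ioc, residualSq]
  refine Finset.sum_congr rfl fun t _ => ?_
  rw [response, designRow_dotProduct, designRow_dotProduct, Sum.elim_comp_inl, Sum.elim_comp_inr]
  congr 1
  simp only [dotProduct_add, dotProduct_sub]
  ring

theorem ssr_eq_profile (T : ℕ) (ω : Ω) (τ : ℝ) :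
    ssr R T (fun t => x t ω) (response R x ε β₀ δ₀ τ₀ T ω) τ
      = profile (fun γ : Fin dx ⊕ Fin dz → ℝ => γ ∘ Sum.inl - β₀) (fun γ => R *ᵥ (γ ∘ Sum.inr))
        (fun _ => 0) T (fun t => x t ω) (fun t => ε t ω) (R *ᵥ δ₀) (breakDate T τ₀)
        (breakDate T τ) := by
  rw [ssr, profile]
  congr 1
  ext γ
  rw [add_zero]
  exact sum_sq_response_sub R x ε β₀ δ₀ τ₀ T ω τ γ

theorem mulVec_injective_of_rank_eq {R : Matrix (Fin dx) (Fin dz) ℝ} (hR : R.rank = dz) :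
    Function.Injective R.mulVec := by
  rw [Matrix.mulVec_injective_iff, linearIndependent_iff_card_eq_finrank_span,
    Set.finrank, ← Matrix.rank_eq_finrank_span_cols, hR, Fintype.card_fin]

variable [MeasurableSpace Ω] {P : Measure Ω} {σsq₀ C l : ℝ}
  {SigX : Matrix (Fin dx) (Fin dx) ℝ} {𝓗 : Set ℝ}
variable {R x ε β₀ δ₀ τ₀}

/-- In good samples the least-squares break date is the maximizer of the walk. -/
theorem leastSquares_eq_argmax (h𝓗 : 𝓗 ⊆ Set.Ioo 0 1) (hτ₀ : τ₀ ∈ interior 𝓗) (hl : 0 < l)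
    (hSig : ∀ v, 2 * l * (v ⬝ᵥ v) ≤ v ⬝ᵥ (SigX *ᵥ v)) (hs : 0 ≤ σsq₀) (hC0 : 0 ≤ C)
    (hC : ∀ᵐ ω ∂P, ∀ t, x t ω ⬝ᵥ x t ω ≤ C ^ 2) (hw₀ : R *ᵥ δ₀ ≠ 0) {τLS : ℕ → Ω → ℝ}
    (hLS : ∀ᶠ T in atTop, ∀ᵐ ω ∂P, IsLeastSquares R 𝓗 T
        (fun t => x t ω) (response R x ε β₀ δ₀ τ₀ T ω) (τLS T ω)) :
    ∃ κ₁ > 0, ∀ n N₁ : ℕ, ∃ κ₂ > 0, ∀ N₂ : ℕ, ∀ᶠ T in atTop, ∀ᵐ ω ∂P,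
      SampleGood κ₁ N₁ SigX σsq₀ (fun t => x t ω) (fun t => ε t ω) T (breakDate T τ₀) →
      SampleGood κ₂ N₂ SigX σsq₀ (fun t => x t ω) (fun t => ε t ω) T (breakDate T τ₀) →
      shiftPath (breakDate T τ₀) (samplePath x ε ω) ∈ gapPaths (R *ᵥ δ₀) n →
      breakDate T (τLS T ω) - breakDate T τ₀
        = argmax (pathWalk (R *ᵥ δ₀) (shiftPath (breakDate T τ₀) (samplePath x ε ω))) := by
  have hmem : 𝓗 ∈ 𝓝 τ₀ := mem_interior_iff_mem_nhds.1 hτ₀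
  obtain ⟨c, hc, hbr⟩ := exists_eventually_interiorBreak (d := dx) (h𝓗 (interior_subset hτ₀)) C
  set u : (Fin dx ⊕ Fin dz → ℝ) → Fin dx → ℝ := fun γ => γ ∘ Sum.inl - β₀ with hu
  set w : (Fin dx ⊕ Fin dz → ℝ) → Fin dx → ℝ := fun γ => R *ᵥ (γ ∘ Sum.inr) with hw
  have hu₀ : u (Sum.elim β₀ δ₀) = 0 := by simp [hu]
  have hw₀' : w (Sum.elim β₀ δ₀) = R *ᵥ δ₀ := by simp [hw]
  obtain ⟨κ₁, hκ₁, hκ₁1, g, hg, hgrow⟩ := exists_profile_growth hl hSig hs hC0 hc hw₀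
    (pen := fun _ => 0) (fun _ => le_rfl) hu₀ hw₀'
  refine ⟨κ₁, hκ₁, fun n N₁ => ?_⟩
  -- A quarter of the gap: the walk approximation is used at two dates and costs `2 ρ`, less than
  -- the gap `4 ρ`.
  have hρ : (0 : ℝ) < 1 / (4 * ((n : ℝ) + 1)) := by positivity
  obtain ⟨κ₂, hκ₂, hnear⟩ := exists_profile_near hl hSig hs hC0 hc
    (pen := fun _ => 0) (fun _ => le_rfl) hu₀ hw₀' (n + N₁) N₁ hρ
  refine ⟨κ₂, hκ₂, fun N₂ => ?_⟩
  filter_upwards [hLS, hbr, hgrow N₁, hnear N₂, eventually_exists_breakDate_eq hmem n]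
    with T hLST hbrT hgrowT hnearT hexT
  filter_upwards [hLST, hC] with ω hω hCω hg₁ hg₂ hgap
  set a : ℤ → Fin dx → ℝ := fun t => x t ω with ha
  set e : ℤ → ℝ := fun t => ε t ω with he
  set k₀ := breakDate T τ₀ with hk₀
  set k := breakDate T (τLS T ω) with hk
  set Q := profile u w (fun _ => 0) T a e (R *ᵥ δ₀) k₀ with hQ
  have hbr' := hbrT a hCω
  obtain ⟨hτ, hmin⟩ := hω
  obtain ⟨hk0, hkT⟩ := breakDate_mem (T := T) (h𝓗 hτ)
  have hle : ∀ τ ∈ 𝓗, Q k ≤ Q (breakDate T τ) := by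
    intro τ hτ'
    have h1 := isMinOn_iff.1 hmin τ hτ'
    rwa [ssr_eq_profile, ssr_eq_profile] at h1
  obtain ⟨hmn, hgap'⟩ := argmax_of_mem_gapPaths hgap
  set m := argmax (pathWalk (R *ᵥ δ₀) (shiftPath k₀ (samplePath x ε ω))) with hm
  -- Beyond distance `N₁` the profile exceeds its value at `k₀`, so a minimizer cannot lie there.
  -- The extra `n` makes room in the window for `k₀ + m`.
  have hkN : |(k : ℝ) - k₀| ≤ (n + N₁ : ℕ) := by
    by_contra hcon
    rw [not_le] at hcon
    push_cast at hcon
    have h1 := hgrowT a e k₀ hbr' hg₁ k hk0 hkT (by linarith [Nat.cast_nonneg (α := ℝ) n])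
    have h2 := hle τ₀ (interior_subset hτ₀)
    have h3 : 0 < g * |(k : ℝ) - k₀| := mul_pos hg (lt_of_le_of_lt (by positivity) hcon)
    simp only [← hQ] at h1
    linarith
  obtain ⟨τ', hτ', hkm⟩ := hexT m hmn
  obtain ⟨hkm0, hkmT⟩ := breakDate_mem (T := T) (h𝓗 hτ')
  rw [hkm] at hkm0 hkmT
  have h1 := abs_le.1 (hnearT a e k₀ hbr' hg₂ (hg₁.mid.mono hκ₁1) k hk0 hkT hkN)
  have h2 := abs_le.1 (hnearT a e k₀ hbr' hg₂ (hg₁.mid.mono hκ₁1) (k₀ + m) hkm0 hkmT (by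
    push_cast
    rw [add_sub_cancel_left]
    have : |(m : ℝ)| ≤ n := by exact_mod_cast hmn
    linarith [Nat.cast_nonneg (α := ℝ) N₁]))
  have h3 := hle τ' hτ'
  rw [hkm] at h3
  by_contra hne
  have h4 := hgap' (k - k₀) hne
  rw [pathWalk_shiftPath, pathWalk_shiftPath, add_sub_cancel] at h4
  have h5 : 1 / ((n : ℝ) + 1) = 4 * (1 / (4 * ((n : ℝ) + 1))) := by field_simp
  simp only [← hQ] at h1 h2
  linarith

end LeastSquares

/-! ### Gaussian integrals -/

section GaussianMass

variable {ι : Type*} [Fintype ι]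

/-- The criterion of a penalized regression is a constant plus a quadratic form centred at the
minimizer. -/
theorem exists_completed_square {H : Matrix ι ι ℝ} (hH : Hᵀ = H) (μ : ι → ℝ) (S : Finset ℤ)
    (r : ℤ → ι → ℝ) (y : ℤ → ℝ) {c : ℝ} (hc : 0 < c)
    (hB : ∀ γ, c * (γ ⬝ᵥ γ) ≤ ∑ t ∈ S, (r t ⬝ᵥ γ) ^ 2 + γ ⬝ᵥ (H *ᵥ γ)) :
    ∃ γ₀, ∀ γ, ∑ t ∈ S, (y t - r t ⬝ᵥ γ) ^ 2 + (γ - μ) ⬝ᵥ (H *ᵥ (γ - μ))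
      = (∑ t ∈ S, (y t - r t ⬝ᵥ γ₀) ^ 2 + (γ₀ - μ) ⬝ᵥ (H *ᵥ (γ₀ - μ)))
        + (∑ t ∈ S, (r t ⬝ᵥ (γ - γ₀)) ^ 2 + (γ - γ₀) ⬝ᵥ (H *ᵥ (γ - γ₀))) := by
  -- The operator of the normal equations. Coercivity makes it injective, hence surjective in finite
  -- dimension, and the solution `γ₀` removes the linear term.
  let F : (ι → ℝ) →ₗ[ℝ] (ι → ℝ) :=
    { toFun := fun γ => ∑ t ∈ S, (r t ⬝ᵥ γ) • r t + H *ᵥ γ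
      map_add' := fun γ γ' => by
        simp only [dotProduct_add, add_smul, Finset.sum_add_distrib, mulVec_add]
        abel
      map_smul' := fun z γ => by
        simp only [dotProduct_smul, smul_eq_mul, mul_smul, ← Finset.smul_sum, mulVec_smul,
          smul_add, RingHom.id_apply] }
  have hF : ∀ γ h, h ⬝ᵥ F γ = ∑ t ∈ S, (r t ⬝ᵥ γ) * (r t ⬝ᵥ h) + h ⬝ᵥ (H *ᵥ γ) := by
    intro γ h
    simp only [F, LinearMap.coe_mk, AddHom.coe_mk, dotProduct_add, dotProduct_sum,
      dotProduct_smul, smul_eq_mul, dotProduct_comm h (r _)]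
  have hinj : Function.Injective F := by
    rw [← LinearMap.ker_eq_bot, LinearMap.ker_eq_bot']
    intro γ hγ
    have h1 := hF γ γ
    rw [hγ, dotProduct_zero] at h1
    have h2 := hB γ
    simp only [pow_two] at h2
    rw [← h1] at h2
    have h3 : γ ⬝ᵥ γ = 0 := le_antisymm (by nlinarith) (dotProduct_self_nonneg' γ)
    exact dotProduct_self_eq_zero.1 h3
  obtain ⟨γ₀, hγ₀⟩ := (LinearMap.injective_iff_surjective.1 hinj) (∑ t ∈ S, y t • r t + H *ᵥ μ)
  refine ⟨γ₀, fun γ => ?_⟩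
  obtain ⟨h, rfl⟩ : ∃ h, γ = γ₀ + h := ⟨γ - γ₀, by abel⟩
  have h1 := hF γ₀ h
  rw [hγ₀] at h1
  simp only [dotProduct_add, dotProduct_sum, dotProduct_smul, smul_eq_mul,
    dotProduct_comm h (r _)] at h1
  have hsymm : ∀ v w : ι → ℝ, v ⬝ᵥ (H *ᵥ w) = w ⬝ᵥ (H *ᵥ v) := by
    intro v w
    rw [dotProduct_mulVec, ← mulVec_transpose, hH, dotProduct_comm]
  have h2 : ∑ t ∈ S, (y t - r t ⬝ᵥ (γ₀ + h)) ^ 2 = ∑ t ∈ S, (y t - r t ⬝ᵥ γ₀) ^ 2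
      - 2 * (∑ t ∈ S, y t * (r t ⬝ᵥ h) - ∑ t ∈ S, (r t ⬝ᵥ γ₀) * (r t ⬝ᵥ h))
      + ∑ t ∈ S, (r t ⬝ᵥ h) ^ 2 := by
    rw [← Finset.sum_sub_distrib, Finset.mul_sum, ← Finset.sum_sub_distrib,
      ← Finset.sum_add_distrib]
    refine Finset.sum_congr rfl fun t _ => ?_
    rw [dotProduct_add]
    ring
  have h3 : (γ₀ + h - μ) ⬝ᵥ (H *ᵥ (γ₀ + h - μ)) = (γ₀ - μ) ⬝ᵥ (H *ᵥ (γ₀ - μ))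
      + 2 * (h ⬝ᵥ (H *ᵥ γ₀) - h ⬝ᵥ (H *ᵥ μ)) + h ⬝ᵥ (H *ᵥ h) := by
    have h4 : γ₀ + h - μ = (γ₀ - μ) + h := by abel
    rw [h4, mulVec_add, dotProduct_add, add_dotProduct, add_dotProduct, hsymm (γ₀ - μ) h,
      mulVec_sub H γ₀ μ, dotProduct_sub h]
    ring
  rw [h2, h3, add_sub_cancel_left]
  linarith

theorem lintegral_comp_smul_of_pos (f : (ι → ℝ) → ENNReal) {r : ℝ} (hr : 0 < r) :
    ∫⁻ u, f (r • u) = ENNReal.ofReal (r ^ (-(Fintype.card ι : ℝ))) * ∫⁻ u, f u := by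
  have h1 := Measure.map_addHaar_smul (volume : Measure (ι → ℝ)) hr.ne'
  have h2 : ∫⁻ u, f (r • u) = ∫⁻ u, f u ∂(Measure.map (fun u => r • u) volume) :=
    (lintegral_map_equiv f (Homeomorph.smulOfNeZero r hr.ne').toMeasurableEquiv).symm
  rw [h2, h1, lintegral_smul_measure, smul_eq_mul, Module.finrank_fintype_fun_eq_card,
    abs_of_pos (by positivity), Real.rpow_neg hr.le, Real.rpow_natCast]

/-- The integral of `exp (-B / 2)`. -/
noncomputable def gaussMass (B : (ι → ℝ) → ℝ) : ENNReal :=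
  ∫⁻ u, ENNReal.ofReal (Real.exp (-(B u) / 2))

/-- Substitute `u ↦ s^(-1/2) u`; the Jacobian produces the power of `s`. -/
theorem lintegral_exp_neg_div {B : (ι → ℝ) → ℝ} (hB : ∀ (r : ℝ) u, B (r • u) = r ^ 2 * B u)
    {s : ℝ} (hs : 0 < s) : ∫⁻ u, ENNReal.ofReal (Real.exp (-(B u) / (2 * s)))
      = ENNReal.ofReal (s ^ ((Fintype.card ι : ℝ) / 2)) * gaussMass B := by
  have hr : 0 < s ^ (-(1 / 2) : ℝ) := Real.rpow_pos_of_pos hs _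
  have h1 := lintegral_comp_smul_of_pos
    (fun u => ENNReal.ofReal (Real.exp (-(B u) / 2))) hr
  have h2 : (s ^ (-(1 / 2) : ℝ)) ^ 2 = s⁻¹ := by
    rw [← Real.rpow_natCast, ← Real.rpow_mul hs.le]
    norm_num
    exact Real.rpow_neg_one s
  have h3 : ∀ u, ENNReal.ofReal (Real.exp (-(B (s ^ (-(1 / 2) : ℝ) • u)) / 2))
      = ENNReal.ofReal (Real.exp (-(B u) / (2 * s))) := by
    intro u
    rw [hB, h2]
    congr 2
    field_simp
  simp only [h3] at h1
  rw [h1, gaussMass, ← Real.rpow_mul hs.le]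
  congr 3
  ring

/-- The mass decreases in the form, and scaling evaluates the mass of `α B₀`. This takes the place
of a comparison of determinants. -/
theorem gaussMass_le {B B₀ : (ι → ℝ) → ℝ} (hB₀ : ∀ (r : ℝ) u, B₀ (r • u) = r ^ 2 * B₀ u)
    {α : ℝ} (hα : 0 < α) (h : ∀ u, α * B₀ u ≤ B u) :
    gaussMass B ≤ ENNReal.ofReal (α ^ (-((Fintype.card ι : ℝ) / 2))) * gaussMass B₀ := by
  rw [Real.rpow_neg hα.le, ← Real.inv_rpow hα.le, ← lintegral_exp_neg_div hB₀ (inv_pos.2 hα)]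
  refine lintegral_mono fun u => ENNReal.ofReal_le_ofReal (Real.exp_le_exp.2 ?_)
  have h1 : -(B₀ u) / (2 * α⁻¹) = -(α * B₀ u) / 2 := by field_simp
  rw [h1]
  linarith [h u]

theorem gaussMass_lt_top {B : (ι → ℝ) → ℝ} {c : ℝ} (hc : 0 < c)
    (h : ∀ u, c * (u ⬝ᵥ u) ≤ B u) : gaussMass B < ⊤ := by
  have hint : Integrable (fun u : ι → ℝ => ∏ i, Real.exp (-(c / 2) * u i ^ 2)) :=
    Integrable.fintype_prod fun _ => integrable_exp_neg_mul_sq (half_pos hc)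
  refine lt_of_le_of_lt (lintegral_mono fun u => ENNReal.ofReal_le_ofReal ?_) hint.lintegral_lt_top
  rw [← Real.exp_sum, Real.exp_le_exp, ← Finset.mul_sum]
  have h2 : ∑ i, u i ^ 2 = u ⬝ᵥ u := by simp [dotProduct, pow_two]
  rw [h2]
  linarith [h u]

theorem gaussMass_pos {B : (ι → ℝ) → ℝ} (hB : Continuous B) : 0 < gaussMass B := by
  rw [gaussMass, lintegral_pos_iff_support (by fun_prop)]
  have : (Function.support fun u => ENNReal.ofReal (Real.exp (-(B u) / 2))) = Set.univ := by
    ext u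
    simp [Real.exp_pos]
  rw [this]
  exact IsOpen.measure_pos _ isOpen_univ ⟨0, trivial⟩

end GaussianMass

/-! ### The inverse gamma integral -/

section InvGammaMass

/-- The integral of `s ^ (-(ν + 1)) * exp (-q / (2 * s))` over the positive reals. -/
noncomputable def invGammaMass (ν q : ℝ) : ENNReal :=
  ∫⁻ s in Set.Ioi (0 : ℝ), ENNReal.ofReal (s ^ (-(ν + 1)) * Real.exp (-q / (2 * s)))

/-- Substitute `s = q r`; the dependence on `q` separates as a power. -/
theorem invGammaMass_eq (ν : ℝ) {q : ℝ} (hq : 0 < q) :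
    invGammaMass ν q = ENNReal.ofReal (q ^ (-ν)) * invGammaMass ν 1 := by
  have himg : (fun r => q * r) '' Set.Ioi (0 : ℝ) = Set.Ioi 0 := by
    rw [Set.image_mul_left_Ioi hq, mul_zero]
  have h1 := lintegral_image_eq_lintegral_abs_deriv_mul (s := Set.Ioi (0 : ℝ)) measurableSet_Ioi
    (f := fun r => q * r) (f' := fun _ => q)
    (fun r _ => by simpa using ((hasDerivAt_id r).const_mul q).hasDerivWithinAt)
    (fun r _ r' _ h => mul_left_cancel₀ hq.ne' h)
    (fun s => ENNReal.ofReal (s ^ (-(ν + 1)) * Real.exp (-q / (2 * s))))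
  rw [himg] at h1
  rw [invGammaMass, h1, invGammaMass, ← lintegral_const_mul' _ _ ENNReal.ofReal_ne_top]
  refine setLIntegral_congr_fun measurableSet_Ioi fun r hr => ?_
  have hr' : 0 < r := hr
  rw [abs_of_pos hq, ← ENNReal.ofReal_mul hq.le, ← ENNReal.ofReal_mul (by positivity)]
  congr 1
  have h2 : -q / (2 * (q * r)) = -1 / (2 * r) := by field_simp
  have h3 : q ^ (-ν) = q * q ^ (-(ν + 1)) := by
    rw [show -ν = 1 + -(ν + 1) by ring, Real.rpow_add hq, Real.rpow_one]
  rw [h2, Real.mul_rpow hq.le hr'.le, h3]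
  ring

/-- Near zero the exponential beats the power, through one term of the exponential series; at
infinity the power alone is integrable because `ν > 0`. -/
theorem invGammaMass_one_lt_top {ν : ℝ} (hν : 0 < ν) : invGammaMass ν 1 < ⊤ := by
  obtain ⟨n, hn⟩ := exists_nat_ge (ν + 1)
  rw [invGammaMass, ← Set.Ioc_union_Ioi_eq_Ioi zero_le_one]
  refine (lintegral_union_le _ _ _).trans_lt (ENNReal.add_lt_top.2 ⟨?_, ?_⟩)
  · have hbd : ∀ s ∈ Set.Ioc (0 : ℝ) 1,
        ENNReal.ofReal (s ^ (-(ν + 1)) * Real.exp (-1 / (2 * s)))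
          ≤ ENNReal.ofReal (n.factorial * 2 ^ n) := by
      intro s hs
      have hs0 : 0 < s := hs.1
      refine ENNReal.ofReal_le_ofReal ?_
      have h1 := Real.pow_div_factorial_le_exp (1 / (2 * s)) (by positivity) n
      have h2 : Real.exp (-1 / (2 * s)) ≤ n.factorial * 2 ^ n * s ^ n := by
        rw [neg_div, Real.exp_neg]
        refine inv_le_of_inv_le₀ (by positivity) (le_trans (le_of_eq ?_) h1)
        rw [div_pow, mul_pow, one_pow]
        field_simp
      calc s ^ (-(ν + 1)) * Real.exp (-1 / (2 * s))
          ≤ s ^ (-(ν + 1)) * (n.factorial * 2 ^ n * s ^ n) := by gcongr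
        _ = n.factorial * 2 ^ n * s ^ (n - (ν + 1)) := by
            rw [sub_eq_add_neg, Real.rpow_add hs0, Real.rpow_natCast]
            ring
        _ ≤ n.factorial * 2 ^ n * 1 := by
            gcongr
            exact Real.rpow_le_one hs0.le hs.2 (by linarith)
        _ = _ := mul_one _
    refine (setLIntegral_mono measurable_const hbd).trans_lt ?_
    simp [ENNReal.mul_lt_top]
  · have hint := integrableOn_Ioi_rpow_of_lt (a := -(ν + 1)) (by linarith) zero_lt_one
    refine lt_of_le_of_lt (setLIntegral_mono' measurableSet_Ioi fun s hs => ?_)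
      hint.lintegral_lt_top
    have hs0 : (0 : ℝ) < s := lt_trans zero_lt_one hs
    refine ENNReal.ofReal_le_ofReal (mul_le_of_le_one_right (by positivity) ?_)
    rw [Real.exp_le_one_iff]
    exact div_nonpos_of_nonpos_of_nonneg (by norm_num) (by positivity)

theorem invGammaMass_one_pos (ν : ℝ) : 0 < invGammaMass ν 1 := by
  rw [invGammaMass, setLIntegral_pos_iff (by fun_prop)]
  have : (Function.support fun s : ℝ =>
      ENNReal.ofReal (s ^ (-(ν + 1)) * Real.exp (-1 / (2 * s)))) ∩ Set.Ioi 0 = Set.Ioi 0 := by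
    refine Set.inter_eq_right.2 fun s hs => ?_
    have hs0 : (0 : ℝ) < s := hs
    have h1 : 0 < s ^ (-(ν + 1)) * Real.exp (-1 / (2 * s)) := by positivity
    simpa using h1
  rw [this]
  simp

/-- Translation to the minimizer and Gaussian scaling give the inner integral. It contributes
`s^(card/2)`, which lowers the exponent of the remaining inverse gamma integral from `p` to `p -
card/2`. -/
theorem lintegral_gaussian_invGamma {ι : Type*} [Fintype ι] {B f : (ι → ℝ) → ℝ}
    (hB : ∀ (r : ℝ) u, B (r • u) = r ^ 2 * B u) {γ₀ : ι → ℝ}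
    (hf : ∀ γ, f γ = f γ₀ + B (γ - γ₀)) {K p q : ℝ} (hK : 0 ≤ K) (hq : 0 < f γ₀ + q) :
    ∫⁻ s in Set.Ioi (0 : ℝ), ∫⁻ γ : ι → ℝ,
        ENNReal.ofReal (K * s ^ (-(p + 1)) * Real.exp (-(f γ + q) / (2 * s)))
      = ENNReal.ofReal K * (gaussMass B * (ENNReal.ofReal
          ((f γ₀ + q) ^ (-(p - (Fintype.card ι : ℝ) / 2)))
            * invGammaMass (p - (Fintype.card ι : ℝ) / 2) 1)) := by
  rw [← invGammaMass_eq _ hq, invGammaMass, ← mul_assoc, ← lintegral_const_mul _ (by fun_prop)]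
  refine setLIntegral_congr_fun measurableSet_Ioi fun s hs => ?_
  have hs0 : (0 : ℝ) < s := hs
  have h1 : ∀ γ, ENNReal.ofReal (K * s ^ (-(p + 1)) * Real.exp (-(f γ + q) / (2 * s)))
      = ENNReal.ofReal (K * s ^ (-(p + 1)) * Real.exp (-(f γ₀ + q) / (2 * s)))
        * ENNReal.ofReal (Real.exp (-(B (γ - γ₀)) / (2 * s))) := by
    intro γ
    rw [← ENNReal.ofReal_mul (by positivity), mul_assoc _ (Real.exp _), ← Real.exp_add, hf γ]
    congr 3
    ring
  rw [lintegral_congr h1, lintegral_const_mul' _ _ ENNReal.ofReal_ne_top,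
    lintegral_sub_right_eq_self (fun γ => ENNReal.ofReal (Real.exp (-(B γ) / (2 * s)))) γ₀,
    lintegral_exp_neg_div hB hs0, ← mul_assoc, ← ENNReal.ofReal_mul (by positivity),
    mul_right_comm (ENNReal.ofReal K), ← ENNReal.ofReal_mul hK]
  congr 2
  have h2 : s ^ (-(p - (Fintype.card ι : ℝ) / 2 + 1))
      = s ^ (-(p + 1)) * s ^ ((Fintype.card ι : ℝ) / 2) := by
    rw [← Real.rpow_add hs0]
    congr 1
    ring
  rw [h2]
  ring

end InvGammaMass

/-! ### The posterior mode -/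

section PosteriorMode

/-- A maximizer of a normalized density maximizes the density itself, if the density is a product
of a probability density and a positive function with finitely many values. -/
theorem le_of_isMaxOn_div_lintegral {𝓗 : Set ℝ} {p : ℝ → ℝ} {L W : ℝ → ENNReal} {τ₀ τ : ℝ}
    (h𝓗 : MeasurableSet 𝓗) (hL : ∀ u ∈ 𝓗, L u = ENNReal.ofReal (p u) * W u)
    (hfin : (W '' 𝓗).Finite) (hW0 : ∀ u ∈ 𝓗, 0 < W u) (hW : ∀ u ∈ 𝓗, W u < ⊤)
    (hp : IntegrableOn p 𝓗) (hτ₀ : τ₀ ∈ interior 𝓗) (hp₀ : 0 < p τ₀) (hpc : ContinuousAt p τ₀)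
    (hmax : IsMaxOn (fun u => L u / ∫⁻ u in 𝓗, L u) 𝓗 τ) {τ' : ℝ} (hτ' : τ' ∈ 𝓗) :
    L τ' ≤ L τ := by
  have hmem : 𝓗 ∈ 𝓝 τ₀ := mem_interior_iff_mem_nhds.1 hτ₀
  have hne : (W '' 𝓗).Nonempty := ⟨_, τ₀, interior_subset hτ₀, rfl⟩
  obtain ⟨_, ⟨u₁, hu₁, rfl⟩, hmax₁⟩ := Set.exists_max_image (W '' 𝓗) id hfin hne
  obtain ⟨_, ⟨u₂, hu₂, rfl⟩, hmin₂⟩ := Set.exists_min_image (W '' 𝓗) id hfin hne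
  -- In `ENNReal`, division by `⊤` gives `0` everywhere and division by `0` gives only `0` or `⊤`.
  -- The normalizer must therefore be finite and nonzero before it can be cancelled.
  have hfinite : ∫⁻ u in 𝓗, L u ≠ ⊤ := by
    refine ne_of_lt (lt_of_le_of_lt (setLIntegral_mono' h𝓗
      (g := fun u => ENNReal.ofReal (p u) * W u₁) fun u hu => ?_) ?_)
    · rw [hL u hu]
      gcongr
      exact hmax₁ _ ⟨u, hu, rfl⟩
    · rw [lintegral_mul_const' _ _ (hW u₁ hu₁).ne]
      exact ENNReal.mul_lt_top hp.lintegral_lt_top (hW u₁ hu₁)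
  have hpos : ∫⁻ u in 𝓗, L u ≠ 0 := by
    have hev : ∀ᶠ u in 𝓝 τ₀, u ∈ 𝓗 ∧ p τ₀ / 2 < p u :=
      (Filter.Eventually.and hmem) (hpc.eventually (eventually_gt_nhds (half_lt_self hp₀)))
    obtain ⟨r, hr, hball⟩ := Metric.eventually_nhds_iff_ball.1 hev
    have h1 : ∫⁻ _ in Metric.ball τ₀ r, ENNReal.ofReal (p τ₀ / 2) * W u₂
        ≤ ∫⁻ u in 𝓗, L u := by
      refine (setLIntegral_mono' measurableSet_ball fun u hu => ?_).trans
        (lintegral_mono_set fun u hu => (hball u hu).1)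
      rw [hL u (hball u hu).1]
      exact mul_le_mul' (ENNReal.ofReal_le_ofReal (hball u hu).2.le)
        (hmin₂ _ ⟨u, (hball u hu).1, rfl⟩)
    rw [setLIntegral_const] at h1
    refine (lt_of_lt_of_le (pos_iff_ne_zero.2 ?_) h1).ne'
    refine mul_ne_zero (mul_ne_zero ?_ (hW0 u₂ hu₂).ne') (Metric.measure_ball_pos _ _ hr).ne'
    simpa using hp₀
  have h2 := isMaxOn_iff.1 hmax τ' hτ'
  simp only [div_eq_mul_inv] at h2
  exact (ENNReal.mul_le_mul_iff_left (ENNReal.inv_ne_zero.2 hfinite)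
    (ENNReal.inv_ne_top.2 hpos)).1 h2

variable {dx dz : ℕ}

/-- The quadratic form of the penalized regression. -/
noncomputable def designForm (R : Matrix (Fin dx) (Fin dz) ℝ)
    (H : Matrix (Fin dx ⊕ Fin dz) (Fin dx ⊕ Fin dz) ℝ) (T : ℕ)
    (X : ℤ → Fin dx → ℝ) (τ : ℝ) (γ : Fin dx ⊕ Fin dz → ℝ) : ℝ :=
  ∑ t ∈ Finset.Icc (1 : ℤ) T, (designRow R T τ t (X t) ⬝ᵥ γ) ^ 2 + γ ⬝ᵥ (H *ᵥ γ)

/-- The criterion of the penalized regression. -/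
noncomputable def penalizedSSR (R : Matrix (Fin dx) (Fin dz) ℝ)
    (H : Matrix (Fin dx ⊕ Fin dz) (Fin dx ⊕ Fin dz) ℝ) (μ : Fin dx ⊕ Fin dz → ℝ) (T : ℕ)
    (X : ℤ → Fin dx → ℝ) (Y : ℤ → ℝ) (τ : ℝ) (γ : Fin dx ⊕ Fin dz → ℝ) : ℝ :=
  ∑ t ∈ Finset.Icc (1 : ℤ) T, (Y t - designRow R T τ t (X t) ⬝ᵥ γ) ^ 2
    + (γ - μ) ⬝ᵥ (H *ᵥ (γ - μ))

/-- The prior of `(γ, σ²)` is Gaussian in `γ` and inverse gamma in `σ²`, up to normalization;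
`H = 0` and `b = 0` are allowed. -/
structure IsGaussianPrior {ι : Type*} [Fintype ι] (prior : (ι → ℝ) → ℝ → ℝ) (H : Matrix ι ι ℝ)
    (μ : ι → ℝ) (K a b : ℝ) : Prop where
  symm : Hᵀ = H
  nonneg : ∀ γ, 0 ≤ γ ⬝ᵥ (H *ᵥ γ)
  pos : 0 < K
  rate_nonneg : 0 ≤ b
  shape_nonneg : 0 ≤ a
  eq : ∀ γ s, 0 < s → prior γ s
    = K * s ^ (-(a + 1)) * Real.exp (-((γ - μ) ⬝ᵥ (H *ᵥ (γ - μ)) + b) / (2 * s))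

/-- The degenerate member of the family, with no shrinkage and no rate, so both priors can be
treated together. -/
theorem isGaussianPrior_improperPrior {ι : Type*} [Fintype ι] :
    IsGaussianPrior (improperPrior (ι := ι)) 0 0 1 0 0 := by
  refine ⟨by simp, by simp, one_pos, le_rfl, le_rfl, fun γ s hs => ?_⟩
  simp [improperPrior, Real.rpow_neg_one]

/-- The Gaussian normalization contributes `s^(-card/2)`, hence the larger shape; the rate doubles
because the exponent is written over `2 * s`. -/
theorem isGaussianPrior_conjugatePrior {ι : Type*} [Fintype ι] [DecidableEq ι] {μ : ι → ℝ}
    {H : Matrix ι ι ℝ} {a b : ℝ} (hH : H.PosDef) (ha : 0 < a) (hb : 0 < b) :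
    ∃ K, IsGaussianPrior (conjugatePrior μ H a b) H μ K (a + Fintype.card ι / 2) (2 * b) := by
  refine ⟨(2 * Real.pi) ^ (-(Fintype.card ι : ℝ) / 2) * √H.det * (b ^ a / Real.Gamma a),
    ?_, ?_, ?_, by positivity, by positivity, fun γ s hs => ?_⟩
  · simpa using hH.isHermitian.eq
  · intro γ
    simpa using hH.posSemidef.dotProduct_mulVec_nonneg γ
  · have := hH.det_pos
    have := Real.Gamma_pos_of_pos ha
    have := Real.rpow_pos_of_pos hb a
    have := Real.sqrt_pos.2 hH.det_pos
    positivity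
  · have h1 : s ^ (-(a + (Fintype.card ι : ℝ) / 2 + 1))
        = s ^ (-(Fintype.card ι : ℝ) / 2) * s ^ (-a - 1) := by
      rw [← Real.rpow_add hs]
      congr 1
      ring
    have h2 : Real.exp (-((γ - μ) ⬝ᵥ (H *ᵥ (γ - μ)) + 2 * b) / (2 * s))
        = Real.exp (-((γ - μ) ⬝ᵥ (H *ᵥ (γ - μ))) / (2 * s)) * Real.exp (-b / s) := by
      rw [← Real.exp_add]
      congr 1
      field_simp
      ring
    rw [conjugatePrior, normalDensity, invGammaDensity, Real.mul_rpow (by positivity) hs.le, h1,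
      h2]
    ring

theorem normalLikelihood_eq (R : Matrix (Fin dx) (Fin dz) ℝ) (T : ℕ)
    (X : ℤ → Fin dx → ℝ) (Y : ℤ → ℝ) (τ : ℝ) (γ : Fin dx ⊕ Fin dz → ℝ) {s : ℝ} (hs : 0 < s) :
    normalLikelihood R T X Y τ γ s = (2 * Real.pi) ^ (-(T : ℝ) / 2) * s ^ (-(T : ℝ) / 2)
      * Real.exp (-(∑ t ∈ Finset.Icc (1 : ℤ) T, (Y t - designRow R T τ t (X t) ⬝ᵥ γ) ^ 2)
        / (2 * s)) := by
  have hcard : (Finset.Icc (1 : ℤ) T).card = T := by simp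
  rw [normalLikelihood, Finset.prod_mul_distrib, Finset.prod_const, hcard, ← Real.exp_sum,
    ← Finset.sum_div, Finset.sum_neg_distrib, ← Real.mul_rpow (by positivity) hs.le]
  congr 1
  rw [Real.sqrt_eq_rpow, one_div, ← Real.rpow_neg (by positivity), ← Real.rpow_natCast,
    ← Real.rpow_mul (by positivity)]
  congr 1
  ring

theorem designForm_smul (R : Matrix (Fin dx) (Fin dz) ℝ)
    (H : Matrix (Fin dx ⊕ Fin dz) (Fin dx ⊕ Fin dz) ℝ) (T : ℕ)
    (X : ℤ → Fin dx → ℝ) (τ r : ℝ) (γ : Fin dx ⊕ Fin dz → ℝ) :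
    designForm R H T X τ (r • γ) = r ^ 2 * designForm R H T X τ γ := by
  simp only [designForm, dotProduct_smul, mulVec_smul, smul_dotProduct, smul_eq_mul, mul_pow,
    ← Finset.mul_sum]
  ring

theorem continuous_designForm (R : Matrix (Fin dx) (Fin dz) ℝ)
    (H : Matrix (Fin dx ⊕ Fin dz) (Fin dx ⊕ Fin dz) ℝ) (T : ℕ)
    (X : ℤ → Fin dx → ℝ) (τ : ℝ) : Continuous (designForm R H T X τ) := by
  unfold designForm
  fun_prop

variable {R : Matrix (Fin dx) (Fin dz) ℝ} {prior : (Fin dx ⊕ Fin dz → ℝ) → ℝ → ℝ}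
  {H : Matrix (Fin dx ⊕ Fin dz) (Fin dx ⊕ Fin dz) ℝ} {μ : Fin dx ⊕ Fin dz → ℝ} {K a b c : ℝ}
  {T : ℕ} {X : ℤ → Fin dx → ℝ} {Y : ℤ → ℝ} {p : ℝ → ℝ} {τ : ℝ}

/-- The likelihood times the prior is a power of `s` times the exponential of the penalized
criterion. Completing the square reduces its integral to a Gaussian and an inverse gamma factor. -/
theorem marginalLikelihood_eq (hprior : IsGaussianPrior prior H μ K a b) (hp : 0 ≤ p τ)
    (hc : 0 < c) (hform : ∀ γ, c * (γ ⬝ᵥ γ) ≤ designForm R H T X τ γ)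
    (hq : 0 < (⨅ γ, penalizedSSR R H μ T X Y τ γ) + b) :
    marginalLikelihood R prior p T X Y τ = ENNReal.ofReal (p τ)
      * (ENNReal.ofReal (K * (2 * Real.pi) ^ (-(T : ℝ) / 2)) * (gaussMass (designForm R H T X τ)
        * (ENNReal.ofReal (((⨅ γ, penalizedSSR R H μ T X Y τ γ) + b)
            ^ (-(T / 2 + a - (Fintype.card (Fin dx ⊕ Fin dz) : ℝ) / 2)))
          * invGammaMass (T / 2 + a - (Fintype.card (Fin dx ⊕ Fin dz) : ℝ) / 2) 1))) := by
  obtain ⟨γ₀, hγ₀⟩ := exists_completed_square hprior.symm μ (Finset.Icc (1 : ℤ) T)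
    (fun t => designRow R T τ t (X t)) Y hc hform
  have hsq : ∀ γ, penalizedSSR R H μ T X Y τ γ
      = penalizedSSR R H μ T X Y τ γ₀ + designForm R H T X τ (γ - γ₀) := hγ₀
  have hinf : ⨅ γ, penalizedSSR R H μ T X Y τ γ = penalizedSSR R H μ T X Y τ γ₀ := by
    have hle : ∀ γ, penalizedSSR R H μ T X Y τ γ₀ ≤ penalizedSSR R H μ T X Y τ γ := by
      intro γ
      rw [hsq γ]
      have h1 := hform (γ - γ₀)
      have h2 := mul_nonneg hc.le (dotProduct_self_nonneg' (γ - γ₀))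
      linarith
    exact le_antisymm (ciInf_le ⟨_, by rintro _ ⟨γ, rfl⟩; exact hle γ⟩ γ₀) (le_ciInf hle)
  rw [hinf] at hq ⊢
  have hpi : (0 : ℝ) < (2 * Real.pi) ^ (-(T : ℝ) / 2) := Real.rpow_pos_of_pos (by positivity) _
  have hK := hprior.pos
  rw [← mul_assoc, ← ENNReal.ofReal_mul hp, ← lintegral_gaussian_invGamma
    (designForm_smul R H T X τ) hsq (by positivity) hq, marginalLikelihood]
  refine setLIntegral_congr_fun measurableSet_Ioi fun s hs => lintegral_congr fun γ => ?_
  have hs0 : (0 : ℝ) < s := hs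
  rw [normalLikelihood_eq R T X Y τ γ hs0, hprior.eq γ s hs0]
  congr 1
  have h1 : s ^ (-((T : ℝ) / 2 + a + 1)) = s ^ (-(T : ℝ) / 2) * s ^ (-(a + 1)) := by
    rw [← Real.rpow_add hs0]
    congr 1
    ring
  have h2 : Real.exp (-(penalizedSSR R H μ T X Y τ γ + b) / (2 * s))
      = Real.exp (-(∑ t ∈ Finset.Icc (1 : ℤ) T, (Y t - designRow R T τ t (X t) ⬝ᵥ γ) ^ 2)
        / (2 * s)) * Real.exp (-((γ - μ) ⬝ᵥ (H *ᵥ (γ - μ)) + b) / (2 * s)) := by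
    rw [← Real.exp_add, penalizedSSR]
    congr 1
    ring
  rw [h1, h2]
  ring

/-- Comparison of the posterior mode with another break location. -/
theorem IsPosteriorMode.le_mul_rpow {𝓗 : Set ℝ} {τ₀ τ' : ℝ} {α : ℝ} (h𝓗 : 𝓗 ⊆ Set.Ioo 0 1)
    (h𝓗m : MeasurableSet 𝓗) (hτ₀ : τ₀ ∈ interior 𝓗) (hprior : IsGaussianPrior prior H μ K a b)
    (hp : ∀ u ∈ 𝓗, 0 ≤ p u) (hpint : IntegrableOn p 𝓗) (hp₀ : 0 < p τ₀)
    (hpc : ContinuousAt p τ₀) (hc : 0 < c)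
    (hform : ∀ u ∈ 𝓗, ∀ γ, c * (γ ⬝ᵥ γ) ≤ designForm R H T X u γ)
    (hq : ∀ u ∈ 𝓗, 0 < (⨅ γ, penalizedSSR R H μ T X Y u γ) + b)
    (hν : 0 < T / 2 + a - (Fintype.card (Fin dx ⊕ Fin dz) : ℝ) / 2)
    (hmode : IsPosteriorMode R prior p 𝓗 T X Y τ) (hτ' : τ' ∈ 𝓗) (hα : 0 < α)
    (hτα : ∀ γ, α * designForm R H T X τ' γ ≤ designForm R H T X τ γ) :
    p τ' * (((⨅ γ, penalizedSSR R H μ T X Y τ γ) + b)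
        / ((⨅ γ, penalizedSSR R H μ T X Y τ' γ) + b))
          ^ (T / 2 + a - (Fintype.card (Fin dx ⊕ Fin dz) : ℝ) / 2)
      ≤ p τ * α ^ (-((Fintype.card (Fin dx ⊕ Fin dz) : ℝ) / 2)) := by
  obtain ⟨hτ, hmax⟩ := hmode
  set ν := T / 2 + a - (Fintype.card (Fin dx ⊕ Fin dz) : ℝ) / 2 with hνdef
  set q : ℝ → ℝ := fun u => (⨅ γ, penalizedSSR R H μ T X Y u γ) + b with hqdef
  set K' := ENNReal.ofReal (K * (2 * Real.pi) ^ (-(T : ℝ) / 2)) with hK'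
  set W : ℝ → ENNReal := fun u => K' * (gaussMass (designForm R H T X u)
        * (ENNReal.ofReal (q u ^ (-ν)) * invGammaMass ν 1)) with hW
  have hpi : (0 : ℝ) < (2 * Real.pi) ^ (-(T : ℝ) / 2) := Real.rpow_pos_of_pos (by positivity) _
  have hK := hprior.pos
  have hK'0 : K' ≠ 0 := by
    rw [hK']
    have : 0 < K * (2 * Real.pi) ^ (-(T : ℝ) / 2) := by positivity
    simpa using this
  have hK't : K' ≠ ⊤ := ENNReal.ofReal_ne_top
  have hΦ0 : invGammaMass ν 1 ≠ 0 := (invGammaMass_one_pos ν).ne'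
  have hΦt : invGammaMass ν 1 ≠ ⊤ := (invGammaMass_one_lt_top hν).ne
  have hG0 : ∀ u, gaussMass (designForm R H T X u) ≠ 0 :=
    fun u => (gaussMass_pos (continuous_designForm R H T X u)).ne'
  have hGt : ∀ u ∈ 𝓗, gaussMass (designForm R H T X u) ≠ ⊤ :=
    fun u hu => (gaussMass_lt_top hc (hform u hu)).ne
  have hL : ∀ u ∈ 𝓗, marginalLikelihood R prior p T X Y u = ENNReal.ofReal (p u) * W u :=
    fun u hu => marginalLikelihood_eq hprior (hp u hu) hc (hform u hu) (hq u hu)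
  -- Apart from the prior density, everything depends on the location only through its break date,
  -- an integer between `0` and `T`.
  have hfin : (W '' 𝓗).Finite := by
    have hfac : ∀ u v, breakDate T u = breakDate T v → W u = W v := by
      intro u v huv
      have h1 : ∀ t w, designRow R T u t w = designRow R T v t w := by
        intro t w
        rw [designRow, designRow, huv]
      have h2 : designForm R H T X u = designForm R H T X v := by
        ext γ
        simp only [designForm, h1]
      have h3 : q u = q v := by
        simp only [hqdef, penalizedSSR, h1]
      simp only [hW, h2, h3]
    have himg : (breakDate T '' 𝓗).Finite := by
      refine (Set.finite_Icc (0 : ℤ) T).subset ?_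
      rintro _ ⟨u, hu, rfl⟩
      exact breakDate_mem (h𝓗 hu)
    have : W '' 𝓗 ⊆ (fun k => W (Function.invFunOn (breakDate T) 𝓗 k)) '' (breakDate T '' 𝓗) := by
      rintro _ ⟨u, hu, rfl⟩
      refine ⟨breakDate T u, ⟨u, hu, rfl⟩, hfac _ _ ?_⟩
      exact Function.invFunOn_eq (f := breakDate T) ⟨u, hu, rfl⟩
    exact (himg.image _).subset this
  have hle := le_of_isMaxOn_div_lintegral h𝓗m hL hfin
    (fun u hu => pos_iff_ne_zero.2 (mul_ne_zero hK'0 (mul_ne_zero (hG0 u) (mul_ne_zero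
      (by simpa using Real.rpow_pos_of_pos (hq u hu) _) hΦ0))))
    (fun u hu => (ENNReal.mul_ne_top hK't (ENNReal.mul_ne_top (hGt u hu)
      (ENNReal.mul_ne_top ENNReal.ofReal_ne_top hΦt))).lt_top)
    hpint hτ₀ hp₀ hpc hmax hτ'
  rw [hL τ hτ, hL τ' hτ'] at hle
  have hq₁ : 0 < q τ := hq τ hτ
  have hq₂ : 0 < q τ' := hq τ' hτ'
  -- Domination of one design form by the other bounds the ratio of their Gaussian masses by a power
  -- of `α`; all other common factors cancel.
  have hG := gaussMass_le (designForm_smul R H T X τ') hα hτα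
  have hle' : (K' * gaussMass (designForm R H T X τ') * invGammaMass ν 1)
        * ENNReal.ofReal (p τ' * q τ' ^ (-ν))
      ≤ (K' * gaussMass (designForm R H T X τ') * invGammaMass ν 1)
        * ENNReal.ofReal
          (p τ * α ^ (-((Fintype.card (Fin dx ⊕ Fin dz) : ℝ) / 2)) * q τ ^ (-ν)) := by
    calc _ = ENNReal.ofReal (p τ') * W τ' := by
          rw [ENNReal.ofReal_mul (hp τ' hτ')]
          simp only [hW]
          ring
      _ ≤ ENNReal.ofReal (p τ) * W τ := hle
      _ ≤ ENNReal.ofReal (p τ) * (K' * ((ENNReal.ofReal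
            (α ^ (-((Fintype.card (Fin dx ⊕ Fin dz) : ℝ) / 2)))
            * gaussMass (designForm R H T X τ')) * (ENNReal.ofReal (q τ ^ (-ν))
              * invGammaMass ν 1))) := by
          simp only [hW]
          gcongr
      _ = _ := by
          rw [ENNReal.ofReal_mul (mul_nonneg (hp τ hτ) (by positivity)),
            ENNReal.ofReal_mul (hp τ hτ)]
          ring
  rw [ENNReal.mul_le_mul_iff_right (mul_ne_zero (mul_ne_zero hK'0 (hG0 τ')) hΦ0)
      (ENNReal.mul_ne_top (ENNReal.mul_ne_top hK't (hGt τ' hτ')) hΦt),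
    ENNReal.ofReal_le_ofReal_iff (mul_nonneg (mul_nonneg (hp τ hτ) (by positivity))
      (by positivity))] at hle'
  rw [Real.rpow_neg hq₂.le, Real.rpow_neg hq₁.le, ← div_eq_mul_inv, ← div_eq_mul_inv,
    div_le_div_iff₀ (Real.rpow_pos_of_pos hq₂ _) (Real.rpow_pos_of_pos hq₁ _)] at hle'
  rw [Real.div_rpow hq₁.le hq₂.le, ← mul_div_assoc, div_le_iff₀ (Real.rpow_pos_of_pos hq₂ _)]
  exact hle'

end PosteriorMode

/-! ### Bounds on the quadratic form of the regression -/

section DesignForm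

theorem exists_mulVec_self_le {m n : Type*} [Fintype m] [Fintype n] (A : Matrix m n ℝ) :
    ∃ r, 0 ≤ r ∧ ∀ v, (A *ᵥ v) ⬝ᵥ (A *ᵥ v) ≤ r * (v ⬝ᵥ v) := by
  refine ⟨∑ i, A i ⬝ᵥ A i, Finset.sum_nonneg fun i _ => dotProduct_self_nonneg' _, fun v => ?_⟩
  rw [Finset.sum_mul]
  refine Finset.sum_le_sum fun i _ => ?_
  rw [← pow_two]
  exact sq_dotProduct_le (A i) v

theorem exists_mulVec_self_ge {m n : Type*} [Fintype m] [Fintype n] [DecidableEq n]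
    {A : Matrix m n ℝ} (hA : Function.Injective A.mulVec) :
    ∃ r > 0, ∀ v, r * (v ⬝ᵥ v) ≤ (A *ᵥ v) ⬝ᵥ (A *ᵥ v) := by
  obtain ⟨r, hr, h⟩ := exists_dotProduct_mulVec_ge (Matrix.PosDef.conjTranspose_mul_self A hA)
  refine ⟨r, hr, fun v => (h v).trans_eq ?_⟩
  rw [conjTranspose_eq_transpose_of_trivial, ← mulVec_mulVec, dotProduct_mulVec, vecMul_transpose]

/-- Expand `0 ≤ |v - A v|²`. -/
theorem exists_dotProduct_mulVec_le {n : Type*} [Fintype n] (A : Matrix n n ℝ) :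
    ∃ r, 0 ≤ r ∧ ∀ v, v ⬝ᵥ (A *ᵥ v) ≤ r * (v ⬝ᵥ v) := by
  obtain ⟨r, hr, h⟩ := exists_mulVec_self_le A
  refine ⟨(1 + r) / 2, by positivity, fun v => ?_⟩
  have h1 := dotProduct_self_nonneg' (v - A *ᵥ v)
  simp only [dotProduct_sub, sub_dotProduct, dotProduct_comm (A *ᵥ v) v] at h1
  linarith [h v]

variable {dx dz : ℕ} {R : Matrix (Fin dx) (Fin dz) ℝ}
  {H : Matrix (Fin dx ⊕ Fin dz) (Fin dx ⊕ Fin dz) ℝ} {a : ℤ → Fin dx → ℝ} {C : ℝ}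

theorem designForm_eq (T : ℕ) (τ : ℝ) (γ : Fin dx ⊕ Fin dz → ℝ) :
    designForm R H T a τ γ = ∑ t ∈ Finset.Ioc (0 : ℤ) T, (a t ⬝ᵥ (γ ∘ Sum.inl
      + if breakDate T τ < t then R *ᵥ (γ ∘ Sum.inr) else 0)) ^ 2 + γ ⬝ᵥ (H *ᵥ γ) := by
  rw [designForm, ← zero_add (1 : ℤ), Finset.Icc_add_one_left_eq_Ioc]
  simp only [designRow_dotProduct]

theorem sum_dotProduct_self (γ : Fin dx ⊕ Fin dz → ℝ) :
    γ ⬝ᵥ γ = (γ ∘ Sum.inl) ⬝ᵥ (γ ∘ Sum.inl) + (γ ∘ Sum.inr) ⬝ᵥ (γ ∘ Sum.inr) := by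
  simp [dotProduct, Fintype.sum_sum_type]

theorem exists_sq_designRow_le (R : Matrix (Fin dx) (Fin dz) ℝ) (C : ℝ) :
    ∃ r, 0 ≤ r ∧ ∀ v : Fin dx → ℝ, v ⬝ᵥ v ≤ C ^ 2 → ∀ (γ : Fin dx ⊕ Fin dz → ℝ) (q : Prop)
      [Decidable q],
      (v ⬝ᵥ (γ ∘ Sum.inl + if q then R *ᵥ (γ ∘ Sum.inr) else 0)) ^ 2 ≤ r * (γ ⬝ᵥ γ) := by
  obtain ⟨ρ, hρ, h⟩ := exists_mulVec_self_le R
  refine ⟨C ^ 2 * (2 + 2 * ρ), by positivity, fun v hv γ q _ => ?_⟩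
  have h1 : (if q then R *ᵥ (γ ∘ Sum.inr) else 0) ⬝ᵥ (if q then R *ᵥ (γ ∘ Sum.inr) else 0)
      ≤ ρ * (γ ∘ Sum.inr ⬝ᵥ γ ∘ Sum.inr) := by
    split_ifs
    · exact h _
    · simpa using mul_nonneg hρ (dotProduct_self_nonneg' _)
  have h2 := dotProduct_self_add_le (γ ∘ Sum.inl) (if q then R *ᵥ (γ ∘ Sum.inr) else 0)
  have h3 := dotProduct_self_nonneg' (γ ∘ Sum.inl)
  have h4 := dotProduct_self_nonneg' (γ ∘ Sum.inr)
  refine (sq_dotProduct_le _ _).trans ?_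
  rw [mul_assoc]
  refine mul_le_mul hv ?_ (dotProduct_self_nonneg' _) (sq_nonneg C)
  rw [sum_dotProduct_self γ]
  have h5 := mul_nonneg hρ h3
  linarith only [h1, h2, h3, h4, h5]

theorem exists_designForm_le (R : Matrix (Fin dx) (Fin dz) ℝ)
    (H : Matrix (Fin dx ⊕ Fin dz) (Fin dx ⊕ Fin dz) ℝ) (C : ℝ) :
    ∃ r > 0, ∀ T : ℕ, 0 < T → ∀ a : ℤ → Fin dx → ℝ, (∀ t, a t ⬝ᵥ a t ≤ C ^ 2) → ∀ τ γ,
      designForm R H T a τ γ ≤ r * T * (γ ⬝ᵥ γ) := by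
  obtain ⟨r, hr, h⟩ := exists_sq_designRow_le R C
  obtain ⟨h₀, hh₀, hH⟩ := exists_dotProduct_mulVec_le H
  refine ⟨r + h₀ + 1, by positivity, fun T hT a ha τ γ => ?_⟩
  have hT1 : (1 : ℝ) ≤ T := by exact_mod_cast hT
  have hγ := dotProduct_self_nonneg' γ
  rw [designForm_eq]
  have h1 : ∑ t ∈ Finset.Ioc (0 : ℤ) T, (a t ⬝ᵥ (γ ∘ Sum.inl
      + if breakDate T τ < t then R *ᵥ (γ ∘ Sum.inr) else 0)) ^ 2 ≤ T * (r * (γ ⬝ᵥ γ)) := by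
    refine (Finset.sum_le_card_nsmul _ _ _ fun t _ => h (a t) (ha t) γ _).trans_eq ?_
    simp
  have h2 : h₀ * (γ ⬝ᵥ γ) * 1 ≤ h₀ * (γ ⬝ᵥ γ) * T := by gcongr
  have h3 : 0 ≤ (T : ℝ) * (γ ⬝ᵥ γ) := by positivity
  linarith [hH γ]

/-- The two designs share all rows except those between the two dates, and each such row contributes
at most a multiple of `|γ|²`. -/
theorem exists_designForm_le_add (R : Matrix (Fin dx) (Fin dz) ℝ)
    (H : Matrix (Fin dx ⊕ Fin dz) (Fin dx ⊕ Fin dz) ℝ) (C : ℝ) :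
    ∃ r, 0 ≤ r ∧ ∀ (T : ℕ) (a : ℤ → Fin dx → ℝ), (∀ t, a t ⬝ᵥ a t ≤ C ^ 2) → ∀ τ τ' γ,
      designForm R H T a τ' γ ≤ designForm R H T a τ γ
        + r * |(breakDate T τ' : ℝ) - breakDate T τ| * (γ ⬝ᵥ γ) := by
  obtain ⟨r, hr, h⟩ := exists_sq_designRow_le R C
  refine ⟨r, hr, fun T a ha τ τ' γ => ?_⟩
  have hγ : 0 ≤ r * (γ ⬝ᵥ γ) := mul_nonneg hr (dotProduct_self_nonneg' γ)
  rw [designForm_eq, designForm_eq]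
  set k := breakDate T τ
  set k' := breakDate T τ'
  have h1 : ∀ t, (a t ⬝ᵥ (γ ∘ Sum.inl + if k' < t then R *ᵥ (γ ∘ Sum.inr) else 0)) ^ 2
      ≤ (a t ⬝ᵥ (γ ∘ Sum.inl + if k < t then R *ᵥ (γ ∘ Sum.inr) else 0)) ^ 2
        + if t ∈ between k k' then r * (γ ⬝ᵥ γ) else 0 := by
    intro t
    by_cases ht : t ∈ between k k'
    · rw [if_pos ht]
      exact le_add_of_nonneg_of_le (sq_nonneg _) (h (a t) (ha t) γ _)
    · rw [if_neg ht, add_zero]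
      have h2 : (k' < t) ↔ (k < t) := by
        rw [between, Finset.mem_Ioc] at ht
        omega
      simp only [h2, le_refl]
  have h2 : ∑ t ∈ Finset.Ioc (0 : ℤ) T, (if t ∈ between k k' then r * (γ ⬝ᵥ γ) else 0)
      ≤ r * |(k' : ℝ) - k| * (γ ⬝ᵥ γ) := by
    rw [← Finset.sum_filter, Finset.sum_const, nsmul_eq_mul]
    have h3 : (((Finset.Ioc (0 : ℤ) T).filter (· ∈ between k k')).card : ℝ)
        ≤ (between k k').card := by
      exact_mod_cast Finset.card_le_card fun t ht => (Finset.mem_filter.1 ht).2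
    rw [card_between] at h3
    calc _ ≤ |(k' : ℝ) - k| * (r * (γ ⬝ᵥ γ)) := by gcongr
      _ = _ := by ring
  have h3 := Finset.sum_le_sum fun t (_ : t ∈ Finset.Ioc (0 : ℤ) T) => h1 t
  rw [Finset.sum_add_distrib] at h3
  linarith only [h2, h3]

/-- Uniform positive definiteness for break dates away from the ends of a good sample. -/
theorem exists_le_designForm (hR : R.rank = dz) {Sig : Matrix (Fin dx) (Fin dx) ℝ} {l c : ℝ}
    (hl : 0 < l) (hSig : ∀ v, 2 * l * (v ⬝ᵥ v) ≤ v ⬝ᵥ (Sig *ᵥ v)) (hc : 0 < c)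
    (hH : ∀ γ, 0 ≤ γ ⬝ᵥ (H *ᵥ γ)) (s : ℝ) :
    ∃ κ > 0, ∃ r > 0, ∀ N : ℕ, ∀ᶠ T : ℕ in atTop, ∀ a e k₀, SampleGood κ N Sig s a e T k₀ →
      ∀ τ, c * T ≤ breakDate T τ → (breakDate T τ : ℝ) ≤ T - c * T →
        ∀ γ, r * T * (γ ⬝ᵥ γ) ≤ designForm R H T a τ γ := by
  obtain ⟨ρ, hρ, hRρ⟩ := exists_mulVec_self_ge (mulVec_injective_of_rank_eq hR)
  have hκl : l / (dx + 1) * dx ≤ l := by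
    rw [div_mul_eq_mul_div, div_le_iff₀ (by positivity)]
    nlinarith
  refine ⟨l / (dx + 1), by positivity, l * c * ρ / (ρ + 2), by positivity, fun N => ?_⟩
  filter_upwards [eventually_le_mul_natCast (N : ℝ) hc] with T hT a e k₀ hg τ hk hk' γ
  set k := breakDate T τ
  have hT0 : 0 ≤ c * T := by positivity
  have hk0 : 0 ≤ k := by
    have : (0 : ℝ) ≤ k := by linarith
    exact_mod_cast this
  have hkT : k ≤ T := by
    have : (k : ℝ) ≤ T := by linarith
    exact_mod_cast this
  have hc1 := card_Ioc_cast hk0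
  have hc2 := card_Ioc_cast hkT
  push_cast at hc1 hc2
  have h1 : l * (c * T) * ((γ ∘ Sum.inl) ⬝ᵥ (γ ∘ Sum.inl))
      ≤ ∑ t ∈ Finset.Ioc 0 k, (a t ⬝ᵥ (γ ∘ Sum.inl)) ^ 2 := by
    have hb := hg.left.blockGood (B := Finset.Ioc 0 k) ⟨k, Or.inl rfl⟩ (by
      have : (N : ℝ) ≤ (Finset.Ioc 0 k).card := by rw [hc1]; linarith
      exact_mod_cast this)
    refine le_trans ?_ (hb.le_sum_sq hκl hSig _)
    have := dotProduct_self_nonneg' (γ ∘ Sum.inl)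
    rw [hc1]
    gcongr
    linarith
  have h2 : l * (c * T) * ((γ ∘ Sum.inl + R *ᵥ (γ ∘ Sum.inr)) ⬝ᵥ
      (γ ∘ Sum.inl + R *ᵥ (γ ∘ Sum.inr)))
      ≤ ∑ t ∈ Finset.Ioc k T, (a t ⬝ᵥ (γ ∘ Sum.inl + R *ᵥ (γ ∘ Sum.inr))) ^ 2 := by
    have hb := hg.right.blockGood (B := Finset.Ioc k T) ⟨k, Or.inr rfl⟩ (by
      have : (N : ℝ) ≤ (Finset.Ioc k (T : ℤ)).card := by rw [hc2]; linarith
      exact_mod_cast this)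
    refine le_trans ?_ (hb.le_sum_sq hκl hSig _)
    have := dotProduct_self_nonneg' (γ ∘ Sum.inl + R *ᵥ (γ ∘ Sum.inr))
    rw [hc2]
    gcongr
    linarith
  rw [designForm_eq, ← sum_Ioc_add_sum_Ioc hk0 hkT]
  have h3 : ∑ t ∈ Finset.Ioc 0 k, (a t ⬝ᵥ (γ ∘ Sum.inl
      + if k < t then R *ᵥ (γ ∘ Sum.inr) else 0)) ^ 2
      = ∑ t ∈ Finset.Ioc 0 k, (a t ⬝ᵥ (γ ∘ Sum.inl)) ^ 2 := by
    refine Finset.sum_congr rfl fun t ht => ?_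
    rw [if_neg (not_lt.2 (Finset.mem_Ioc.1 ht).2), add_zero]
  have h4 : ∑ t ∈ Finset.Ioc k T, (a t ⬝ᵥ (γ ∘ Sum.inl
      + if k < t then R *ᵥ (γ ∘ Sum.inr) else 0)) ^ 2
      = ∑ t ∈ Finset.Ioc k T, (a t ⬝ᵥ (γ ∘ Sum.inl + R *ᵥ (γ ∘ Sum.inr))) ^ 2 := by
    refine Finset.sum_congr rfl fun t ht => ?_
    rw [if_pos (Finset.mem_Ioc.1 ht).1]
  rw [h3, h4]
  have h5 := dotProduct_self_sub_le (γ ∘ Sum.inl + R *ᵥ (γ ∘ Sum.inr)) (γ ∘ Sum.inl)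
  rw [add_sub_cancel_left] at h5
  have h6 := hRρ (γ ∘ Sum.inr)
  set A := (γ ∘ Sum.inl) ⬝ᵥ (γ ∘ Sum.inl) with hA
  set D := (γ ∘ Sum.inr) ⬝ᵥ (γ ∘ Sum.inr)
  set E := (γ ∘ Sum.inl + R *ᵥ (γ ∘ Sum.inr)) ⬝ᵥ (γ ∘ Sum.inl + R *ᵥ (γ ∘ Sum.inr)) with hE
  have hA0 : 0 ≤ A := dotProduct_self_nonneg' _
  have hE0 : 0 ≤ E := dotProduct_self_nonneg' _
  -- The first block controls `β` and the second `β + R δ`. Their difference `R δ` controls `δ` by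
  -- injectivity: `ρ D ≤ 2 E + 2 A`.
  have h7 : ρ / (ρ + 2) * (A + D) ≤ A + E := by
    rw [div_mul_eq_mul_div, div_le_iff₀ (by positivity)]
    nlinarith [mul_nonneg hρ.le hE0]
  have h8 : l * (c * T) * (ρ / (ρ + 2) * (A + D)) ≤ l * (c * T) * (A + E) := by gcongr
  rw [sum_dotProduct_self γ]
  have h9 : l * c * ρ / (ρ + 2) * T * (A + D) = l * (c * T) * (ρ / (ρ + 2) * (A + D)) := by ring
  rw [h9]
  linarith [hH γ]

theorem exists_subset_Icc_of_closure_subset {𝓗 : Set ℝ} (h : closure 𝓗 ⊆ Set.Ioo 0 1) :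
    ∃ c > 0, 𝓗 ⊆ Set.Icc c (1 - c) := by
  rcases 𝓗.eq_empty_or_nonempty with rfl | hne
  · exact ⟨1, one_pos, Set.empty_subset _⟩
  have hcpt : IsCompact (closure 𝓗) :=
    Metric.isCompact_of_isClosed_isBounded isClosed_closure ((Metric.isBounded_Ioo 0 1).subset h)
  obtain ⟨u, hu⟩ := hcpt.exists_isLeast hne.closure
  obtain ⟨v, hv⟩ := hcpt.exists_isGreatest hne.closure
  have hu0 := (h hu.1).1
  have hv1 := (h hv.1).2
  refine ⟨min u (1 - v), lt_min hu0 (by linarith), fun τ hτ => ⟨?_, ?_⟩⟩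
  · exact (min_le_left _ _).trans (hu.2 (subset_closure hτ))
  · have h1 := hv.2 (subset_closure hτ)
    have h2 := min_le_right u (1 - v)
    linarith

/-- Positive definiteness uniformly over the space of break locations. -/
theorem exists_le_designForm_of_mem (hR : R.rank = dz) {Sig : Matrix (Fin dx) (Fin dx) ℝ} {l : ℝ}
    (hl : 0 < l) (hSig : ∀ v, 2 * l * (v ⬝ᵥ v) ≤ v ⬝ᵥ (Sig *ᵥ v))
    (hH : ∀ γ, 0 ≤ γ ⬝ᵥ (H *ᵥ γ)) {𝓗 : Set ℝ} (hdef : H.PosDef ∨ closure 𝓗 ⊆ Set.Ioo 0 1)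
    (s : ℝ) :
    ∃ κ > 0, ∃ r > 0, ∀ N : ℕ, ∀ᶠ T : ℕ in atTop, ∀ a e k₀, SampleGood κ N Sig s a e T k₀ →
      ∀ τ ∈ 𝓗, ∀ γ, r * (γ ⬝ᵥ γ) ≤ designForm R H T a τ γ := by
  rcases hdef with hdef | hdef
  -- A positive definite prior precision suffices by itself, however close the date is to an end.
  -- Otherwise the data must supply positivity, which requires dates away from the ends.
  · obtain ⟨r, hr, h⟩ := exists_dotProduct_mulVec_ge hdef
    refine ⟨1, one_pos, r, hr, fun N => .of_forall fun T a e k₀ _ τ _ γ => ?_⟩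
    exact (h γ).trans (le_add_of_nonneg_left (Finset.sum_nonneg fun _ _ => sq_nonneg _))
  · obtain ⟨c, hc, h𝓗⟩ := exists_subset_Icc_of_closure_subset hdef
    obtain ⟨κ, hκ, r, hr, h⟩ := exists_le_designForm hR hl hSig (half_pos hc) hH s
    refine ⟨κ, hκ, r, hr, fun N => ?_⟩
    filter_upwards [h N, eventually_le_mul_natCast 1 (half_pos hc), eventually_ge_atTop 1]
      with T hT hT1 hT2 a e k₀ hg τ hτ γ
    have hT0 : (0 : ℝ) ≤ T := Nat.cast_nonneg T
    have h1 : c * T ≤ τ * T := by gcongr; exact (h𝓗 hτ).1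
    have h2 : τ * T ≤ (1 - c) * T := by gcongr; exact (h𝓗 hτ).2
    have h3 := breakDate_lower (T := T) (τ := τ)
    have h4 := breakDate_upper (T := T) (τ := τ)
    refine le_trans ?_ (hT a e k₀ hg τ (by linarith) (by linarith) γ)
    have h5 := dotProduct_self_nonneg' γ
    have h6 : (1 : ℝ) ≤ T := by exact_mod_cast hT2
    have h7 : r * 1 * (γ ⬝ᵥ γ) ≤ r * T * (γ ⬝ᵥ γ) := by gcongr
    linarith

end DesignForm

/-! ### Elementary inequalities for powers -/

section Powers

/-- At `z = 0` the inequality reads `1 < 1 + x`; continuity gives a small positive `z`. -/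
theorem exists_one_add_mul_rpow_lt (E : ℝ) {x : ℝ} (hx : 0 < x) :
    ∃ z > 0, (1 + z) * (1 + z)⁻¹ ^ (-E) < (1 - z) * (1 + x) := by
  have hcont : ContinuousAt
      (fun z : ℝ => (1 - z) * (1 + x) - (1 + z) * (1 + z)⁻¹ ^ (-E)) 0 := by
    have h1 : ContinuousAt (fun z : ℝ => (1 + z)⁻¹) 0 :=
      (continuousAt_const.add continuousAt_id).inv₀ (by simp)
    have h2 : ContinuousAt (fun z : ℝ => (1 + z)⁻¹ ^ (-E)) 0 :=
      h1.rpow_const (Or.inl (by simp))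
    fun_prop
  have hev := hcont.eventually (eventually_gt_nhds (b := 0) (by simpa using hx))
  obtain ⟨z, hz, hz0⟩ := ((hev.filter_mono nhdsWithin_le_nhds).and
    (self_mem_nhdsWithin (a := (0 : ℝ)) (s := Set.Ioi 0))).exists
  exact ⟨z, hz0, sub_pos.1 hz⟩

/-- An exponential in `T` against the power `T ^ E`. This disposes of dates far from the true one.
-/
theorem eventually_mul_rpow_lt (E A r : ℝ) {x y : ℝ} (hA : 0 < A) (hr : 0 < r) (hx : 0 < x)
    (hy : 0 < y) (B : ℝ) :
    ∀ᶠ T : ℕ in atTop, B * (r / (A * T)) ^ (-E) < y * (1 + x) ^ ((T : ℝ) / 4) := by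
  have hlog : 0 < Real.log (1 + x) / 4 := by
    have := Real.log_pos (show (1 : ℝ) < 1 + x by linarith)
    positivity
  have ho := (isLittleO_rpow_exp_pos_mul_atTop E hlog).comp_tendsto
    (tendsto_natCast_atTop_atTop (R := ℝ))
  set D := |B| * (A / r) ^ E + 1 with hD
  have hAr : 0 < (A / r) ^ E := Real.rpow_pos_of_pos (by positivity) _
  have hD0 : 0 < D := by positivity
  have hb := ho.bound (show 0 < y / D by positivity)
  filter_upwards [hb, eventually_gt_atTop 0] with T hT hT0
  have hT0' : (0 : ℝ) < T := by exact_mod_cast hT0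
  have hTE : 0 < (T : ℝ) ^ E := Real.rpow_pos_of_pos hT0' _
  simp only [Function.comp_apply, Real.norm_eq_abs, abs_of_pos hTE, Real.abs_exp] at hT
  have h1 : (r / (A * T)) ^ (-E) = (A / r) ^ E * (T : ℝ) ^ E := by
    rw [← Real.mul_rpow (by positivity) hT0'.le, Real.rpow_neg (by positivity),
      ← Real.inv_rpow (by positivity)]
    congr 1
    field_simp
  have h2 : (1 + x) ^ ((T : ℝ) / 4) = Real.exp (Real.log (1 + x) / 4 * T) := by
    rw [Real.rpow_def_of_pos (by linarith)]
    congr 1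
    ring
  rw [h1, h2]
  rw [div_mul_eq_mul_div, le_div_iff₀ hD0] at hT
  refine lt_of_lt_of_le ?_ hT
  calc B * ((A / r) ^ E * (T : ℝ) ^ E) ≤ |B| * ((A / r) ^ E * (T : ℝ) ^ E) := by
        gcongr
        exact le_abs_self B
    _ = (D - 1) * (T : ℝ) ^ E := by rw [hD]; ring
    _ < (T : ℝ) ^ E * D := by linarith

/-- Since `q' ≤ A T`, the ratio is at least `1 + Δ/(A T)`. Bernoulli's inequality with `ν ≥ T/4`
gives the first bound; monotonicity in the exponent gives the second, useful when `Δ` is of order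
`T`. -/
theorem one_add_le_div_rpow {q q' A Δ T ν : ℝ} (hq' : 0 < q') (hA : 0 < A) (hT : 0 < T)
    (hq'A : q' ≤ A * T) (hΔ : 0 ≤ Δ) (hq : q' + Δ ≤ q) (hν : T / 4 ≤ ν) (hν1 : 1 ≤ ν) :
    1 + Δ / (4 * A) ≤ (q / q') ^ ν ∧ (1 + Δ / (A * T)) ^ (T / 4) ≤ (q / q') ^ ν := by
  have hx : 0 ≤ Δ / (A * T) := by positivity
  have h1 : 1 + Δ / (A * T) ≤ q / q' := by
    rw [le_div_iff₀ hq']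
    have : Δ / (A * T) * q' ≤ Δ := by
      rw [div_mul_eq_mul_div, div_le_iff₀ (by positivity)]
      gcongr
    linarith
  have h2 : (1 + Δ / (A * T)) ^ ν ≤ (q / q') ^ ν :=
    Real.rpow_le_rpow (by positivity) h1 (by linarith)
  refine ⟨?_, ?_⟩
  · refine le_trans ?_ ((one_add_mul_self_le_rpow_one_add (by linarith) hν1).trans h2)
    have h3 : T / 4 * (Δ / (A * T)) ≤ ν * (Δ / (A * T)) := by gcongr
    have h4 : T / 4 * (Δ / (A * T)) = Δ / (4 * A) := by field_simp
    linarith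
  · exact (Real.rpow_le_rpow_of_exponent_le (by linarith) hν).trans h2

end Powers

/-! ### Limit theory for the posterior mode -/

section Bayes

/-- The prior density of the break location: a finite density on `𝓗`, positive and continuous at
the interior point `τ₀`. -/
structure IsBreakPrior (𝓗 : Set ℝ) (τ₀ : ℝ) (p : ℝ → ℝ) : Prop where
  subset : 𝓗 ⊆ Set.Ioo 0 1
  measurableSet : MeasurableSet 𝓗
  mem_interior : τ₀ ∈ interior 𝓗
  nonneg : ∀ τ ∈ 𝓗, 0 ≤ p τ
  integrableOn : IntegrableOn p 𝓗
  pos : 0 < p τ₀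
  continuousAt : ContinuousAt p τ₀

variable {dx dz : ℕ}

/-- The penalized sum of squares, minimized over the slopes, as a function of the break date. -/
noncomputable def breakProfile (R : Matrix (Fin dx) (Fin dz) ℝ)
    (H : Matrix (Fin dx ⊕ Fin dz) (Fin dx ⊕ Fin dz) ℝ) (μ : Fin dx ⊕ Fin dz → ℝ)
    (β₀ : Fin dx → ℝ) (δ₀ : Fin dz → ℝ) (T : ℕ) (a : ℤ → Fin dx → ℝ) (e : ℤ → ℝ) (k₀ k : ℤ) : ℝ :=
  profile (fun γ : Fin dx ⊕ Fin dz → ℝ => γ ∘ Sum.inl - β₀) (fun γ => R *ᵥ (γ ∘ Sum.inr))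
    (fun γ => (γ - μ) ⬝ᵥ (H *ᵥ (γ - μ))) T a e (R *ᵥ δ₀) k₀ k

variable {Ω : Type*} {R : Matrix (Fin dx) (Fin dz) ℝ}
  {x : ℤ → Ω → Fin dx → ℝ} {ε : ℤ → Ω → ℝ} {β₀ : Fin dx → ℝ} {δ₀ : Fin dz → ℝ} {τ₀ : ℝ}
  {H : Matrix (Fin dx ⊕ Fin dz) (Fin dx ⊕ Fin dz) ℝ} {μ : Fin dx ⊕ Fin dz → ℝ}

theorem iInf_penalizedSSR_eq (T : ℕ) (ω : Ω) (τ : ℝ) :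
    ⨅ γ, penalizedSSR R H μ T (fun t => x t ω) (response R x ε β₀ δ₀ τ₀ T ω) τ γ
      = breakProfile R H μ β₀ δ₀ T (fun t => x t ω) (fun t => ε t ω) (breakDate T τ₀)
        (breakDate T τ) := by
  rw [breakProfile, profile]
  congr 1
  ext γ
  rw [penalizedSSR, sum_sq_response_sub R x ε β₀ δ₀ τ₀ T ω τ γ]

variable [MeasurableSpace Ω] {P : Measure Ω} {σsq₀ C l K a b : ℝ}
  {SigX : Matrix (Fin dx) (Fin dx) ℝ} {𝓗 : Set ℝ} {p : ℝ → ℝ} {τB : ℕ → Ω → ℝ}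
  {prior : (Fin dx ⊕ Fin dz → ℝ) → ℝ → ℝ}

/-- In good samples the regression is well behaved, and the posterior mode can be compared with
any other break location. -/
theorem exists_posteriorMode_comparison (hπ : IsBreakPrior 𝓗 τ₀ p)
    (hprior : IsGaussianPrior prior H μ K a b) (hdef : H.PosDef ∨ closure 𝓗 ⊆ Set.Ioo 0 1)
    (hR : R.rank = dz) (hl : 0 < l) (hSig : ∀ v, 2 * l * (v ⬝ᵥ v) ≤ v ⬝ᵥ (SigX *ᵥ v))
    (hs : 0 < σsq₀) (hC : ∀ᵐ ω ∂P, ∀ t, x t ω ⬝ᵥ x t ω ≤ C ^ 2)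
    (hmode : ∀ᶠ T in atTop, ∀ᵐ ω ∂P, IsPosteriorMode R prior p 𝓗 T
        (fun t => x t ω) (response R x ε β₀ δ₀ τ₀ T ω) (τB T ω)) :
    ∃ κ > 0, ∃ r > 0, ∀ N : ℕ, ∀ᶠ T in atTop, ∀ᵐ ω ∂P,
      SampleGood κ N SigX σsq₀ (fun t => x t ω) (fun t => ε t ω) T (breakDate T τ₀) →
      τB T ω ∈ 𝓗 ∧
      breakProfile R H μ β₀ δ₀ T (fun t => x t ω) (fun t => ε t ω) (breakDate T τ₀)
        (breakDate T τ₀) ≤ (σsq₀ + 2) * T ∧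
      (∀ τ ∈ 𝓗, 0 < breakProfile R H μ β₀ δ₀ T (fun t => x t ω) (fun t => ε t ω) (breakDate T τ₀)
        (breakDate T τ) + b) ∧
      (∀ τ ∈ 𝓗, ∀ γ, r * (γ ⬝ᵥ γ) ≤ designForm R H T (fun t => x t ω) τ γ) ∧
      ∀ τ ∈ 𝓗, ∀ α > 0, (∀ γ, α * designForm R H T (fun t => x t ω) τ γ
          ≤ designForm R H T (fun t => x t ω) (τB T ω) γ) →
        p τ * ((breakProfile R H μ β₀ δ₀ T (fun t => x t ω) (fun t => ε t ω) (breakDate T τ₀)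
            (breakDate T (τB T ω)) + b)
          / (breakProfile R H μ β₀ δ₀ T (fun t => x t ω) (fun t => ε t ω) (breakDate T τ₀)
            (breakDate T τ) + b)) ^ (T / 2 + a - (Fintype.card (Fin dx ⊕ Fin dz) : ℝ) / 2)
        ≤ p (τB T ω) * α ^ (-((Fintype.card (Fin dx ⊕ Fin dz) : ℝ) / 2)) := by
  obtain ⟨c, hc, hbr⟩ := exists_eventually_interiorBreak (d := dx)
    (hπ.subset (interior_subset hπ.mem_interior)) C
  obtain ⟨κ₁, hκ₁, hbd⟩ := exists_profile_bounds (C := C) hl hSig hs hc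
    (u := fun γ : Fin dx ⊕ Fin dz → ℝ => γ ∘ Sum.inl - β₀) (w := fun γ => R *ᵥ (γ ∘ Sum.inr))
    (pen := fun γ => (γ - μ) ⬝ᵥ (H *ᵥ (γ - μ))) (γ₀ := Sum.elim β₀ δ₀) (w₀ := R *ᵥ δ₀)
    (fun γ => hprior.nonneg _) (by simp) (by simp)
  obtain ⟨κ₂, hκ₂, r, hr, hform⟩ := exists_le_designForm_of_mem hR hl hSig hprior.nonneg hdef σsq₀
  refine ⟨min κ₁ κ₂, lt_min hκ₁ hκ₂, r, hr, fun N => ?_⟩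
  filter_upwards [hmode, hbr, hbd N, hform N,
    eventually_natCast_ge (Fintype.card (Fin dx ⊕ Fin dz) + 1 : ℝ)] with T hT hbrT hbdT hformT hTd
  filter_upwards [hT, hC] with ω hω hCω hg
  obtain ⟨h1, h2⟩ := hbdT _ _ _ (hbrT _ hCω) (hg.mono (min_le_left _ _))
  have h3 := hformT _ _ _ (hg.mono (min_le_right _ _))
  have h4 : ∀ τ ∈ 𝓗, 0 < breakProfile R H μ β₀ δ₀ T (fun t => x t ω) (fun t => ε t ω)
      (breakDate T τ₀) (breakDate T τ) + b := fun τ hτ => by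
    obtain ⟨h5, h6⟩ := breakDate_mem (T := T) (hπ.subset hτ)
    exact add_pos_of_pos_of_nonneg (h2 _ h5 h6) hprior.rate_nonneg
  refine ⟨hω.1, h1, h4, h3, fun τ hτ α hα hτα => ?_⟩
  have h5 := IsPosteriorMode.le_mul_rpow hπ.subset hπ.measurableSet hπ.mem_interior hprior
    hπ.nonneg hπ.integrableOn hπ.pos hπ.continuousAt hr h3
    (fun τ hτ => by rw [iInf_penalizedSSR_eq]; exact h4 τ hτ)
    (by linarith [hprior.shape_nonneg]) hω hτ hα hτα
  rwa [iInf_penalizedSSR_eq, iInf_penalizedSSR_eq] at h5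

/-- Each of three anchors fails with probability at most `1/4`, so for every `T` some outcomes are
good. -/
theorem exists_frequently_sampleGood [IsProbabilityMeasure P] (hx : ∀ t, Measurable (x t))
    (hε : ∀ t, Measurable (ε t)) {C : ℝ} (hC : ∀ᵐ ω ∂P, ∀ t i, |x t ω i| ≤ C)
    (hdgp : DGPAssumption P x ε δ₀ σsq₀ SigX) (hstat : IsStrictlyStationary P x ε) {κ : ℝ}
    (hκ : 0 < κ) :
    ∃ N : ℕ, ∀ (T : ℕ) (k : ℤ), ∃ᵐ ω ∂P,
      SampleGood κ N SigX σsq₀ (fun t => x t ω) (fun t => ε t ω) T k := by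
  obtain ⟨N, hN⟩ := exists_measure_shiftPath_notMem_le hx hε hstat
    (measurableSet_goodPaths κ SigX σsq₀) (monotone_goodPaths κ SigX σsq₀)
    (ae_exists_mem_goodPaths hx hε hC hdgp hstat hκ) (η := 1 / 4) (by norm_num)
  refine ⟨N, fun T k => ?_⟩
  intro hcon
  set B : ℤ → Set Ω := fun h => {ω | shiftPath h (samplePath x ε ω) ∉ goodPaths κ SigX σsq₀ N}
    with hB
  have hsub : (Set.univ : Set Ω) ≤ᵐ[P] (B 0 ∪ B k ∪ B T : Set Ω) := by
    filter_upwards [hcon] with ω hω _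
    by_contra hout
    have hout' : ω ∉ B 0 ∪ B k ∪ B T := hout
    simp only [Set.mem_union, not_or, hB, Set.mem_ofPred_eq, not_not] at hout'
    obtain ⟨⟨h0, h1⟩, h2⟩ := hout'
    exact hω ⟨anchorGood_iff_shiftPath_mem.2 h0, anchorGood_iff_shiftPath_mem.2 h1,
      anchorGood_iff_shiftPath_mem.2 h2⟩
  have h1 : P Set.univ ≤ 1 / 4 + 1 / 4 + 1 / 4 := (measure_mono_ae hsub).trans
    ((measure_union_le _ _).trans (add_le_add ((measure_union_le _ _).trans
      (add_le_add (hN 0) (hN k))) (hN T)))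
  rw [measure_univ] at h1
  have h2 : (1 / 4 + 1 / 4 + 1 / 4 : ENNReal) < 1 := by
    rw [← ENNReal.toReal_lt_toReal (by simp [ENNReal.add_eq_top]) (by simp)]
    rw [ENNReal.toReal_add (by simp) (by simp), ENNReal.toReal_add (by simp) (by simp)]
    norm_num
  exact absurd h1 (not_le.2 h2)

/-- Since a posterior mode exists, the prior density of the break location is bounded. -/
theorem exists_prior_le [IsProbabilityMeasure P] (hx : ∀ t, Measurable (x t))
    (hε : ∀ t, Measurable (ε t)) {C' : ℝ} (hC' : ∀ᵐ ω ∂P, ∀ t i, |x t ω i| ≤ C')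
    (hdgp : DGPAssumption P x ε δ₀ σsq₀ SigX) (hstat : IsStrictlyStationary P x ε)
    (hπ : IsBreakPrior 𝓗 τ₀ p)
    (hprior : IsGaussianPrior prior H μ K a b) (hdef : H.PosDef ∨ closure 𝓗 ⊆ Set.Ioo 0 1)
    (hR : R.rank = dz) (hl : 0 < l) (hSig : ∀ v, 2 * l * (v ⬝ᵥ v) ≤ v ⬝ᵥ (SigX *ᵥ v))
    (hs : 0 < σsq₀) (hC : ∀ᵐ ω ∂P, ∀ t, x t ω ⬝ᵥ x t ω ≤ C ^ 2)
    (hmode : ∀ᶠ T in atTop, ∀ᵐ ω ∂P, IsPosteriorMode R prior p 𝓗 T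
        (fun t => x t ω) (response R x ε β₀ δ₀ τ₀ T ω) (τB T ω)) :
    ∃ B, ∀ τ ∈ 𝓗, p τ ≤ B := by
  obtain ⟨κ, hκ, r, hr, hcmp⟩ := exists_posteriorMode_comparison hπ hprior hdef hR hl hSig hs hC
    hmode
  obtain ⟨N, hN⟩ := exists_frequently_sampleGood hx hε hC' hdgp hstat hκ
  obtain ⟨A, hA, hformle⟩ := exists_designForm_le R H C
  obtain ⟨T, hT, hT0, hTd⟩ := ((hcmp N).and ((eventually_gt_atTop 0).and
    (eventually_natCast_ge (Fintype.card (Fin dx ⊕ Fin dz) + 1 : ℝ)))).exists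
  -- The prior density is not random, so one sample size and one good outcome are enough to bound
  -- it.
  obtain ⟨ω, hg, hω, hCω⟩ := ((hN T (breakDate T τ₀)).and_eventually (hT.and hC)).exists
  obtain ⟨hτB, -, hq, hform, hle⟩ := hω hg
  have hT0' : (0 : ℝ) < T := by exact_mod_cast hT0
  set q : ℤ → ℝ := fun k => breakProfile R H μ β₀ δ₀ T (fun t => x t ω) (fun t => ε t ω)
    (breakDate T τ₀) k + b with hqdef
  obtain ⟨D, hD⟩ := ((Set.finite_Icc (0 : ℤ) T).image q).bddAbove
  set ν := T / 2 + a - (Fintype.card (Fin dx ⊕ Fin dz) : ℝ) / 2 with hν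
  have hν0 : 0 < ν := by linarith [hprior.shape_nonneg]
  set α := r / (A * T) with hα
  have hα0 : 0 < α := by positivity
  -- The mode inequality solved for `p τ`. The profile takes finitely many values over the break
  -- dates, all bounded by `D`.
  refine ⟨p (τB T ω) * α ^ (-((Fintype.card (Fin dx ⊕ Fin dz) : ℝ) / 2))
    * (D / q (breakDate T (τB T ω))) ^ ν, fun τ hτ => ?_⟩
  have h1 := hle τ hτ α hα0 fun γ => by
    refine le_trans ?_ (hform _ hτB γ)
    have h2 := hformle T hT0 _ hCω τ γ
    calc α * designForm R H T (fun t => x t ω) τ γ ≤ α * (A * T * (γ ⬝ᵥ γ)) := by gcongr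
      _ = r * (γ ⬝ᵥ γ) := by rw [hα]; field_simp
  have hqB : 0 < q (breakDate T (τB T ω)) := hq _ hτB
  have hqτ : 0 < q (breakDate T τ) := hq _ hτ
  have hqD : q (breakDate T τ) ≤ D := hD ⟨_, breakDate_mem (hπ.subset hτ), rfl⟩
  have h3 : (q (breakDate T τ) / q (breakDate T (τB T ω))) ^ ν
      ≤ (D / q (breakDate T (τB T ω))) ^ ν := by gcongr
  have hpos : 0 < (q (breakDate T (τB T ω)) / q (breakDate T τ)) ^ ν := by positivity
  have h4 : (q (breakDate T (τB T ω)) / q (breakDate T τ)) ^ ν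
      * (q (breakDate T τ) / q (breakDate T (τB T ω))) ^ ν = 1 := by
    rw [← Real.mul_rpow (by positivity) (by positivity), div_mul_div_cancel₀ hqτ.ne',
      div_self hqB.ne', Real.one_rpow]
  calc p τ = p τ * (q (breakDate T (τB T ω)) / q (breakDate T τ)) ^ ν
        * (q (breakDate T τ) / q (breakDate T (τB T ω))) ^ ν := by rw [mul_assoc, h4, mul_one]
    _ ≤ p (τB T ω) * α ^ (-((Fintype.card (Fin dx ⊕ Fin dz) : ℝ) / 2))
        * (q (breakDate T τ) / q (breakDate T (τB T ω))) ^ ν := by gcongr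
    _ ≤ _ := by
        have := hπ.nonneg _ hτB
        gcongr

end Bayes

/-! ### Three-stage localization of the posterior mode -/

section PosteriorModeLimit

variable {dx dz : ℕ} {Ω : Type*} [MeasurableSpace Ω] {P : Measure Ω} [IsProbabilityMeasure P]
  {R : Matrix (Fin dx) (Fin dz) ℝ} {x : ℤ → Ω → Fin dx → ℝ} {ε : ℤ → Ω → ℝ} {β₀ : Fin dx → ℝ}
  {δ₀ : Fin dz → ℝ} {τ₀ : ℝ} {H : Matrix (Fin dx ⊕ Fin dz) (Fin dx ⊕ Fin dz) ℝ}
  {μ : Fin dx ⊕ Fin dz → ℝ} {σsq₀ C l K a b : ℝ} {SigX : Matrix (Fin dx) (Fin dx) ℝ} {𝓗 : Set ℝ}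
  {p : ℝ → ℝ} {τB : ℕ → Ω → ℝ} {prior : (Fin dx ⊕ Fin dz → ℝ) → ℝ → ℝ}

/-- In good samples the break date of the posterior mode is the maximizer of the walk. -/
theorem posteriorMode_eq_argmax (hx : ∀ t, Measurable (x t))
    (hε : ∀ t, Measurable (ε t)) {C' : ℝ} (hC' : ∀ᵐ ω ∂P, ∀ t i, |x t ω i| ≤ C')
    (hdgp : DGPAssumption P x ε δ₀ σsq₀ SigX) (hstat : IsStrictlyStationary P x ε)
    (hπ : IsBreakPrior 𝓗 τ₀ p)
    (hprior : IsGaussianPrior prior H μ K a b) (hdef : H.PosDef ∨ closure 𝓗 ⊆ Set.Ioo 0 1)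
    (hR : R.rank = dz) (hl : 0 < l) (hSig : ∀ v, 2 * l * (v ⬝ᵥ v) ≤ v ⬝ᵥ (SigX *ᵥ v))
    (hs : 0 < σsq₀) (hC0 : 0 ≤ C) (hC : ∀ᵐ ω ∂P, ∀ t, x t ω ⬝ᵥ x t ω ≤ C ^ 2)
    (hw₀ : R *ᵥ δ₀ ≠ 0)
    (hmode : ∀ᶠ T in atTop, ∀ᵐ ω ∂P, IsPosteriorMode R prior p 𝓗 T
        (fun t => x t ω) (response R x ε β₀ δ₀ τ₀ T ω) (τB T ω)) :
    ∃ κ₁ > 0, ∀ n N₁ : ℕ, ∃ κ₂ > 0, ∀ N₂ : ℕ, ∀ᶠ T in atTop, ∀ᵐ ω ∂P,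
      SampleGood κ₁ N₁ SigX σsq₀ (fun t => x t ω) (fun t => ε t ω) T (breakDate T τ₀) →
      SampleGood κ₂ N₂ SigX σsq₀ (fun t => x t ω) (fun t => ε t ω) T (breakDate T τ₀) →
      shiftPath (breakDate T τ₀) (samplePath x ε ω) ∈ gapPaths (R *ᵥ δ₀) n →
      breakDate T (τB T ω) - breakDate T τ₀
        = argmax (pathWalk (R *ᵥ δ₀) (shiftPath (breakDate T τ₀) (samplePath x ε ω))) := by
  have hmem : 𝓗 ∈ 𝓝 τ₀ := mem_interior_iff_mem_nhds.1 hπ.mem_interior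
  have hτ₀ : τ₀ ∈ 𝓗 := interior_subset hπ.mem_interior
  have hp₀ := hπ.pos
  have hb := hprior.rate_nonneg
  obtain ⟨c, hc, hbr⟩ := exists_eventually_interiorBreak (d := dx) (hπ.subset hτ₀) C
  obtain ⟨Bd, hBd⟩ := exists_prior_le hx hε hC' hdgp hstat hπ hprior hdef hR hl hSig hs hC hmode
  obtain ⟨κc, hκc, r, hr, hcmp⟩ := exists_posteriorMode_comparison hπ hprior hdef hR hl hSig hs hC
    hmode
  obtain ⟨κg, hκg, hκg1, g, hg, hgrow⟩ := exists_profile_growth hl hSig hs.le hC0 hc hw₀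
    (u := fun γ : Fin dx ⊕ Fin dz → ℝ => γ ∘ Sum.inl - β₀) (w := fun γ => R *ᵥ (γ ∘ Sum.inr))
    (pen := fun γ => (γ - μ) ⬝ᵥ (H *ᵥ (γ - μ))) (γ₀ := Sum.elim β₀ δ₀)
    (fun γ => hprior.nonneg _) (by simp) (by simp)
  obtain ⟨κd, hκd, r₁, hr₁, hform⟩ := exists_le_designForm hR hl hSig hc hprior.nonneg σsq₀
  obtain ⟨A, hA, hformle⟩ := exists_designForm_le R H C
  obtain ⟨r₂, hr₂, hformadd⟩ := exists_designForm_le_add R H C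
  set E : ℝ := (Fintype.card (Fin dx ⊕ Fin dz) : ℝ) / 2 with hE
  -- The profile at `k₀` is at most `(σsq₀ + 2) T`; one further `T` absorbs the rate `b` and an
  -- increment of at most `1`.
  set Aq := σsq₀ + 3 with hAq
  have hAq0 : 0 < Aq := by positivity
  have hBd0 : 0 < Bd := hp₀.trans_le (hBd _ hτ₀)
  -- The distance beyond which the gain `1 + g |k - k₀| / (4 Aq)` outweighs the bounded ratios of
  -- prior densities and Gaussian masses.
  set M₀ := ⌈Bd * (r₁ / A) ^ (-E) / p τ₀ * (4 * Aq) / g⌉₊ with hM₀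
  refine ⟨min κg (min κc κd), lt_min hκg (lt_min hκc hκd), fun n N₁ => ?_⟩
  set ρ : ℝ := 1 / (4 * ((n : ℝ) + 1)) with hρdef
  have hρ : 0 < ρ := by positivity
  have hρ1 : ρ ≤ 1 := by
    rw [hρdef, div_le_one (by positivity)]
    linarith [Nat.cast_nonneg (α := ℝ) n]
  obtain ⟨κ₂, hκ₂, hnear⟩ := exists_profile_near hl hSig hs.le hC0 hc (w₀ := R *ᵥ δ₀)
    (u := fun γ : Fin dx ⊕ Fin dz → ℝ => γ ∘ Sum.inl - β₀) (w := fun γ => R *ᵥ (γ ∘ Sum.inr))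
    (pen := fun γ => (γ - μ) ⬝ᵥ (H *ᵥ (γ - μ))) (γ₀ := Sum.elim β₀ δ₀)
    (fun γ => hprior.nonneg _) (by simp) (by simp) (n + (N₁ + M₀)) N₁ hρ
  refine ⟨κ₂, hκ₂, fun N₂ => ?_⟩
  -- The tolerance for the prior density and the design form near `τ₀`, small enough not to offset
  -- the gain from a profile gap of `2 ρ`.
  obtain ⟨z, hz, hzlt⟩ := exists_one_add_mul_rpow_lt E (x := 2 * ρ / (4 * Aq)) (by positivity)
  have hU : {τ | τ ∈ 𝓗 ∧ (1 - z) * p τ₀ < p τ ∧ p τ < (1 + z) * p τ₀} ∈ 𝓝 τ₀ := by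
    have h1 := hπ.continuousAt.eventually (eventually_gt_nhds
      (show (1 - z) * p τ₀ < p τ₀ by nlinarith))
    have h2 := hπ.continuousAt.eventually (eventually_lt_nhds
      (show p τ₀ < (1 + z) * p τ₀ by nlinarith))
    exact Filter.Eventually.and hmem (h1.and h2)
  filter_upwards [hcmp N₁, hgrow N₁, hform N₁, hnear N₂, hbr, eventually_exists_breakDate_eq hU n,
    eventually_mem_of_breakDate_near hU (N₁ + M₀),
    eventually_mul_rpow_lt E A r hA hr (show 0 < g * c / Aq by positivity) hp₀ Bd,
    eventually_natCast_ge (b + 1), eventually_natCast_ge (4 * E + 4),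
    eventually_le_mul_natCast (N₁ : ℝ) hc,
    eventually_le_mul_natCast (r₂ * (n + (N₁ + M₀ : ℕ) : ℝ)) (show 0 < z * r₁ by positivity)]
    with T hcmpT hgrowT hformT hnearT hbrT hexT hnearU hfarT hTb hTE hTc hTz
  filter_upwards [hcmpT, hC] with ω hω hCω hg₁ hg₂ hgap
  have hE0 : 0 ≤ E := by positivity
  have hT4 : (4 : ℝ) ≤ T := by linarith
  have hT0 : (0 : ℝ) < T := by linarith
  have hTpos : 0 < T := by exact_mod_cast hT0
  set k₀ := breakDate T τ₀ with hk₀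
  set k := breakDate T (τB T ω) with hk
  set Q := breakProfile R H μ β₀ δ₀ T (fun t => x t ω) (fun t => ε t ω) k₀ with hQ
  obtain ⟨hτB, hQ₀, hqpos, hformr, hle⟩ :=
    hω (hg₁.mono ((min_le_right _ _).trans (min_le_left _ _)))
  have hbr' := hbrT _ hCω
  set ν : ℝ := T / 2 + a - E with hν
  have hν4 : (T : ℝ) / 4 ≤ ν := by linarith [hprior.shape_nonneg]
  have hν1 : 1 ≤ ν := by linarith
  obtain ⟨hk0, hkT⟩ := breakDate_mem (T := T) (hπ.subset hτB)
  have hgr : (N₁ : ℝ) ≤ |(k : ℝ) - k₀| → Q k₀ + g * |(k : ℝ) - k₀| ≤ Q k := fun h =>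
    hgrowT _ _ _ hbr' (hg₁.mono (min_le_left _ _)) k hk0 hkT h
  have hq₀A : Q k₀ + b ≤ Aq * T := by
    have : (σsq₀ + 2) * T + T = Aq * T := by rw [hAq]; ring
    linarith
  -- Far dates: the mass ratio is controlled only up to a power of `T`, but a profile increment of
  -- order `T` makes the likelihood ratio exponentially large.
  have hkc : |(k : ℝ) - k₀| < c * T := by
    by_contra hcon
    rw [not_lt] at hcon
    have h1 := hgr (hTc.trans hcon)
    have h2 : g * (c * T) ≤ g * |(k : ℝ) - k₀| := by gcongr
    have h3 := (one_add_le_div_rpow (hqpos _ hτ₀) hAq0 hT0 hq₀A (Δ := g * (c * T)) (by positivity)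
      (q := Q k + b) (by linarith) hν4 hν1).2
    have h4 : g * (c * T) / (Aq * T) = g * c / Aq := by field_simp
    rw [h4] at h3
    have h5 := hle τ₀ hτ₀ (r / (A * T)) (by positivity) fun γ => by
      refine le_trans ?_ (hformr _ hτB γ)
      calc r / (A * T) * designForm R H T (fun t => x t ω) τ₀ γ
          ≤ r / (A * T) * (A * T * (γ ⬝ᵥ γ)) := by
            gcongr
            exact hformle T hTpos _ hCω τ₀ γ
        _ = r * (γ ⬝ᵥ γ) := by field_simp
    have h6 : p τ₀ * (1 + g * c / Aq) ^ ((T : ℝ) / 4) ≤ p τ₀ * ((Q k + b) / (Q k₀ + b)) ^ ν := by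
      gcongr
    have h7 : p (τB T ω) * (r / (A * T)) ^ (-E) ≤ Bd * (r / (A * T)) ^ (-E) := by
      gcongr
      exact hBd _ hτB
    linarith only [h5, h6, h7, hfarT]
  have hkabs := abs_lt.1 hkc
  have hformk : ∀ γ, r₁ * T * (γ ⬝ᵥ γ) ≤ designForm R H T (fun t => x t ω) (τB T ω) γ := by
    refine hformT _ _ _ (hg₁.mono ((min_le_right _ _).trans (min_le_right _ _))) (τB T ω) ?_ ?_
    · linarith [hbr'.left]
    · linarith [hbr'.right]
  -- Dates away from both ends: the design form is now of exact order `T`, so the mass ratio is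
  -- bounded and linear growth of the profile suffices.
  have hkM : |(k : ℝ) - k₀| ≤ (N₁ + M₀ : ℕ) := by
    by_contra hcon
    rw [not_le] at hcon
    push_cast at hcon
    have h1 := hgr (by linarith [Nat.cast_nonneg (α := ℝ) M₀])
    have h3 := (one_add_le_div_rpow (hqpos _ hτ₀) hAq0 hT0 hq₀A (Δ := g * |(k : ℝ) - k₀|)
      (by positivity) (q := Q k + b) (by linarith) hν4 hν1).1
    have h5 := hle τ₀ hτ₀ (r₁ / A) (by positivity) fun γ => by
      refine le_trans ?_ (hformk γ)
      calc r₁ / A * designForm R H T (fun t => x t ω) τ₀ γ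
          ≤ r₁ / A * (A * T * (γ ⬝ᵥ γ)) := by
            gcongr
            exact hformle T hTpos _ hCω τ₀ γ
        _ = r₁ * T * (γ ⬝ᵥ γ) := by field_simp
    have h6 : p τ₀ * (1 + g * |(k : ℝ) - k₀| / (4 * Aq))
        ≤ p τ₀ * ((Q k + b) / (Q k₀ + b)) ^ ν := by
      gcongr
    have h7 : p (τB T ω) * (r₁ / A) ^ (-E) ≤ Bd * (r₁ / A) ^ (-E) := by
      gcongr
      exact hBd _ hτB
    have h8 : Bd * (r₁ / A) ^ (-E) / p τ₀ * (4 * Aq) / g < |(k : ℝ) - k₀| :=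
      (Nat.le_ceil _).trans_lt (by linarith [Nat.cast_nonneg (α := ℝ) N₁])
    rw [div_lt_iff₀ hg, div_mul_eq_mul_div, div_lt_iff₀ hp₀] at h8
    have h9 : Bd * (r₁ / A) ^ (-E) < p τ₀ * (1 + g * |(k : ℝ) - k₀| / (4 * Aq)) := by
      have h10 : p τ₀ * (1 + g * |(k : ℝ) - k₀| / (4 * Aq))
          = p τ₀ + |(k : ℝ) - k₀| * g * p τ₀ / (4 * Aq) := by ring
      rw [h10]
      have h11 : Bd * (r₁ / A) ^ (-E) < |(k : ℝ) - k₀| * g * p τ₀ / (4 * Aq) := by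
        rwa [lt_div_iff₀ (by positivity)]
      linarith only [h11, hp₀]
    linarith only [h5, h6, h7, h9]
  obtain ⟨hmn, hgap'⟩ := argmax_of_mem_gapPaths hgap
  set m := argmax (pathWalk (R *ᵥ δ₀) (shiftPath k₀ (samplePath x ε ω))) with hm
  obtain ⟨τ', ⟨hτ', hpτ', -⟩, hkm⟩ := hexT m hmn
  obtain ⟨hkm0, hkmT⟩ := breakDate_mem (T := T) (hπ.subset hτ')
  rw [hkm] at hkm0 hkmT
  have hmn' : |(m : ℝ)| ≤ n := by exact_mod_cast hmn
  have hN₁ := Nat.cast_nonneg (α := ℝ) N₁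
  have hM₀' := Nat.cast_nonneg (α := ℝ) M₀
  have hn' := Nat.cast_nonneg (α := ℝ) n
  have hmid := hg₁.mid.mono ((min_le_left _ _).trans hκg1)
  have h1 : |Q k₀ - Q k - walk (fun t => x t ω) (fun t => ε t ω) (R *ᵥ δ₀) k₀ k| ≤ ρ :=
    hnearT _ _ _ hbr' hg₂ hmid k hk0 hkT (by push_cast at hkM ⊢; linarith)
  have h2 : |Q k₀ - Q (k₀ + m)
      - walk (fun t => x t ω) (fun t => ε t ω) (R *ᵥ δ₀) k₀ (k₀ + m)| ≤ ρ :=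
    hnearT _ _ _ hbr' hg₂ hmid (k₀ + m) hkm0 hkmT (by
      push_cast
      rw [add_sub_cancel_left]
      linarith)
  rw [abs_le] at h1 h2
  by_contra hne
  have h5 : 1 / ((n : ℝ) + 1) = 4 * ρ := by
    rw [hρdef]
    field_simp
  have h3 := hgap' (k - k₀) hne
  rw [pathWalk_shiftPath, pathWalk_shiftPath, add_sub_cancel, h5] at h3
  have hgapQ : Q (k₀ + m) + 2 * ρ ≤ Q k := by linarith only [h1, h2, h3]
  -- The walk vanishes at `k₀`, so it is nonnegative at its maximizer.
  have hQm : Q (k₀ + m) ≤ Q k₀ + ρ := by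
    by_cases hm0 : m = 0
    · rw [hm0, add_zero]
      linarith only [hρ]
    · have h4 := hgap' 0 (Ne.symm hm0)
      rw [pathWalk_shiftPath, pathWalk_shiftPath, add_zero, walk_self, h5] at h4
      linarith only [h2, h4, hρ]
  have hqmA : Q (k₀ + m) + b ≤ Aq * T := by
    have : (σsq₀ + 2) * T + T = Aq * T := by rw [hAq]; ring
    linarith only [this, hQm, hQ₀, hTb, hρ1]
  have hqmpos := hqpos τ' hτ'
  rw [hkm] at hqmpos
  have h6 := (one_add_le_div_rpow hqmpos hAq0 hT0 hqmA (Δ := 2 * ρ) (by positivity)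
      (q := Q k + b) (by linarith only [hgapQ]) hν4 hν1).1
  -- In a bounded window the two design forms differ by boundedly many rows, negligible against a
  -- form of order `T`; their ratio is therefore within the factor `1 + z`.
  have h7 := hle τ' hτ' (1 + z)⁻¹ (by positivity) fun γ => by
    rw [inv_mul_le_iff₀ (by positivity)]
    have h8 := hformadd T _ hCω (τB T ω) τ' γ
    have h9 := hformk γ
    have h10 : |((breakDate T τ' : ℤ) : ℝ) - (breakDate T (τB T ω) : ℤ)|
        ≤ n + (N₁ + M₀ : ℕ) := by
      rw [hkm, ← hk]
      have : (((k₀ + m : ℤ) : ℝ) - k) = m - (k - k₀) := by push_cast; ring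
      rw [this]
      exact (abs_sub _ _).trans (add_le_add hmn' hkM)
    have hγ := dotProduct_self_nonneg' γ
    have h11 : r₂ * |((breakDate T τ' : ℤ) : ℝ) - (breakDate T (τB T ω) : ℤ)| * (γ ⬝ᵥ γ)
        ≤ z * r₁ * T * (γ ⬝ᵥ γ) := by
      refine mul_le_mul_of_nonneg_right (le_trans ?_ hTz) hγ
      gcongr
    have h12 : z * (r₁ * T * (γ ⬝ᵥ γ))
        ≤ z * designForm R H T (fun t => x t ω) (τB T ω) γ := by gcongr
    linarith only [h8, h11, h12]
  obtain ⟨-, -, hpB⟩ := hnearU (τB T ω) (by exact_mod_cast hkM)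
  rw [hkm] at h7
  have hz0 : 0 < (1 + z)⁻¹ ^ (-E) := Real.rpow_pos_of_pos (by positivity) _
  have h13 : (1 - z) * p τ₀ * (1 + 2 * ρ / (4 * Aq))
      ≤ p τ' * ((Q k + b) / (Q (k₀ + m) + b)) ^ ν := by
    have h14 : 0 < 1 + 2 * ρ / (4 * Aq) := by positivity
    calc (1 - z) * p τ₀ * (1 + 2 * ρ / (4 * Aq)) ≤ p τ' * (1 + 2 * ρ / (4 * Aq)) := by gcongr
      _ ≤ _ := by
        have := hπ.nonneg _ hτ'
        gcongr
  have h15 : p (τB T ω) * (1 + z)⁻¹ ^ (-E) ≤ (1 + z) * p τ₀ * (1 + z)⁻¹ ^ (-E) := by gcongr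
  have h16 : p τ₀ * ((1 + z) * (1 + z)⁻¹ ^ (-E)) < p τ₀ * ((1 - z) * (1 + 2 * ρ / (4 * Aq))) := by
    gcongr
  linarith only [h7, h13, h15, h16]

end PosteriorModeLimit

/-! ### The limit theorem -/

theorem corollary1
    {Ω : Type*} [MeasurableSpace Ω] (P : Measure Ω) [IsProbabilityMeasure P]
    {dx dz : ℕ}
    -- the regressors and errors, and the sample space of the regressors
    (x : ℤ → Ω → Fin dx → ℝ) (ε : ℤ → Ω → ℝ)
    (hx : ∀ t, Measurable (x t)) (hε : ∀ t, Measurable (ε t))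
    (𝒳 : Set (Fin dx → ℝ)) (h𝒳 : Convex ℝ 𝒳) (h𝒳b : Bornology.IsBounded 𝒳)
    (hx𝒳 : ∀ t, ∀ᵐ ω ∂P, x t ω ∈ 𝒳)
    -- the known matrix defining `z_t = R' x_t`
    (R : Matrix (Fin dx) (Fin dz) ℝ) (hR : R.rank = dz)
    -- the true parameters and the space of break locations
    (β₀ : Fin dx → ℝ) (δ₀ : Fin dz → ℝ) (σsq₀ : ℝ) (hσ : 0 < σsq₀) (τ₀ : ℝ)
    (𝓗 : Set ℝ) (h𝓗 : 𝓗 ⊆ Set.Ioo 0 1) (h𝓗m : MeasurableSet 𝓗) (hτ₀ : τ₀ ∈ interior 𝓗)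
    -- the data generating process
    (SigX : Matrix (Fin dx) (Fin dx) ℝ)
    (hdgp : DGPAssumption P x ε δ₀ σsq₀ SigX)
    (hstat : IsStrictlyStationary P x ε)
    -- the maximizer of `W*` is almost surely unique
    (huniq : ∀ᵐ ω ∂P, ∀ m m' : ℤ,
      IsArgmax (Wstar R x ε δ₀ ω) m → IsArgmax (Wstar R x ε δ₀ ω) m' → m = m')
    -- the prior on `(γ, σ²)`: natural conjugate, or its uninformative limit
    (prior : (Fin dx ⊕ Fin dz → ℝ) → ℝ → ℝ)
    (hprior :
      (∃ (μ : Fin dx ⊕ Fin dz → ℝ) (H : Matrix (Fin dx ⊕ Fin dz) (Fin dx ⊕ Fin dz) ℝ) (a b : ℝ),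
        H.PosDef ∧ 0 < a ∧ 0 < b ∧ prior = conjugatePrior μ H a b)
      ∨ (prior = improperPrior ∧ closure 𝓗 ⊆ Set.Ioo 0 1))
    -- the prior density of the break location on `𝓗`
    (priorτ : ℝ → ℝ) (hpriorτ_nonneg : ∀ τ ∈ 𝓗, 0 ≤ priorτ τ)
    (hpriorτ_int : IntegrableOn priorτ 𝓗) (hpriorτ_one : ∫ τ in 𝓗, priorτ τ = 1)
    (hpriorτ_pos : 0 < priorτ τ₀) (hpriorτ_cont : ContinuousAt priorτ τ₀) :
    -- `W*` almost surely attains its maximum at `argmax W*`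
    (∀ᵐ ω ∂P, IsArgmax (Wstar R x ε δ₀ ω) (argmax (Wstar R x ε δ₀ ω))) ∧
    -- limit law of the posterior mode
    (∀ τBayes : ℕ → Ω → ℝ, (∀ T, AEMeasurable (τBayes T) P) →
      (∀ᶠ T in atTop, ∀ᵐ ω ∂P, IsPosteriorMode R prior priorτ 𝓗 T
        (fun t => x t ω) (response R x ε β₀ δ₀ τ₀ T ω) (τBayes T ω)) →
      TendstoInDistribution (fun T ω => breakDate T (τBayes T ω) - breakDate T τ₀) atTop
        (fun ω => argmax (Wstar R x ε δ₀ ω)) (fun _ => P) P) ∧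
    -- the same limit law for the least-squares estimator
    (∀ τLS : ℕ → Ω → ℝ, (∀ T, AEMeasurable (τLS T) P) →
      (∀ᶠ T in atTop, ∀ᵐ ω ∂P, IsLeastSquares R 𝓗 T
        (fun t => x t ω) (response R x ε β₀ δ₀ τ₀ T ω) (τLS T ω)) →
      TendstoInDistribution (fun T ω => breakDate T (τLS T ω) - breakDate T τ₀) atTop
        (fun ω => argmax (Wstar R x ε δ₀ ω)) (fun _ => P) P) := by
  -- Full column rank turns a nonzero shift of the `z`-coefficients into a nonzero shift of the
  -- regression slope, the source of the drift.
  have hw₀ : R *ᵥ δ₀ ≠ 0 := fun h => hdgp.delta_ne_zero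
    (mulVec_injective_of_rank_eq hR (h.trans (mulVec_zero R).symm))
  obtain ⟨l', hl', hSig'⟩ := exists_dotProduct_mulVec_ge hdgp.secondMoment_posDef
  have hSig : ∀ v, 2 * (l' / 2) * (v ⬝ᵥ v) ≤ v ⬝ᵥ (SigX *ᵥ v) := fun v => by
    rw [mul_div_cancel₀ l' two_ne_zero]
    exact hSig' v
  obtain ⟨C, hC0, hC, hC'⟩ := exists_bound_of_ae_mem h𝒳b hx𝒳
  have hW : ∀ ω, Wstar R x ε δ₀ ω = pathWalk (R *ᵥ δ₀) (samplePath x ε ω) :=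
    Wstar_eq_pathWalk R x ε δ₀
  simp only [hW] at huniq ⊢
  have hgap := ae_exists_mem_gapPaths hx hε hC' hdgp hstat hw₀ huniq
  have hmeas : ∀ τ : ℕ → Ω → ℝ, (∀ T, AEMeasurable (τ T) P) →
      ∀ T, AEMeasurable (fun ω => breakDate T (τ T ω) - breakDate T τ₀) P := by
    intro τ hτ T
    have h1 : Measurable fun u : ℝ => breakDate T u - breakDate T τ₀ :=
      (Int.measurable_floor.comp (measurable_id.mul_const _)).sub_const _
    exact h1.comp_aemeasurable (hτ T)
  refine ⟨?_, fun τB hτB hmode => ?_, fun τLS hτLS hLS => ?_⟩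
  · filter_upwards [hgap] with ω ⟨n, hn⟩ using isArgmax_of_mem_gapPaths hn
  · have hπ : IsBreakPrior 𝓗 τ₀ priorτ :=
      ⟨h𝓗, h𝓗m, hτ₀, hpriorτ_nonneg, hpriorτ_int, hpriorτ_pos, hpriorτ_cont⟩
    obtain ⟨H, μ, K, a, b, hgauss, hdef⟩ : ∃ H μ K a b, IsGaussianPrior prior H μ K a b ∧
        (H.PosDef ∨ closure 𝓗 ⊆ Set.Ioo 0 1) := by
      rcases hprior with ⟨μ, H, a, b, hH, ha, hb, rfl⟩ | ⟨rfl, hcl⟩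
      · obtain ⟨K, hK⟩ := isGaussianPrior_conjugatePrior (μ := μ) hH ha hb
        exact ⟨H, μ, K, _, _, hK, Or.inl hH⟩
      · exact ⟨0, 0, 1, 0, 0, isGaussianPrior_improperPrior, Or.inr hcl⟩
    exact tendstoInDistribution_of_good_samples hx hε hC' hdgp hstat hgap (hmeas τB hτB)
      (fun T => breakDate T τ₀) (posteriorMode_eq_argmax hx hε hC' hdgp hstat hπ hgauss hdef hR
        (half_pos hl') hSig hσ hC0 hC hw₀ hmode)
  · exact tendstoInDistribution_of_good_samples hx hε hC' hdgp hstat hgap (hmeas τLS hτLS)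
      (fun T => breakDate T τ₀) (leastSquares_eq_argmax h𝓗 hτ₀ (half_pos hl') hSig hσ.le hC0 hC hw₀
        hLS)
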